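/- All graphs are finite and simple. A coloring of a graph $G$ is distinguishing if it is proper and no non-trivial automorphism of $G$ maps every color class to itself; $\chi_D(G)$ is the least number of colors in a distinguishing coloring of $G$. $G\cup H$ is the disjoint union, $rG$ the disjoint union of $r$ copies of $G$, $G\vee H$ the join, $\overline{K_r}$ the edgeless graph on $r$ vertices. A complete multipartite graph may have one part only (an edgeless graph); it is nonvacuous if it has a vertex. For a graph $\Gamma$ with ordered vertices $v_1,\dots,v_n$, $\Gamma(H_1,\dots,H_n)$ is obtained from $\Gamma$ by replacing each $v_i$ by a copy of $H_i$ and each edge $v_iv_j$ by $H_i\vee H_j$. Put $\hat K_2(H_1,H_2)=H_1\vee H_2$ and $\hat K_3(H_1,H_2,H_3)=H_1\vee H_2\vee H_3$. Let - $\mathcal G_3$ consist of the two graphs on $v_1,\dots,v_5$ with edges $v_1v_2,v_1v_3,v_2v_3,v_2v_4,v_3v_5$, without or with the further edge $v_4v_5$; - $\hat G_5$ be the path $v_1v_2v_3v_4$; - $\hat G_6$ be the graph on $v_1,\dots,v_5$ with edges $v_1v_2,v_2v_3,v_3v_4,v_2v_4$ (so $v_5$ is isolated); - $\hat G_7$ be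 the graph on $v_1,\dots,v_6$ with edges $v_1v_2,v_2v_3,v_3v_4,v_4v_5,v_5v_6,v_6v_1,v_1v_4,v_1v_3,v_2v_4,v_2v_6,v_3v_5$. Let $\mathcal F$ be the class of all graphs isomorphic to one of the following, where $H_1,H_2,H_3,H_4$ stand for arbitrary nonvacuous complete multipartite graphs: (a) $P_5$; (b) $C_5$; (c) $C_6$; (d) $2K_3$; (e) $\overline{K_r}\cup K_2$, $r\ge 2$; (f) $\hat K_2(\overline{K_r},H_1)\cup K_2$, $r\ge 2$; (g) $\hat K_3(H_1,H_2,H_3)\cup K_2$; (h) $\hat K_2(H_1,H_2)\cup\overline{K_2}$; (i) $2K_2\vee 2K_2$; (j) $2K_2\vee(\hat K_2(H_1,H_2)\cup K_1)$; (k) $2K_2\cup K_1$; (l) $(2K_2\vee H_1)\cup K_1$; (m) $\hat G_3(H_1,H_2,H_3,K_1,K_1)$, $\hat G_3\in\mathcal G_3$; (n) $\hat G_5(H_1,H_2,K_1,K_1)$; (o) $\hat G_5(K_1,H_1,H_2,K_1)$; (p) $\hat G_6(K_1,H_1,H_2,H_3,K_1)$; (q) $\hat G_7(H_1,H_2,H_3,H_4,K_1,K_1)$.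 **Theorem.** Let $G$ be a graph of order $n\ge 4$ with $\chi_D(G)=n-2$. Then: (a) $\chi_D(G\cup G)=\chi_D(G)$ if and only if - ($a_1$) $G$ is isomorphic to the join of a nonvacuous complete multipartite graph with a graph in $\mathcal F$, or - ($a_2$) $G$ is isomorphic to one of the following, for some nonvacuous complete multipartite graphs $H_1,H_2,H_3,H_4$: $P_5$; $C_5$; $C_6$; $2K_3$; $2K_2\vee 2K_2$; $\hat K_2(\overline{K_r},H_1)\cup K_2$ with $r\ge 2$; $(2K_2\vee H_1)\cup K_1$; $2K_2\vee(\hat K_2(H_1,H_2)\cup K_1)$; $\hat G_7(H_1,H_2,H_3,H_4,K_1,K_1)$; $\hat G_3(H_1,H_2,H_3,K_1,K_1)$ with $\hat G_3\in\mathcal G_3$; $\hat G_6(K_1,H_1,H_2,H_3,K_1)$; $\hat K_3(H_1,H_2,H_3)\cup K_2$ with $\hat K_3(H_1,H_2,H_3)$ not complete; $\hat K_2(H_1,H_2)\cup\overline{K_2}$ with $\hat K_2(H_1,H_2)$ not complete and of order at least $4$; $\hat G_5(H_1,H_2,K_1,K_1)$ with $H_1\not\cong K_1$ or $H_2\not\cong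 K_1$; $\hat G_5(K_1,H_1,H_2,K_1)$ with $H_1\not\cong K_1$ or $H_2\not\cong K_1$. (b) $\chi_D(G\cup G)=\chi_D(G)+1$ if and only if $G$ is isomorphic to one of: $K_{n-2}\cup K_2$; $P_3\cup\overline{K_2}$; $K_m\cup\overline{K_2}$ with $m\ge 3$; $2K_2\cup K_1$; $P_4$. (c) $\chi_D(G\cup G)=\chi_D(G)+2$ if and only if $G\cong K_2\cup\overline{K_2}$. (d) $\chi_D(G\cup G)=2\chi_D(G)$ if and only if $G\cong\overline{K_r}\cup K_2$ for some $r\ge 2$. -/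

import Mathlib

namespace DistChrom

open SimpleGraph

/-- A proper coloring `c` of `G` is distinguishing if the only automorphism of `G` that preserves
every color class of `c` is the identity. -/
def IsDistinguishing {V : Type*} {G : SimpleGraph V} {α : Type*} (c : G.Coloring α) : Prop :=
  ∀ f : G ≃g G, (∀ v, c (f v) = c v) → ∀ v, f v = v

/-- The distinguishing chromatic number `χ_D(G)`: the least number of colors in a proper
distinguishing coloring.  (Colors may remain unused; this does not affect the minimum.  For a
finite graph the set is nonempty, since giving distinct colors to all vertices works.) -/
noncomputable def chiD {V : Type*} (G : SimpleGraph V) : ℕ :=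
  sInf {k : ℕ | ∃ c : G.Coloring (Fin k), IsDistinguishing c}

/-- `G` and `H` are isomorphic. -/
def Isom {V W : Type*} (G : SimpleGraph V) (H : SimpleGraph W) : Prop := Nonempty (G ≃g H)

infix:25 " ≅g " => Isom

/-- The join `G ∨ H`: the disjoint union together with all edges between the two sides. -/
def join {V W : Type*} (G : SimpleGraph V) (H : SimpleGraph W) : SimpleGraph (V ⊕ W) :=
  (G ⊕g H) ⊔ completeBipartiteGraph V W

infixl:65 " ∨g " => join

/-- The substitution `Γ(H₁, …, Hₙ)`: each vertex `i` of `Γ` is replaced by a copy of `H i`, and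
each edge `ij` of `Γ` by all edges between the copies of `H i` and `H j`. -/
def substitute {ι : Type*} (Γ : SimpleGraph ι) {W : ι → Type*} (H : ∀ i, SimpleGraph (W i)) :
    SimpleGraph (Σ i, W i) where
  Adj p q := Γ.Adj p.1 q.1 ∨ ∃ i a b, p = ⟨i, a⟩ ∧ q = ⟨i, b⟩ ∧ (H i).Adj a b
  symm := by
    refine ⟨?_⟩
    rintro p q (h | ⟨i, a, b, hp, hq, h⟩)
    · exact Or.inl h.symm
    · exact Or.inr ⟨i, b, a, hq, hp, h.symm⟩
  loopless := by
    refine ⟨?_⟩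
    rintro p (h | ⟨i, a, b, hp, hq, h⟩)
    · exact h.ne rfl
    · rw [hp] at hq
      obtain ⟨-, h2⟩ := Sigma.mk.inj_iff.mp hq
      exact h.ne (eq_of_heq h2)

/-- The complete graph `K_n`. -/
abbrev K (n : ℕ) : SimpleGraph (Fin n) := ⊤

/-- The edgeless graph `K̄_n` on `n` vertices. -/
abbrev E (n : ℕ) : SimpleGraph (Fin n) := ⊥

/-- A finite nonvacuous complete multipartite graph (one part, i.e. an edgeless graph, is
allowed), with vertices numbered `0, …, order - 1`. -/
structure CMGraph where
  order : ℕ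
  order_pos : 0 < order
  graph : SimpleGraph (Fin order)
  isCompleteMultipartite : graph.IsCompleteMultipartite

/-- The one-vertex graph `K_1`, as a complete multipartite graph. -/
def CMGraph.one : CMGraph where
  order := 1
  order_pos := Nat.one_pos
  graph := K 1
  isCompleteMultipartite := by
    refine ⟨fun a b c _ _ h => ?_⟩
    exact h.ne (Subsingleton.elim a c)

/-- Substitution of complete multipartite graphs for the vertices of `Γ`. -/
def subst {n : ℕ} (Γ : SimpleGraph (Fin n)) (H : Fin n → CMGraph) :
    SimpleGraph (Σ i, Fin (H i).order) :=
  substitute Γ fun i => (H i).graph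

/-- The bull: the triangle `v₁v₂v₃` with pendant edges `v₂v₄` and `v₃v₅`. -/
def bull : SimpleGraph (Fin 5) :=
  fromEdgeSet {s(0, 1), s(0, 2), s(1, 2), s(1, 3), s(2, 4)}

/-- The house: the bull together with the edge `v₄v₅`. -/
def house : SimpleGraph (Fin 5) :=
  fromEdgeSet {s(0, 1), s(0, 2), s(1, 2), s(1, 3), s(2, 4), s(3, 4)}

/-- `Ĝ₅`: the path `v₁v₂v₃v₄`. -/
def G5 : SimpleGraph (Fin 4) :=
  fromEdgeSet {s(0, 1), s(1, 2), s(2, 3)}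

/-- `Ĝ₆`: the triangle `v₂v₃v₄` with a pendant edge `v₁v₂`, and an isolated vertex `v₅`. -/
def G6 : SimpleGraph (Fin 5) :=
  fromEdgeSet {s(0, 1), s(1, 2), s(2, 3), s(1, 3)}

/-- `Ĝ₇`: the 6-cycle `v₁v₂v₃v₄v₅v₆` with the chords `v₁v₄`, `v₁v₃`, `v₂v₄`, `v₂v₆`, `v₃v₅`. -/
def G7 : SimpleGraph (Fin 6) :=
  fromEdgeSet {s(0, 1), s(1, 2), s(2, 3), s(3, 4), s(4, 5), s(5, 0),
    s(0, 3), s(0, 2), s(1, 3), s(1, 5), s(2, 4)}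

/-- The seventeen families. -/
inductive BaseFamily {V : Type*} (G : SimpleGraph V) : Prop
  | a (h : G ≅g pathGraph 5)
  | b (h : G ≅g cycleGraph 5)
  | c (h : G ≅g cycleGraph 6)
  | d (h : G ≅g K 3 ⊕g K 3)
  | e (r : ℕ) (hr : 2 ≤ r) (h : G ≅g E r ⊕g K 2)
  | f (r : ℕ) (hr : 2 ≤ r) (H₁ : CMGraph) (h : G ≅g (E r ∨g H₁.graph) ⊕g K 2)
  | g (H₁ H₂ H₃ : CMGraph) (h : G ≅g (H₁.graph ∨g H₂.graph ∨g H₃.graph) ⊕g K 2)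
  | h (H₁ H₂ : CMGraph) (h : G ≅g (H₁.graph ∨g H₂.graph) ⊕g E 2)
  | i (h : G ≅g (K 2 ⊕g K 2) ∨g (K 2 ⊕g K 2))
  | j (H₁ H₂ : CMGraph) (h : G ≅g (K 2 ⊕g K 2) ∨g ((H₁.graph ∨g H₂.graph) ⊕g K 1))
  | k (h : G ≅g (K 2 ⊕g K 2) ⊕g K 1)
  | l (H₁ : CMGraph) (h : G ≅g ((K 2 ⊕g K 2) ∨g H₁.graph) ⊕g K 1)
  | m (H₁ H₂ H₃ : CMGraph) (G3 : SimpleGraph (Fin 5)) (hG3 : G3 = bull ∨ G3 = house)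
      (h : G ≅g subst G3 ![H₁, H₂, H₃, .one, .one])
  | n (H₁ H₂ : CMGraph) (h : G ≅g subst G5 ![H₁, H₂, .one, .one])
  | o (H₁ H₂ : CMGraph) (h : G ≅g subst G5 ![.one, H₁, H₂, .one])
  | p (H₁ H₂ H₃ : CMGraph) (h : G ≅g subst G6 ![.one, H₁, H₂, H₃, .one])
  | q (H₁ H₂ H₃ H₄ : CMGraph) (h : G ≅g subst G7 ![H₁, H₂, H₃, H₄, .one, .one])

/-- The fifteen families of graphs `G`, themselves members of the seventeen families, for which
`χ_D(G ∪ G) = χ_D(G)`. -/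
inductive EqualFamily {V : Type*} (G : SimpleGraph V) : Prop
  | c1 (h : G ≅g pathGraph 5)
  | c2 (h : G ≅g cycleGraph 5)
  | c3 (h : G ≅g cycleGraph 6)
  | c4 (h : G ≅g K 3 ⊕g K 3)
  | c5 (h : G ≅g (K 2 ⊕g K 2) ∨g (K 2 ⊕g K 2))
  | c6 (r : ℕ) (hr : 2 ≤ r) (H₁ : CMGraph) (h : G ≅g (E r ∨g H₁.graph) ⊕g K 2)
  | c7 (H₁ : CMGraph) (h : G ≅g ((K 2 ⊕g K 2) ∨g H₁.graph) ⊕g K 1)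
  | c8 (H₁ H₂ : CMGraph) (h : G ≅g (K 2 ⊕g K 2) ∨g ((H₁.graph ∨g H₂.graph) ⊕g K 1))
  | c9 (H₁ H₂ H₃ H₄ : CMGraph) (h : G ≅g subst G7 ![H₁, H₂, H₃, H₄, .one, .one])
  | c10 (H₁ H₂ H₃ : CMGraph) (G3 : SimpleGraph (Fin 5)) (hG3 : G3 = bull ∨ G3 = house)
      (h : G ≅g subst G3 ![H₁, H₂, H₃, .one, .one])
  | c11 (H₁ H₂ H₃ : CMGraph) (h : G ≅g subst G6 ![.one, H₁, H₂, H₃, .one])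
  | c12 (H₁ H₂ H₃ : CMGraph) (hK : H₁.graph ∨g H₂.graph ∨g H₃.graph ≠ ⊤)
      (h : G ≅g (H₁.graph ∨g H₂.graph ∨g H₃.graph) ⊕g K 2)
  | c13 (H₁ H₂ : CMGraph) (hK : H₁.graph ∨g H₂.graph ≠ ⊤) (h4 : 4 ≤ H₁.order + H₂.order)
      (h : G ≅g (H₁.graph ∨g H₂.graph) ⊕g E 2)
  | c14 (H₁ H₂ : CMGraph) (hne : ¬ (H₁.graph ≅g K 1) ∨ ¬ (H₂.graph ≅g K 1))
      (h : G ≅g subst G5 ![H₁, H₂, .one, .one])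
  | c15 (H₁ H₂ : CMGraph) (hne : ¬ (H₁.graph ≅g K 1) ∨ ¬ (H₂.graph ≅g K 1))
      (h : G ≅g subst G5 ![.one, H₁, H₂, .one])

end DistChrom

open DistChrom

/-!
Two vertices of the same color in a distinguishing coloring cannot be twins, since exchanging them
would be an automorphism. Hence a graph `G` of order `n` has `χ_D(G)` at least `n` minus the size of
any set `S` meeting every non-adjacent pair of vertices with different neighborhoods
(`CoversPairs.card_le_chiD_add`). The proof first determines the graphs with `χ_D(G) = n - 2` and
then colors two copies of each.

**Structure.** In the complement `C`, color classes are cliques, and the pairs above are the edges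
whose ends are not twins, the *non-twin* edges. If `χ_D(G) ≥ n - 2`, then each partition of the
vertices into cliques that merges away three vertices is respected by a non-trivial automorphism
(`exists_perm_of_merge`). Applied to three disjoint edges, to a triangle with a disjoint edge, and to
four pairwise adjacent vertices, this gives strong symmetry: three disjoint non-twin edges either are
exchanged end for end by one automorphism, and then they span a prism or a `K_{3,3}` that is a
component of `C`, or two of them span a 4-cycle all of whose outside neighbors are adjacent to the
whole of it. A triangle of non-twin edges with a disjoint one spans a component that is a house, or
again leads to such a 4-cycle; a 5-cycle of non-twin edges is a component; four pairwise adjacent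
vertices cannot have all their edges non-twin. If none of these configurations is present, an
elementary argument (`exists_cover_pair`) covers the non-twin edges by two vertices. The outcome is
`coreType_of_le_chiD`. Vertices outside the exceptional part are adjacent to all of that part in `G`
or fall into a few types, and within each type non-adjacency is transitive, so that each type induces
a complete multipartite graph. Reading off the possible types gives the seventeen families, up to a
complete multipartite join factor (`exists_baseFamily`).

**Two copies.** A second copy of a connected graph `X` needs no further color as soon as `X` has two
distinguishing colorings that are not carried to each other by an automorphism
(`chiD_sum_self_le`). Exchanging two colors used a different number of times gives such a pair; if
`X` is connected of order `n ≥ 5` with `n - 2` colors, the classes cannot all have the same size. If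
`X` is not complete and has as many colors as vertices, a permutation of the colors that is not an
automorphism does. Small further components are colored separately. The exceptions are those `G`
whose large component is complete, where both copies would have to use all colors, those where the
isolated vertices of the two copies, which need different colors, are too many, and the two small
graphs `2K₂ ∪ K₁` and `P₄`.
-/

namespace DistChrom

open SimpleGraph

/-! ### The distinguishing chromatic number -/

section Basic

variable {V W : Type*} {G : SimpleGraph V} {H : SimpleGraph W} {α β : Type*}

theorem IsDistinguishing.comp_injective {c : G.Coloring α} (hc : IsDistinguishing c)
    {g : α → β} (hg : Function.Injective g) :
    ∃ c' : G.Coloring β, IsDistinguishing c' ∧ ∀ v, c' v = g (c v) :=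
  ⟨Coloring.mk (fun v => g (c v)) fun h e => c.valid h (hg e),
    fun f hf => hc f fun v => hg (hf v), fun _ => rfl⟩

theorem exists_isDistinguishing_of_injective {g : V → α} (hg : Function.Injective g) :
    ∃ c : G.Coloring α, IsDistinguishing c :=
  ⟨Coloring.mk g fun h e => h.ne (hg e), fun _ hf v => hg (hf v)⟩

theorem chiD_le_card [Fintype α] {c : G.Coloring α} (hc : IsDistinguishing c) :
    chiD G ≤ Fintype.card α := by
  obtain ⟨c', hc', -⟩ := hc.comp_injective (Fintype.equivFin α).injective
  exact Nat.sInf_le ⟨c', hc'⟩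

/-- Unused colors may be dropped. -/
theorem chiD_le_card_image [Fintype V] [DecidableEq α] {c : G.Coloring α}
    (hc : IsDistinguishing c) : chiD G ≤ (Finset.univ.image c).card := by
  have key : IsDistinguishing (G := G) (Coloring.mk
      (fun v => (⟨c v, Finset.mem_image_of_mem c (Finset.mem_univ v)⟩ : Finset.univ.image c))
      fun h e => c.valid h (congrArg Subtype.val e)) :=
    fun f hf => hc f fun v => congrArg Subtype.val (hf v)
  simpa using chiD_le_card key

theorem exists_coloring_of_chiD_le [Finite V] {k : ℕ} (hk : chiD G ≤ k) :
    ∃ c : G.Coloring (Fin k), IsDistinguishing c := by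
  obtain ⟨n, ⟨e⟩⟩ := Finite.exists_equiv_fin V
  obtain ⟨c, hc⟩ : chiD G ∈ {k : ℕ | ∃ c : G.Coloring (Fin k), IsDistinguishing c} :=
    Nat.sInf_mem ⟨n, exists_isDistinguishing_of_injective e.injective⟩
  obtain ⟨c', hc', -⟩ := hc.comp_injective (Fin.castLE_injective hk)
  exact ⟨c', hc'⟩

theorem chiD_le_of_coloring {k : ℕ} {c : G.Coloring (Fin k)} (hc : IsDistinguishing c) :
    chiD G ≤ k := by
  simpa using chiD_le_card hc

/-- Transport of a distinguishing coloring along an isomorphism. -/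
theorem IsDistinguishing.comp_iso {c : G.Coloring α} (hc : IsDistinguishing c) (e : H ≃g G) :
    ∃ c' : H.Coloring α, IsDistinguishing c' ∧ ∀ v, c' v = c (e v) := by
  refine ⟨Coloring.mk (fun v => c (e v)) fun h => c.valid (e.map_adj_iff.2 h),
    fun f hf v => ?_, fun _ => rfl⟩
  have := hc ((e.symm.trans f).trans e) (fun v =>
    (hf (e.symm v)).trans (congrArg c (e.apply_symm_apply v))) (e v)
  simpa using this

theorem chiD_congr [Finite V] [Finite W] (h : G ≅g H) : chiD G = chiD H := by
  obtain ⟨e⟩ := h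
  obtain ⟨c, hc⟩ := exists_coloring_of_chiD_le (le_refl (chiD G))
  obtain ⟨c', hc'⟩ := exists_coloring_of_chiD_le (le_refl (chiD H))
  obtain ⟨d, hd, -⟩ := hc.comp_iso e.symm
  obtain ⟨d', hd', -⟩ := hc'.comp_iso e
  exact le_antisymm (chiD_le_of_coloring hd') (chiD_le_of_coloring hd)

/-- In a distinguishing coloring, two vertices of the same color have different neighborhoods, as
otherwise exchanging them would be an automorphism. -/
theorem IsDistinguishing.exists_separating {c : G.Coloring α} (hc : IsDistinguishing c) {u v : V}
    (huv : u ≠ v) (hcuv : c u = c v) : ∃ w, ¬(G.Adj w u ↔ G.Adj w v) := by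
  classical
  by_contra! h
  have hnot : ¬G.Adj u v := fun hadj => c.valid hadj hcuv
  let f : G ≃g G := ⟨Equiv.swap u v, by
    intro a b
    have h1 := h a
    have h2 := h b
    simp only [G.adj_comm] at h1 h2
    simp only [Equiv.swap_apply_def]
    split_ifs <;> simp_all [G.adj_comm]⟩
  have h1 := hc f (fun w => by
    change c (Equiv.swap u v w) = c w
    rw [Equiv.swap_apply_def]
    split_ifs <;> simp_all) u
  exact huv ((Equiv.swap_apply_left u v).symm.trans h1).symm

/-- `CoversPairs G S`: any two vertices outside `S` that are equal or non-adjacent have the same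
neighbors.  Equivalently, `S` meets each pair of non-adjacent vertices with different
neighborhoods. -/
def CoversPairs (G : SimpleGraph V) (S : Set V) : Prop :=
  ∀ u v, u ∉ S → v ∉ S → ¬G.Adj u v → ∀ w, G.Adj w u ↔ G.Adj w v

/-- Vertices outside a covering set get distinct colors. -/
theorem CoversPairs.injOn {S : Set V} (hS : CoversPairs G S) {c : G.Coloring α}
    (hc : IsDistinguishing c) : Set.InjOn c Sᶜ := by
  intro u hu v hv h
  by_contra hne
  obtain ⟨w, hw⟩ := hc.exists_separating hne h
  exact hw (hS u v hu hv (fun hadj => c.valid hadj h) w)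

theorem CoversPairs.card_le_chiD_add [Fintype V] {S : Finset V}
    (hS : CoversPairs G (S : Set V)) : Fintype.card V ≤ chiD G + S.card := by
  classical
  obtain ⟨c, hc⟩ := exists_coloring_of_chiD_le (le_refl (chiD G))
  have h1 : (Sᶜ.image c).card = Sᶜ.card :=
    Finset.card_image_of_injOn (by simpa using hS.injOn hc)
  have h2 : (Sᶜ.image c).card ≤ chiD G := by
    simpa using Finset.card_le_univ (Sᶜ.image c)
  rw [h1, Finset.card_compl] at h2
  omega

end Basic

/-! ### Merging color classes -/

section Merge

variable {V : Type*} {C : SimpleGraph V}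

/-- If `Cᶜ` cannot be distinguished with fewer than `|V| - k` colors, then every partition of the
vertices into cliques of `C` with fewer classes is respected by some non-trivial automorphism.
The partition is given by a map `c` sending each vertex to a representative, missing `B`. -/
theorem exists_perm_of_merge [Fintype V] {k : ℕ} (hd : Fintype.card V ≤ chiD Cᶜ + k)
    (c : V → V) (hc : ∀ u v, u ≠ v → c u = c v → C.Adj u v) (B : Finset V) (hB : k < B.card)
    (hmiss : ∀ v, c v ∉ B) :
    ∃ f : Equiv.Perm V, (∀ u v, C.Adj (f u) (f v) ↔ C.Adj u v) ∧ (∀ v, c (f v) = c v) ∧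
      ∃ v, f v ≠ v := by
  classical
  by_contra! hcon
  have hdist : IsDistinguishing (G := Cᶜ) (Coloring.mk c fun {u v} h e =>
      h.2 (hc u v h.1 e)) := by
    intro f hf v
    refine hcon f.toEquiv (fun u v => ?_) hf v
    have h1 : Cᶜ.Adj (f u) (f v) ↔ Cᶜ.Adj u v := f.map_adj_iff
    simp only [compl_adj, ne_eq, EmbeddingLike.apply_eq_iff_eq] at h1
    change C.Adj (f u) (f v) ↔ C.Adj u v
    by_cases huv : u = v
    · simp [huv]
    · tauto
  have h1 := chiD_le_card_image hdist
  have h2 : (Finset.univ.image c) ⊆ Bᶜ := fun v hv => by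
    obtain ⟨w, -, rfl⟩ := Finset.mem_image.1 hv
    simpa using hmiss w
  have h3 := Finset.card_le_card h2
  have h4 := Finset.card_le_univ B
  rw [Finset.card_compl] at h3
  change chiD Cᶜ ≤ (Finset.univ.image c).card at h1
  omega

/-- Merging three disjoint edges of `C`: some automorphism exchanges the ends of at least one of
them and fixes all other vertices. -/
theorem exists_perm_of_three_pairs [Fintype V] (hd : Fintype.card V ≤ chiD Cᶜ + 2)
    {a b p q r s : V} (hnd : [a, b, p, q, r, s].Nodup) (hab : C.Adj a b) (hpq : C.Adj p q)
    (hrs : C.Adj r s) :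
    ∃ f : Equiv.Perm V, (∀ u v, C.Adj (f u) (f v) ↔ C.Adj u v) ∧
      (∀ v, f v = v ∨ v = a ∨ v = b ∨ v = p ∨ v = q ∨ v = r ∨ v = s) ∧
      ((f a = a ∧ f b = b) ∨ (f a = b ∧ f b = a)) ∧
      ((f p = p ∧ f q = q) ∨ (f p = q ∧ f q = p)) ∧
      ((f r = r ∧ f s = s) ∨ (f r = s ∧ f s = r)) ∧ ¬(f a = a ∧ f p = p ∧ f r = r) := by
  classical
  simp only [List.nodup_cons, List.mem_cons, List.not_mem_nil, or_false, not_or,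
    List.nodup_nil, not_false_eq_true, and_true] at hnd
  obtain ⟨f, hf, hfc, v, hv⟩ := exists_perm_of_merge hd
    (fun v => if v = b then a else if v = q then p else if v = s then r else v)
    (by intro u v; have := hab.symm; have := hpq.symm; have := hrs.symm; grind) {b, q, s}
    (by rw [Finset.card_eq_three.2 ⟨b, q, s, by grind⟩]; norm_num) (by grind)
  have hinj := f.injective
  -- vertices with the same representative lie in the same class
  have hcl : ∀ u v, (if u = b then a else if u = q then p else if u = s then r else u) =
      (if v = b then a else if v = q then p else if v = s then r else v) →
      ((v = a ∨ v = b) → u = a ∨ u = b) ∧ ((v = p ∨ v = q) → u = p ∨ u = q) ∧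
      ((v = r ∨ v = s) → u = r ∨ u = s) ∧
      (u = v ∨ v = a ∨ v = b ∨ v = p ∨ v = q ∨ v = r ∨ v = s) := by
    intro u v; grind
  have key : ∀ v, f v = v ∨ v = a ∨ v = b ∨ v = p ∨ v = q ∨ v = r ∨ v = s :=
    fun v => (hcl _ _ (hfc v)).2.2.2
  have ha := (hcl _ _ (hfc a)).1 (Or.inl rfl)
  have hb := (hcl _ _ (hfc b)).1 (Or.inr rfl)
  have hp := (hcl _ _ (hfc p)).2.1 (Or.inl rfl)
  have hq := (hcl _ _ (hfc q)).2.1 (Or.inr rfl)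
  have hr := (hcl _ _ (hfc r)).2.2.1 (Or.inl rfl)
  have hs := (hcl _ _ (hfc s)).2.2.1 (Or.inr rfl)
  have iab := hinj.ne hab.ne
  have ipq := hinj.ne hpq.ne
  have irs := hinj.ne hrs.ne
  clear hcl hfc
  refine ⟨f, hf, key, by grind only, by grind only, by grind only, ?_⟩
  rintro ⟨h1, h2, h3⟩
  have : v = a ∨ v = b ∨ v = p ∨ v = q ∨ v = r ∨ v = s :=
    (key v).resolve_left hv
  rcases this with rfl | rfl | rfl | rfl | rfl | rfl <;> grind only

/-- Merging a triangle and a disjoint edge of `C`: some non-trivial automorphism permutes each of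
them and fixes all other vertices. -/
theorem exists_perm_of_triangle_pair [Fintype V] (hd : Fintype.card V ≤ chiD Cᶜ + 2)
    {a b c d e : V} (hnd : [a, b, c, d, e].Nodup) (hab : C.Adj a b) (hac : C.Adj a c)
    (hbc : C.Adj b c) (hde : C.Adj d e) :
    ∃ f : Equiv.Perm V, (∀ u v, C.Adj (f u) (f v) ↔ C.Adj u v) ∧
      (∀ v, f v = v ∨ v = a ∨ v = b ∨ v = c ∨ v = d ∨ v = e) ∧
      (f a = a ∨ f a = b ∨ f a = c) ∧ (f b = a ∨ f b = b ∨ f b = c) ∧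
      (f c = a ∨ f c = b ∨ f c = c) ∧
      ((f d = d ∧ f e = e) ∨ (f d = e ∧ f e = d)) ∧
      ¬(f a = a ∧ f b = b ∧ f c = c ∧ f d = d) := by
  classical
  simp only [List.nodup_cons, List.mem_cons, List.not_mem_nil, or_false, not_or,
    List.nodup_nil, not_false_eq_true, and_true] at hnd
  obtain ⟨f, hf, hfc, v, hv⟩ := exists_perm_of_merge hd
    (fun v => if v = b then a else if v = c then a else if v = e then d else v)
    (by intro u v; have := hab.symm; have := hac.symm; have := hbc.symm; have := hde.symm; grind)
    {b, c, e} (by rw [Finset.card_eq_three.2 ⟨b, c, e, by grind⟩]; norm_num) (by grind)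
  have hinj := f.injective
  -- vertices with the same representative lie in the same class
  have hcl : ∀ u v, (if u = b then a else if u = c then a else if u = e then d else u) =
      (if v = b then a else if v = c then a else if v = e then d else v) →
      ((v = a ∨ v = b ∨ v = c) → u = a ∨ u = b ∨ u = c) ∧
      ((v = d ∨ v = e) → u = d ∨ u = e) ∧
      (u = v ∨ v = a ∨ v = b ∨ v = c ∨ v = d ∨ v = e) := by
    intro u v; grind
  have key : ∀ v, f v = v ∨ v = a ∨ v = b ∨ v = c ∨ v = d ∨ v = e :=
    fun v => (hcl _ _ (hfc v)).2.2
  have ha := (hcl _ _ (hfc a)).1 (Or.inl rfl)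
  have hb := (hcl _ _ (hfc b)).1 (Or.inr (Or.inl rfl))
  have hc := (hcl _ _ (hfc c)).1 (Or.inr (Or.inr rfl))
  have hd := (hcl _ _ (hfc d)).2.1 (Or.inl rfl)
  have he := (hcl _ _ (hfc e)).2.1 (Or.inr rfl)
  have ide := hinj.ne hde.ne
  clear hcl hfc
  refine ⟨f, hf, key, ha, hb, hc, by grind only, ?_⟩
  rintro ⟨h1, h2, h3, h4⟩
  have : v = a ∨ v = b ∨ v = c ∨ v = d ∨ v = e :=
    (key v).resolve_left hv
  rcases this with rfl | rfl | rfl | rfl | rfl <;> grind only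

/-- Merging four pairwise adjacent vertices of `C`: some automorphism moves one of them to another
and fixes all vertices outside. -/
theorem exists_perm_of_quadruple [Fintype V] (hd : Fintype.card V ≤ chiD Cᶜ + 2)
    {a b c d : V} (hab : C.Adj a b) (hac : C.Adj a c) (had : C.Adj a d)
    (hbc : C.Adj b c) (hbd : C.Adj b d) (hcd : C.Adj c d) :
    ∃ f : Equiv.Perm V, (∀ u v, C.Adj (f u) (f v) ↔ C.Adj u v) ∧
      (∀ v, f v = v ∨ v = a ∨ v = b ∨ v = c ∨ v = d) ∧ ∃ u v, u ≠ v ∧ f u = v ∧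
      (u = a ∨ u = b ∨ u = c ∨ u = d) ∧ (v = a ∨ v = b ∨ v = c ∨ v = d) := by
  classical
  have h1 := hab.ne
  have h2 := hac.ne
  have h3 := had.ne
  have h4 := hbc.ne
  have h5 := hbd.ne
  have h6 := hcd.ne
  obtain ⟨f, hf, hfc, v, hv⟩ := exists_perm_of_merge hd
    (fun v => if v = b then a else if v = c then a else if v = d then a else v)
    (by
      intro u v
      have := hab.symm; have := hac.symm; have := hbc.symm; have := had.symm
      have := hbd.symm; have := hcd.symm; grind)
    {b, c, d} (by rw [Finset.card_eq_three.2 ⟨b, c, d, by grind⟩]; norm_num) (by grind)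
  -- vertices with the same representative lie in the same class
  have hcl : ∀ u v, (if u = b then a else if u = c then a else if u = d then a else u) =
      (if v = b then a else if v = c then a else if v = d then a else v) →
      ((v = a ∨ v = b ∨ v = c ∨ v = d) → u = a ∨ u = b ∨ u = c ∨ u = d) ∧
      (u = v ∨ v = a ∨ v = b ∨ v = c ∨ v = d) := by
    intro u v; grind
  have key : ∀ v, f v = v ∨ v = a ∨ v = b ∨ v = c ∨ v = d := fun v => (hcl _ _ (hfc v)).2
  have hv' : v = a ∨ v = b ∨ v = c ∨ v = d :=
    (key v).resolve_left hv
  exact ⟨f, hf, key, v, f v, hv.symm, rfl, hv', (hcl _ _ (hfc v)).1 hv'⟩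

end Merge
/-! ### Pairs of adjacent vertices that are not twins -/

section NonTwin

variable {V : Type*} {C : SimpleGraph V}

/-- Adjacent vertices `u`, `v` with different closed neighborhoods. -/
def NonTwin (C : SimpleGraph V) (u v : V) : Prop :=
  C.Adj u v ∧ ∃ w, w ≠ u ∧ w ≠ v ∧ ¬(C.Adj w u ↔ C.Adj w v)

theorem NonTwin.symm {u v : V} (h : NonTwin C u v) : NonTwin C v u := by
  obtain ⟨h, w, h1, h2, h3⟩ := h
  exact ⟨h.symm, w, h2, h1, fun h => h3 h.symm⟩

/-- In the complement, a covering set is a vertex cover of the non-twin edges. -/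
theorem coversPairs_compl_iff {S : Set V} :
    CoversPairs Cᶜ S ↔ ∀ u v, u ∉ S → v ∉ S → ¬NonTwin C u v := by
  constructor
  · rintro h u v hu hv ⟨huv, w, h1, h2, h3⟩
    have := h u v hu hv (by simp [huv]) w
    simp only [compl_adj, ne_eq] at this
    tauto
  · intro h u v hu hv huv w
    by_cases hne : u = v
    · rw [hne]
    have hadj : C.Adj u v := by simpa [hne] using huv
    have h1 := fun w => not_and.1 (h u v hu hv) hadj ∘ fun h => ⟨w, h⟩
    have h2 := h1 w
    simp only [compl_adj, ne_eq]
    by_cases hwu : w = u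
    · subst hwu; simp [hadj]
    by_cases hwv : w = v
    · subst hwv; simp [hadj.symm]
    tauto

/-- `Linked C a b p q`: the vertices `a, b, q, p` form an induced 4-cycle in this order (given
that `ab` and `pq` are edges), and exchanging `a` with `b` and `p` with `q` is an automorphism. -/
def Linked (C : SimpleGraph V) (a b p q : V) : Prop :=
  C.Adj a p ∧ C.Adj b q ∧ ¬C.Adj a q ∧ ¬C.Adj b p ∧
    ∀ w, w ≠ a → w ≠ b → w ≠ p → w ≠ q → (C.Adj w a ↔ C.Adj w b) ∧ (C.Adj w p ↔ C.Adj w q)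

/-- An edge whose ends are exchanged by an automorphism fixing everything else joins twins. -/
theorem not_nonTwin_of_swap {f : V → V} (hf : ∀ u v, C.Adj (f u) (f v) ↔ C.Adj u v) {a b : V}
    (ha : f a = b) (hfix : ∀ w, w ≠ a → w ≠ b → f w = w) : ¬NonTwin C a b := by
  rintro ⟨-, w, h1, h2, h3⟩
  have := hf w a
  rw [ha, hfix w h1 h2] at this
  exact h3 this.symm

/-- Two edges exchanged end for end by an automorphism fixing everything else are linked, as
otherwise each would join twins. -/
theorem linked_of_swap {f : V → V} (hf : ∀ u v, C.Adj (f u) (f v) ↔ C.Adj u v) {a b p q : V}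
    (ha : f a = b) (hp : f p = q) (hq : f q = p)
    (hfix : ∀ w, w ≠ a → w ≠ b → w ≠ p → w ≠ q → f w = w) (hab : NonTwin C a b) :
    Linked C a b p q ∨ Linked C a b q p := by
  have hout : ∀ w, w ≠ a → w ≠ b → w ≠ p → w ≠ q →
      (C.Adj w a ↔ C.Adj w b) ∧ (C.Adj w p ↔ C.Adj w q) := by
    intro w h1 h2 h3 h4
    have e1 := hf w a
    have e2 := hf w p
    rw [hfix w h1 h2 h3 h4, ha] at e1
    rw [hfix w h1 h2 h3 h4, hp] at e2
    exact ⟨e1.symm, e2.symm⟩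
  obtain ⟨-, w, h1, h2, h3⟩ := hab
  have e1 := hf a p
  have e2 := hf a q
  rw [ha, hp] at e1
  rw [ha, hq] at e2
  have e3 : w = p ∨ w = q := by
    by_contra! hh
    exact h3 (hout w h1 h2 hh.1 hh.2).1
  have hsym : ¬(C.Adj a p ↔ C.Adj b p) := by
    rcases e3 with rfl | rfl
    · simpa [C.adj_comm w] using h3
    · simp only [C.adj_comm w] at h3
      tauto
  by_cases hap : C.Adj a p
  · exact Or.inl ⟨hap, by tauto, by tauto, by tauto, hout⟩
  · exact Or.inr ⟨by tauto, by tauto, by tauto, by tauto, fun w h1 h2 h3 h4 =>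
      ⟨(hout w h1 h2 h4 h3).1, (hout w h1 h2 h4 h3).2.symm⟩⟩

/-- Three disjoint non-twin edges: two of them are linked, or exchanging the ends of all three is
an automorphism. -/
theorem linked_of_three_nonTwin [Fintype V] (hd : Fintype.card V ≤ chiD Cᶜ + 2)
    {a b p q r s : V} (hnd : [a, b, p, q, r, s].Nodup) (hab : NonTwin C a b)
    (hpq : NonTwin C p q) (hrs : NonTwin C r s) :
    (Linked C a b p q ∨ Linked C a b q p) ∨ (Linked C a b r s ∨ Linked C a b s r) ∨
    (Linked C p q r s ∨ Linked C p q s r) ∨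
    ∃ f : V → V, (∀ u v, C.Adj (f u) (f v) ↔ C.Adj u v) ∧
      (∀ v, f v = v ∨ v = a ∨ v = b ∨ v = p ∨ v = q ∨ v = r ∨ v = s) ∧
      (f a = b ∧ f b = a) ∧ (f p = q ∧ f q = p) ∧ (f r = s ∧ f s = r) := by
  obtain ⟨f, hf, hfix, h1, h2, h3, h4⟩ := exists_perm_of_three_pairs hd hnd hab.1 hpq.1 hrs.1
  rcases h1 with h1 | h1 <;> rcases h2 with h2 | h2 <;> rcases h3 with h3 | h3
  · exact absurd ⟨h1.1, h2.1, h3.1⟩ h4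
  · exact absurd hrs (not_nonTwin_of_swap hf h3.1 (by clear hf; grind only))
  · exact absurd hpq (not_nonTwin_of_swap hf h2.1 (by clear hf; grind only))
  · exact Or.inr (Or.inr (Or.inl (linked_of_swap hf h2.1 h3.1 h3.2 (by clear hf; grind only) hpq)))
  · exact absurd hab (not_nonTwin_of_swap hf h1.1 (by clear hf; grind only))
  · exact Or.inr (Or.inl (linked_of_swap hf h1.1 h3.1 h3.2 (by clear hf; grind only) hab))
  · exact Or.inl (linked_of_swap hf h1.1 h2.1 h2.2 (by clear hf; grind only) hab)
  · exact Or.inr (Or.inr (Or.inr ⟨f, hf, hfix, h1, h2, h3⟩))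

/-- A triangle of non-twin edges and a non-twin edge disjoint from it: the edge is linked to an
edge of the triangle. -/
theorem linked_of_triangle_nonTwin [Fintype V] (hd : Fintype.card V ≤ chiD Cᶜ + 2)
    {a b c d e : V} (hnd : [a, b, c, d, e].Nodup) (hab : NonTwin C a b)
    (hac : NonTwin C a c) (hbc : NonTwin C b c) (hde : NonTwin C d e) :
    (Linked C a b d e ∨ Linked C a b e d) ∨ (Linked C a c d e ∨ Linked C a c e d) ∨
    (Linked C b c d e ∨ Linked C b c e d) := by
  obtain ⟨f, hf, hfix, h1, h2, h3, h4, h5⟩ :=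
    exists_perm_of_triangle_pair hd hnd hab.1 hac.1 hbc.1 hde.1
  have i1 := f.injective.ne hab.1.ne
  have i2 := f.injective.ne hac.1.ne
  have i3 := f.injective.ne hbc.1.ne
  -- the square of a rotation of the triangle fixes all other vertices
  have rot : ∀ x y z, NonTwin C x y → C.Adj x z → C.Adj y z → f x = y → f y = z → f z = x →
      (∀ w, w ≠ x → w ≠ y → w ≠ z → f (f w) = w) → False := by
    rintro x y z ⟨-, w, w1, w2, w3⟩ hxz hyz e1 e2 e3 hw
    by_cases hwz : w = z
    · subst hwz
      exact w3 ⟨fun _ => hyz.symm, fun _ => hxz.symm⟩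
    have hww := hw w w1 w2 hwz
    have k1 := (hf (f w) (f x)).trans (hf w x)
    have k2 := (hf (f w) (f z)).trans (hf w z)
    rw [hww, e1, e2] at k1
    rw [hww, e3, e1] at k2
    exact w3 (k1.symm.trans k2.symm)
  rcases h1 with h1 | h1 | h1 <;> rcases h2 with h2 | h2 | h2 <;>
    rcases h3 with h3 | h3 | h3 <;>
    first
    | exact absurd (h1.trans h2.symm) i1
    | exact absurd (h1.trans h3.symm) i2
    | exact absurd (h2.trans h3.symm) i3
    | skip
  · rcases h4 with h4 | h4
    · exact absurd ⟨h1, h2, h3, h4.1⟩ h5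
    · exact absurd hde (not_nonTwin_of_swap hf h4.1 (by clear hf rot; grind only))
  · rcases h4 with h4 | h4
    · exact absurd hbc (not_nonTwin_of_swap hf h2 (by clear hf rot; grind only))
    · exact Or.inr (Or.inr (linked_of_swap hf h2 h4.1 h4.2 (by clear hf rot; grind only) hbc))
  · rcases h4 with h4 | h4
    · exact absurd hab (not_nonTwin_of_swap hf h1 (by clear hf rot; grind only))
    · exact Or.inl (linked_of_swap hf h1 h4.1 h4.2 (by clear hf rot; grind only) hab)
  · exact (rot a b c hab hac.1 hbc.1 h1 h2 h3 (by clear hf rot; grind only)).elim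
  · exact (rot a c b hac hab.1 hbc.1.symm h1 h3 h2 (by clear hf rot; grind only)).elim
  · rcases h4 with h4 | h4
    · exact absurd hac (not_nonTwin_of_swap hf h1 (by clear hf rot; grind only))
    · exact Or.inr (Or.inl (linked_of_swap hf h1 h4.1 h4.2 (by clear hf rot; grind only) hac))

/-- The automorphism obtained by merging four pairwise adjacent vertices moves one to a twin. -/
theorem not_four_nonTwin [Fintype V] (hd : Fintype.card V ≤ chiD Cᶜ + 2) {a b c d : V}
    (hab : NonTwin C a b) (hac : NonTwin C a c) (had : NonTwin C a d)
    (hbc : NonTwin C b c) (hbd : NonTwin C b d) (hcd : NonTwin C c d) : False := by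
  obtain ⟨f, hf, hfix, u, v, huv, hfu, hu, hv⟩ :=
    exists_perm_of_quadruple hd hab.1 hac.1 had.1 hbc.1 hbd.1 hcd.1
  have hN : NonTwin C u v := by
    have := hab.symm; have := hac.symm; have := had.symm
    have := hbc.symm; have := hbd.symm; have := hcd.symm
    rcases hu with rfl | rfl | rfl | rfl <;> rcases hv with rfl | rfl | rfl | rfl <;>
      first | assumption | exact absurd rfl huv
  obtain ⟨-, w, h1, h2, h3⟩ := hN
  -- a vertex outside the clique is fixed, one inside is adjacent to both
  by_cases hw : w = a ∨ w = b ∨ w = c ∨ w = d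
  · have e1 := hab.1; have e2 := hac.1; have e3 := had.1
    have e4 := hbc.1; have e5 := hbd.1; have e6 := hcd.1
    have hin : ∀ x y, (x = a ∨ x = b ∨ x = c ∨ x = d) → (y = a ∨ y = b ∨ y = c ∨ y = d) →
        x ≠ y → C.Adj x y := by
      rintro x y (rfl | rfl | rfl | rfl) (rfl | rfl | rfl | rfl) hxy <;>
        first | assumption | exact SimpleGraph.Adj.symm (by assumption) | exact absurd rfl hxy
    exact h3 ⟨fun _ => hin _ _ hw hv h2, fun _ => hin _ _ hw hu h1⟩
  · have hfw := (hfix w).resolve_right hw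
    have := hf w u
    rw [hfw, hfu] at this
    exact h3 this.symm

end NonTwin
/-! ### Six vertices carrying three non-twin edges -/

section Six

variable {V : Type*} {C : SimpleGraph V}

/-- `IsCoComponent C T e`: the image of `e` is isolated from the rest of `C`, and `e` identifies
the graph induced on it with the complement of `T`. -/
def IsCoComponent {ι : Type*} (C : SimpleGraph V) (T : SimpleGraph ι) (e : ι → V) : Prop :=
  Function.Injective e ∧ (∀ i j, i ≠ j → (C.Adj (e i) (e j) ↔ ¬T.Adj i j)) ∧
    ∀ w, w ∉ Set.range e → ∀ i, ¬C.Adj w (e i)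

/-- Three disjoint edges whose ends are separated by vertices off these edges give a partition
that no automorphism respects. -/
theorem false_of_three_separated [Fintype V] (hd : Fintype.card V ≤ chiD Cᶜ + 2)
    {a b p q r s u v w : V} (hnd : [a, b, p, q, r, s].Nodup) (hab : C.Adj a b)
    (hpq : C.Adj p q) (hrs : C.Adj r s)
    (hu : u ∉ [a, b, p, q, r, s]) (hv : v ∉ [a, b, p, q, r, s]) (hw : w ∉ [a, b, p, q, r, s])
    (hu' : ¬(C.Adj u a ↔ C.Adj u b)) (hv' : ¬(C.Adj v p ↔ C.Adj v q))
    (hw' : ¬(C.Adj w r ↔ C.Adj w s)) : False := by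
  obtain ⟨f, hf, hfix, h1, h2, h3, h4⟩ := exists_perm_of_three_pairs hd hnd hab hpq hrs
  simp only [List.mem_cons, List.not_mem_nil, or_false] at hu hv hw
  have fu := (hfix u).resolve_right hu
  have fv := (hfix v).resolve_right hv
  have fw := (hfix w).resolve_right hw
  have k1 := hf u a
  have k2 := hf v p
  have k3 := hf w r
  clear hf hfix hnd
  grind only

/-- The domino formed by the squares `abqp` and `pqsr`, where the pairs between `ab` and `rs` are
all edges or all non-edges, is partitioned by the edges `ap`, `bq`, `rs`, and no automorphism
respects this partition. -/
theorem false_of_domino [Fintype V] (hd : Fintype.card V ≤ chiD Cᶜ + 2)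
    {a b p q r s : V} (hnd : [a, b, p, q, r, s].Nodup) (hrs : C.Adj r s)
    (hap : C.Adj a p) (hbq : C.Adj b q) (haq : ¬C.Adj a q)
    (hbp : ¬C.Adj b p) (hpr : C.Adj p r) (hqs : C.Adj q s) (hps : ¬C.Adj p s)
    (hqr : ¬C.Adj q r) (h : (C.Adj a r ↔ C.Adj a s) ∧ (C.Adj b r ↔ C.Adj b s) ∧
      (C.Adj a r ↔ C.Adj b r)) : False := by
  have hnd' : [a, p, b, q, r, s].Nodup := by
    simp only [List.nodup_cons, List.mem_cons, List.not_mem_nil, or_false, not_or,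
      List.nodup_nil, not_false_eq_true, and_true] at hnd ⊢
    tauto
  obtain ⟨f, hf, hfix, h1, h2, h3, h4⟩ := exists_perm_of_three_pairs hd hnd' hap hbq hrs
  have k2 := hf a q
  have k3 := hf a r
  have k4 := hf a s
  have k5 := hf p b
  have k6 := hf p r
  have k7 := hf p s
  have k8 := hf b r
  have k9 := hf b s
  have k10 := hf q r
  have k11 := hf q s
  clear hf hfix hnd hnd'
  simp only [C.adj_comm p b] at *
  have hbp' : ¬C.Adj p b := fun h => hbp h.symm
  have haq' : ¬C.Adj q a := fun h => haq h.symm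
  grind only

/-- `IsPrism C a b p q r s`: the six vertices induce the triangular prism with triangles `apr`
and `bqs`. -/
structure IsPrism (C : SimpleGraph V) (a b p q r s : V) : Prop where
  nodup : [a, b, p, q, r, s].Nodup
  ab : C.Adj a b
  pq : C.Adj p q
  rs : C.Adj r s
  ap : C.Adj a p
  ar : C.Adj a r
  pr : C.Adj p r
  bq : C.Adj b q
  bs : C.Adj b s
  qs : C.Adj q s
  aq : ¬C.Adj a q
  as : ¬C.Adj a s
  ps : ¬C.Adj p s
  bp : ¬C.Adj b p
  br : ¬C.Adj b r
  qr : ¬C.Adj q r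

/-- Cyclic shift of the three edges joining the triangles. -/
theorem IsPrism.rot {a b p q r s : V} (h : IsPrism C a b p q r s) : IsPrism C p q r s a b := by
  obtain ⟨h0, h1, h2, h3, h4, h5, h6, h7, h8, h9, n1, n2, n3, n4, n5, n6⟩ := h
  refine ⟨?_, h2, h3, h1, h6, h4.symm, h5.symm, h9, h7.symm, h8.symm, n3, fun h => n4 h.symm,
    fun h => n5 h.symm, n6, fun h => n1 h.symm, fun h => n2 h.symm⟩
  simp only [List.nodup_cons, List.mem_cons, List.not_mem_nil, or_false, not_or,
    List.nodup_nil, not_false_eq_true, and_true] at h0 ⊢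
  grind only

/-- A vertex outside a prism that does not separate the ends of the three edges joining the
triangles is not adjacent to the prism. -/
theorem IsPrism.not_adj [Fintype V] (hd : Fintype.card V ≤ chiD Cᶜ + 2)
    {a b p q r s : V} (h : IsPrism C a b p q r s) {w : V} (hw : w ∉ [a, b, p, q, r, s])
    (h1 : C.Adj w a ↔ C.Adj w b) (h2 : C.Adj w p ↔ C.Adj w q) (h3 : C.Adj w r ↔ C.Adj w s) :
    ¬C.Adj w a := by
  -- a vertex seeing one of the matching edges only separates the ends of two edges of triangles
  have hsep : ∀ {a b p q r s : V}, IsPrism C a b p q r s → w ∉ [a, b, p, q, r, s] →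
      (C.Adj w a ↔ C.Adj w b) → (C.Adj w p ↔ C.Adj w q) → ¬(C.Adj w a ↔ C.Adj w p) → False := by
    clear h hw h1 h2 h3 a b p q r s
    intro a b p q r s h hw h1 h2 h3
    have hnd' : [a, p, b, q, r, s].Nodup := by
      have hnd := h.nodup
      simp only [List.nodup_cons, List.mem_cons, List.not_mem_nil, or_false, not_or,
        List.nodup_nil, not_false_eq_true, and_true] at hnd ⊢
      tauto
    obtain ⟨f, hf, hfix, e1, e2, e3, e4⟩ := exists_perm_of_three_pairs hd hnd' h.ap h.bq h.rs
    have fw : f w = w := (hfix w).resolve_right (by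
      clear * - hw
      simp only [List.mem_cons, List.not_mem_nil, or_false] at hw
      tauto)
    have k1 := hf w a
    have k2 := hf w b
    have k3 := hf a r
    have fa : f a = a := by
      refine (e1.resolve_right fun e => h3 ?_).1
      rwa [fw, e.1, Iff.comm] at k1
    have fb : f b = b := by
      refine (e2.resolve_right fun e => h3 ?_).1
      rw [fw, e.1] at k2
      rw [h1, ← k2, h2]
    have fr : f r = r := by
      refine (e3.resolve_right fun e => h.as ?_).1
      rw [fa, e.1] at k3
      exact k3.2 h.ar
    exact e4 ⟨fa, fb, fr⟩
  intro hwa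
  by_cases hp : C.Adj w p
  swap
  · exact hsep h hw h1 h2 (by tauto)
  by_cases hr : C.Adj w r
  swap
  · refine hsep h.rot (fun hm => hw ?_) h2 h3 (by tauto)
    simp only [List.mem_cons, List.not_mem_nil, or_false] at hm ⊢
    tauto
  -- a vertex adjacent to all six: merge it with `a`
  have hnd' : [w, a, p, q, r, s].Nodup := by
    have hnd := h.nodup
    simp only [List.nodup_cons, List.mem_cons, List.not_mem_nil, or_false, not_or,
      List.nodup_nil, not_false_eq_true, and_true] at hnd hw ⊢
    tauto
  obtain ⟨f, hf, hfix, e1, e2, e3, e4⟩ := exists_perm_of_three_pairs hd hnd' hwa h.pq h.rs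
  have fb : f b = b := (hfix b).resolve_right (by
    have hnd := h.nodup
    simp only [List.nodup_cons, List.mem_cons, List.not_mem_nil, or_false, not_or,
      List.nodup_nil, not_false_eq_true, and_true] at hnd hw
    grind only)
  have k1 := hf b p
  have k2 := hf b r
  have k3 := hf w p
  have k4 := hf w q
  have := h.aq
  have := h.ap
  have := h.bp
  have := h.br
  have := h.bq
  have := h.bs
  have := h1.1 hwa
  have := h2.1 hp
  clear hf hfix hnd'
  grind only

/-- The prism is the complement of a 6-cycle. -/
theorem IsPrism.isCoComponent {a b p q r s : V} (hP : IsPrism C a b p q r s)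
    (hout : ∀ w ∉ [a, b, p, q, r, s], ¬C.Adj w a ∧ ¬C.Adj w p ∧ ¬C.Adj w r ∧
      (C.Adj w a ↔ C.Adj w b) ∧ (C.Adj w p ↔ C.Adj w q) ∧ (C.Adj w r ↔ C.Adj w s)) :
    IsCoComponent C (cycleGraph 6) (![a, q, r, b, p, s]) := by
  have hnd := hP.nodup
  obtain ⟨h0, h1, h2, h3, h4, h5, h6, h7, h8, h9, n1, n2, n3, n4, n5, n6⟩ := hP
  refine ⟨?_, ?_, fun w hw => ?_⟩
  · refine List.nodup_ofFn.1 ?_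
    simp only [List.nodup_cons, List.mem_cons, List.not_mem_nil, or_false, not_or,
      List.nodup_nil, not_false_eq_true, and_true] at hnd
    simp
    grind only
  · simp +decide [Fin.forall_fin_succ, h1, h2, h3, h4, h5, h6, h7, h8, h9, n1,
      n2, n3, n4, n5, n6, C.adj_comm _ a, C.adj_comm r q, C.adj_comm r b, C.adj_comm p b,
      C.adj_comm s p, C.adj_comm q b, C.adj_comm q p, C.adj_comm s b, C.adj_comm r p,
      C.adj_comm s q, C.adj_comm s r]
  · have := hout w (by simp at hw ⊢; tauto)
    simp [Fin.forall_fin_succ]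
    tauto

theorem IsPrism.outside [Fintype V] (hd : Fintype.card V ≤ chiD Cᶜ + 2)
    {a b p q r s : V} (hP : IsPrism C a b p q r s) (hout : ∀ w ∉ [a, b, p, q, r, s],
      (C.Adj w a ↔ C.Adj w b) ∧ (C.Adj w p ↔ C.Adj w q) ∧ (C.Adj w r ↔ C.Adj w s)) :
    ∀ w ∉ [a, b, p, q, r, s], ¬C.Adj w a ∧ ¬C.Adj w p ∧ ¬C.Adj w r ∧
      (C.Adj w a ↔ C.Adj w b) ∧ (C.Adj w p ↔ C.Adj w q) ∧ (C.Adj w r ↔ C.Adj w s) := by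
  intro w hw
  obtain ⟨h1, h2, h3⟩ := hout w hw
  refine ⟨hP.not_adj hd hw h1 h2 h3, hP.rot.not_adj hd (fun hm => hw ?_) h2 h3 h1,
    hP.rot.rot.not_adj hd (fun hm => hw ?_) h3 h1 h2, h1, h2, h3⟩
  all_goals
    clear * - hm
    simp only [List.mem_cons, List.not_mem_nil, or_false] at hm ⊢
    tauto

/-- `IsK33 C a b p q r s`: the six vertices induce the complete bipartite graph with parts
`a, q, r` and `b, p, s`. -/
structure IsK33 (C : SimpleGraph V) (a b p q r s : V) : Prop where
  nodup : [a, b, p, q, r, s].Nodup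
  ab : C.Adj a b
  pq : C.Adj p q
  rs : C.Adj r s
  ap : C.Adj a p
  as : C.Adj a s
  pr : C.Adj p r
  bq : C.Adj b q
  br : C.Adj b r
  qs : C.Adj q s
  aq : ¬C.Adj a q
  ar : ¬C.Adj a r
  ps : ¬C.Adj p s
  bp : ¬C.Adj b p
  bs : ¬C.Adj b s
  qr : ¬C.Adj q r

/-- Cyclic shift of the three matching edges, which interchanges the parts. -/
theorem IsK33.rot {a b p q r s : V} (h : IsK33 C a b p q r s) : IsK33 C p q r s b a := by
  obtain ⟨h0, h1, h2, h3, h4, h5, h6, h7, h8, h9, n1, n2, n3, n4, n5, n6⟩ := h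
  refine ⟨?_, h2, h3, h1.symm, h6, h4.symm, h8.symm, h9, h7.symm, h5.symm, n3,
    fun h => n4 h.symm, fun h => n2 h.symm, n6, fun h => n1 h.symm, fun h => n5 h.symm⟩
  simp only [List.nodup_cons, List.mem_cons, List.not_mem_nil, or_false, not_or,
    List.nodup_nil, not_false_eq_true, and_true] at h0 ⊢
  grind only

/-- A vertex outside a `K_{3,3}` that does not separate the ends of the three matching edges is not
adjacent to it. -/
theorem IsK33.not_adj [Fintype V] (hd : Fintype.card V ≤ chiD Cᶜ + 2)
    {a b p q r s : V} (h : IsK33 C a b p q r s) {w : V} (hw : w ∉ [a, b, p, q, r, s])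
    (h1 : C.Adj w a ↔ C.Adj w b) (h2 : C.Adj w p ↔ C.Adj w q) (h3 : C.Adj w r ↔ C.Adj w s) :
    ¬C.Adj w a := by
  -- a vertex seeing one of the matching edges only separates the ends of two other edges
  have hsep : ∀ {a b p q r s : V}, IsK33 C a b p q r s → w ∉ [a, b, p, q, r, s] →
      (C.Adj w a ↔ C.Adj w b) → (C.Adj w p ↔ C.Adj w q) → ¬(C.Adj w a ↔ C.Adj w p) → False := by
    clear h hw h1 h2 h3 a b p q r s
    intro a b p q r s h hw h1 h2 h3
    have hnd' : [a, p, b, q, r, s].Nodup := by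
      have hnd := h.nodup
      simp only [List.nodup_cons, List.mem_cons, List.not_mem_nil, or_false, not_or,
        List.nodup_nil, not_false_eq_true, and_true] at hnd ⊢
      tauto
    obtain ⟨f, hf, hfix, e1, e2, e3, e4⟩ := exists_perm_of_three_pairs hd hnd' h.ap h.bq h.rs
    have fw : f w = w := (hfix w).resolve_right (by
      clear * - hw
      simp only [List.mem_cons, List.not_mem_nil, or_false] at hw
      tauto)
    have k1 := hf w a
    have k2 := hf w b
    have k3 := hf a s
    have fa : f a = a := by
      refine (e1.resolve_right fun e => h3 ?_).1
      rwa [fw, e.1, Iff.comm] at k1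
    have fb : f b = b := by
      refine (e2.resolve_right fun e => h3 ?_).1
      rw [fw, e.1] at k2
      rw [h1, ← k2, h2]
    have fr : f r = r := by
      refine (e3.resolve_right fun e => h.ar ?_).1
      rw [fa, e.2] at k3
      exact k3.2 h.as
    exact e4 ⟨fa, fb, fr⟩
  intro hwa
  by_cases hp : C.Adj w p
  swap
  · exact hsep h hw h1 h2 (by tauto)
  by_cases hr : C.Adj w r
  swap
  · refine hsep h.rot (fun hm => hw ?_) h2 h3 (by tauto)
    simp only [List.mem_cons, List.not_mem_nil, or_false] at hm ⊢
    tauto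
  -- a vertex adjacent to all six: merge it with `a`
  have hnd' : [w, a, p, q, r, s].Nodup := by
    have hnd := h.nodup
    simp only [List.nodup_cons, List.mem_cons, List.not_mem_nil, or_false, not_or,
      List.nodup_nil, not_false_eq_true, and_true] at hnd hw ⊢
    tauto
  obtain ⟨f, hf, hfix, e1, e2, e3, e4⟩ := exists_perm_of_three_pairs hd hnd' hwa h.pq h.rs
  have fb : f b = b := (hfix b).resolve_right (by
    have hnd := h.nodup
    simp only [List.nodup_cons, List.mem_cons, List.not_mem_nil, or_false, not_or,
      List.nodup_nil, not_false_eq_true, and_true] at hnd hw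
    grind only)
  have k1 := hf b p
  have k2 := hf b r
  have k3 := hf w p
  have k4 := hf w q
  have := h.aq
  have := h.ap
  have := h.bp
  have := h.br
  have := h.bq
  have := h.bs
  have := h1.1 hwa
  have := h2.1 hp
  clear hf hfix hnd'
  grind only

/-- `K_{3,3}` is the complement of `2K₃`. -/
theorem IsK33.isCoComponent {a b p q r s : V} (hP : IsK33 C a b p q r s)
    (hout : ∀ w ∉ [a, b, p, q, r, s], ¬C.Adj w a ∧ ¬C.Adj w p ∧ ¬C.Adj w r ∧
      (C.Adj w a ↔ C.Adj w b) ∧ (C.Adj w p ↔ C.Adj w q) ∧ (C.Adj w r ↔ C.Adj w s)) :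
    IsCoComponent C (K 3 ⊕g K 3) (Sum.elim ![a, q, r] ![b, p, s]) := by
  have hnd := hP.nodup
  obtain ⟨h0, h1, h2, h3, h4, h5, h6, h7, h8, h9, n1, n2, n3, n4, n5, n6⟩ := hP
  refine ⟨?_, ?_, fun w hw => ?_⟩
  · simp only [List.nodup_cons, List.mem_cons, List.not_mem_nil, or_false, not_or,
      List.nodup_nil, not_false_eq_true, and_true] at hnd
    intro i j
    revert i j
    simp [Sum.forall, Fin.forall_fin_succ, hnd]
    grind only
  · simp [Sum.forall, Fin.forall_fin_succ, h1, h2, h3, h4, h5, h6, h7, h8, h9, n1,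
      n2, n3, n4, n5, n6, C.adj_comm _ a, C.adj_comm r q, C.adj_comm r b, C.adj_comm p b,
      C.adj_comm s p, C.adj_comm q b, C.adj_comm q p, C.adj_comm s b, C.adj_comm r p,
      C.adj_comm s q, C.adj_comm s r]
  · have := hout w (by simp at hw ⊢; tauto)
    simp [Sum.forall, Fin.forall_fin_succ]
    tauto

theorem IsK33.outside [Fintype V] (hd : Fintype.card V ≤ chiD Cᶜ + 2)
    {a b p q r s : V} (hP : IsK33 C a b p q r s) (hout : ∀ w ∉ [a, b, p, q, r, s],
      (C.Adj w a ↔ C.Adj w b) ∧ (C.Adj w p ↔ C.Adj w q) ∧ (C.Adj w r ↔ C.Adj w s)) :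
    ∀ w ∉ [a, b, p, q, r, s], ¬C.Adj w a ∧ ¬C.Adj w p ∧ ¬C.Adj w r ∧
      (C.Adj w a ↔ C.Adj w b) ∧ (C.Adj w p ↔ C.Adj w q) ∧ (C.Adj w r ↔ C.Adj w s) := by
  intro w hw
  obtain ⟨h1, h2, h3⟩ := hout w hw
  refine ⟨hP.not_adj hd hw h1 h2 h3, hP.rot.not_adj hd (fun hm => hw ?_) h2 h3 h1.symm,
    hP.rot.rot.not_adj hd (fun hm => hw ?_) h3 h1.symm h2.symm, h1, h2, h3⟩
  all_goals
    clear * - hm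
    simp only [List.mem_cons, List.not_mem_nil, or_false] at hm ⊢
    tauto

end Six
/-! ### The structure of graphs with `χ_D` at least `n - 2`, in the complement -/

section Core

variable {V : Type*} {C : SimpleGraph V}

/-- The possible structures of the complement `C` of a graph with `χ_D ≥ n - 2`: the non-twin
edges are covered by two vertices, or lie in a component of one of five exceptional kinds, or they
are covered by a 4-cycle and one further vertex. -/
inductive CoreType (C : SimpleGraph V) : Prop
  | cover (x y : V) (h : CoversPairs Cᶜ {x, y})
  | path (e : Fin 5 → V) (he : IsCoComponent C (pathGraph 5) e)
      (h : CoversPairs Cᶜ (Set.range e))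
  | cycle5 (e : Fin 5 → V) (he : IsCoComponent C (cycleGraph 5) e)
      (h : CoversPairs Cᶜ (Set.range e))
  | cycle6 (e : Fin 6 → V) (he : IsCoComponent C (cycleGraph 6) e)
      (h : CoversPairs Cᶜ (Set.range e))
  | triangles (e : Fin 3 ⊕ Fin 3 → V) (he : IsCoComponent C (K 3 ⊕g K 3) e)
      (h : CoversPairs Cᶜ (Set.range e))
  | twoC4 (e : (Fin 2 ⊕ Fin 2) ⊕ (Fin 2 ⊕ Fin 2) → V)
      (he : IsCoComponent C ((K 2 ⊕g K 2) ∨g (K 2 ⊕g K 2)) e)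
      (h : CoversPairs Cᶜ (Set.range e))
  | c4Star (e : Fin 2 ⊕ Fin 2 → V) (he : IsCoComponent C (K 2 ⊕g K 2) e) (x : V)
      (hx : x ∉ Set.range e) (h : CoversPairs Cᶜ (insert x (Set.range e)))
  | c4Cone (e : Fin 2 ⊕ Fin 2 → V) (t : V) (he : Function.Injective e)
      (hadj : ∀ i j, i ≠ j → (C.Adj (e i) (e j) ↔ ¬(K 2 ⊕g K 2).Adj i j))
      (ht : t ∉ Set.range e) (hte : ∀ i, C.Adj t (e i))
      (hout : ∀ w, w ∉ Set.range e → w ≠ t → ∀ i, ¬C.Adj w (e i))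
      (h : CoversPairs Cᶜ (insert t (Set.range e)))

/-- Outside a component containing two disjoint edges, each separated by another vertex of the
component, all edges are twins. -/
theorem IsCoComponent.coversPairs [Fintype V] (hd : Fintype.card V ≤ chiD Cᶜ + 2)
    {ι : Type*} {T : SimpleGraph ι} {e : ι → V} (he : IsCoComponent C T e)
    {i j k l u v : ι} (hnd : [i, j, k, l].Nodup) (hu : u ∉ [i, j, k, l]) (hv : v ∉ [i, j, k, l])
    (hij : ¬T.Adj i j) (hkl : ¬T.Adj k l) (huij : ¬(T.Adj u i ↔ T.Adj u j))
    (hvkl : ¬(T.Adj v k ↔ T.Adj v l)) : CoversPairs Cᶜ (Set.range e) := by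
  rw [coversPairs_compl_iff]
  rintro x y hx hy ⟨hxy, w, w1, w2, w3⟩
  obtain ⟨hinj, hadj, hout⟩ := he
  have hxe : ∀ i, x ≠ e i := fun i h => hx ⟨i, h.symm⟩
  have hye : ∀ i, y ≠ e i := fun i h => hy ⟨i, h.symm⟩
  have hwe : ∀ i, w ≠ e i := by
    rintro i rfl
    exact w3 ⟨fun h => absurd h.symm (hout x hx i), fun h => absurd h.symm (hout y hy i)⟩
  simp only [List.nodup_cons, List.mem_cons, List.not_mem_nil, or_false, not_or,
    List.nodup_nil, not_false_eq_true, and_true] at hnd hu hv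
  have hT : ∀ a b, a ≠ b → (C.Adj (e a) (e b) ↔ ¬T.Adj a b) := hadj
  refine false_of_three_separated hd (a := e i) (b := e j) (p := e k) (q := e l) (r := x) (s := y)
    (u := e u) (v := e v) (w := w) ?_ ?_ ?_ hxy ?_ ?_ ?_ ?_ ?_ w3
  · simp only [List.nodup_cons, List.mem_cons, List.not_mem_nil, or_false, not_or,
      List.nodup_nil, not_false_eq_true, and_true, hinj.eq_iff]
    exact ⟨⟨hnd.1.1, hnd.1.2.1, hnd.1.2.2, (hxe i).symm, (hye i).symm⟩,
      ⟨hnd.2.1.1, hnd.2.1.2, (hxe j).symm, (hye j).symm⟩,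
      ⟨hnd.2.2, (hxe k).symm, (hye k).symm⟩, ⟨(hxe l).symm, (hye l).symm⟩, hxy.ne⟩
  · exact (hT i j hnd.1.1).2 hij
  · exact (hT k l hnd.2.2).2 hkl
  · simp [hinj.eq_iff, hu, (hxe u).symm, (hye u).symm]
  · simp [hinj.eq_iff, hv, (hxe v).symm, (hye v).symm]
  · simp [hwe, w1, w2]
  · rw [hT u i hu.1, hT u j hu.2.1]; tauto
  · rw [hT v k hv.2.2.1, hT v l hv.2.2.2]; tauto

/-- Three disjoint edges exchanged simultaneously by an automorphism, with `pq` in the middle. -/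
theorem coreType_of_swap_three [Fintype V] (hd : Fintype.card V ≤ chiD Cᶜ + 2)
    {a b p q r s : V} (hnd : [a, b, p, q, r, s].Nodup) (hab : C.Adj a b) (hpq : C.Adj p q)
    (hrs : C.Adj r s) {f : V → V} (hf : ∀ u v, C.Adj (f u) (f v) ↔ C.Adj u v)
    (hfix : ∀ v, f v = v ∨ v = a ∨ v = b ∨ v = p ∨ v = q ∨ v = r ∨ v = s)
    (h1 : f a = b ∧ f b = a) (h2 : f p = q ∧ f q = p) (h3 : f r = s ∧ f s = r)
    (hap : C.Adj a p) (haq : ¬C.Adj a q) (hpr : C.Adj p r) (hps : ¬C.Adj p s) :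
    CoreType C := by
  have k1 := hf a p
  have k2 := hf a q
  have k3 := hf p r
  have k4 := hf p s
  have k5 := hf a r
  have k6 := hf a s
  rw [h1.1, h2.1] at k1
  rw [h1.1, h2.2] at k2
  rw [h2.1, h3.1] at k3
  rw [h2.1, h3.2] at k4
  rw [h1.1, h3.1] at k5
  rw [h1.1, h3.2] at k6
  have hout : ∀ w, w ∉ [a, b, p, q, r, s] →
      (C.Adj w a ↔ C.Adj w b) ∧ (C.Adj w p ↔ C.Adj w q) ∧ (C.Adj w r ↔ C.Adj w s) := by
    intro w hw
    have fw : f w = w := (hfix w).resolve_right (by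
      clear * - hw
      simp only [List.mem_cons, List.not_mem_nil, or_false] at hw
      tauto)
    have e1 := hf w a
    have e2 := hf w p
    have e3 := hf w r
    rw [fw, h1.1] at e1
    rw [fw, h2.1] at e2
    rw [fw, h3.1] at e3
    exact ⟨e1.symm, e2.symm, e3.symm⟩
  by_cases har : C.Adj a r <;> by_cases has : C.Adj a s
  · exact (false_of_domino hd hnd hrs hap (k1.2 hap) haq (mt k2.1 haq) hpr (k3.2 hpr)
      hps (mt k4.1 hps) (by tauto)).elim
  · have hP : IsPrism C a b p q r s :=
      ⟨hnd, hab, hpq, hrs, hap, har, hpr, k1.2 hap, k5.2 har, k3.2 hpr, haq, has, hps,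
        mt k2.1 haq, mt k6.1 has, mt k4.1 hps⟩
    have he := hP.isCoComponent (hP.outside hd hout)
    exact .cycle6 _ he (he.coversPairs hd (i := 0) (j := 4) (k := 1) (l := 5) (u := 3) (v := 2)
      (by decide) (by decide) (by decide) (by decide) (by decide) (by decide) (by decide))
  · have hP : IsK33 C a b p q r s :=
      ⟨hnd, hab, hpq, hrs, hap, has, hpr, k1.2 hap, k6.2 has, k3.2 hpr, haq, har, hps,
        mt k2.1 haq, mt k5.1 har, mt k4.1 hps⟩
    have he := hP.isCoComponent (hP.outside hd hout)
    exact .triangles _ he (he.coversPairs hd (i := .inl 0) (j := .inr 0) (k := .inl 1)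
      (l := .inr 1) (u := .inl 2) (v := .inl 2) (by decide) (by simp) (by simp)
      (by simp) (by simp) (by simp) (by simp))
  · exact (false_of_domino hd hnd hrs hap (k1.2 hap) haq (mt k2.1 haq) hpr (k3.2 hpr)
      hps (mt k4.1 hps) (by tauto)).elim

/-- Three disjoint non-twin edges exchanged simultaneously by an automorphism. -/
theorem coreType_of_swap_three_nonTwin [Fintype V] (hd : Fintype.card V ≤ chiD Cᶜ + 2)
    {a b p q r s : V} (hnd : [a, b, p, q, r, s].Nodup) (hab : NonTwin C a b)
    (hpq : NonTwin C p q) (hrs : NonTwin C r s) {f : V → V}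
    (hf : ∀ u v, C.Adj (f u) (f v) ↔ C.Adj u v)
    (hfix : ∀ v, f v = v ∨ v = a ∨ v = b ∨ v = p ∨ v = q ∨ v = r ∨ v = s)
    (h1 : f a = b ∧ f b = a) (h2 : f p = q ∧ f q = p) (h3 : f r = s ∧ f s = r) :
    CoreType C := by
  -- the middle edge may be any of the three, and the ends may be named in any order
  have middle : ∀ a b p q r s : V, [a, b, p, q, r, s].Nodup → C.Adj a b → C.Adj p q →
      C.Adj r s → (∀ v, f v = v ∨ v = a ∨ v = b ∨ v = p ∨ v = q ∨ v = r ∨ v = s) →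
      (f a = b ∧ f b = a) → (f p = q ∧ f q = p) → (f r = s ∧ f s = r) →
      ¬(C.Adj a p ↔ C.Adj a q) → ¬(C.Adj p r ↔ C.Adj p s) → CoreType C := by
    clear hnd hab hpq hrs hfix h1 h2 h3 a b p q r s
    intro a b p q r s hnd hab hpq hrs hfix h1 h2 h3 m1 m2
    have k1 := hf a p
    have k2 := hf a q
    rw [h1.1, h2.1] at k1
    rw [h1.1, h2.2] at k2
    have hnd' := hnd
    simp only [List.nodup_cons, List.mem_cons, List.not_mem_nil, or_false, not_or,
      List.nodup_nil, not_false_eq_true, and_true] at hnd'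
    obtain ⟨⟨n1, n2, n3, n4, n5⟩, ⟨n6, n7, n8, n9⟩, ⟨n10, n11, n12⟩, ⟨n13, n14⟩, n15⟩ := hnd'
    by_cases hap : C.Adj a p <;> by_cases hpr : C.Adj p r
    · exact coreType_of_swap_three hd hnd hab hpq hrs hf hfix h1 h2 h3 hap (by tauto) hpr
        (by tauto)
    · refine coreType_of_swap_three (r := s) (s := r) hd ?_ hab hpq hrs.symm hf ?_ h1 h2 h3.symm
        hap (by tauto) (by tauto) hpr
      · simp [*, Ne.symm n15]
      · intro v; rcases hfix v with h | h | h | h | h | h | h <;> simp [h]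
    · refine coreType_of_swap_three (a := b) (b := a) hd ?_ hab.symm hpq hrs hf ?_ h1.symm h2 h3
        (by tauto) (by tauto) hpr (by tauto)
      · simp [*, Ne.symm n1]
      · intro v; rcases hfix v with h | h | h | h | h | h | h <;> simp [h]
    · refine coreType_of_swap_three (a := b) (b := a) (r := s) (s := r) hd ?_ hab.symm hpq
        hrs.symm hf ?_ h1.symm h2 h3.symm (by tauto) (by tauto) (by tauto) hpr
      · simp [*, Ne.symm n1, Ne.symm n15]
      · intro v; rcases hfix v with h | h | h | h | h | h | h <;> simp [h]
  have hnd' := hnd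
  simp only [List.nodup_cons, List.mem_cons, List.not_mem_nil, or_false, not_or,
    List.nodup_nil, not_false_eq_true, and_true] at hnd'
  -- each edge is separated by an end of another one
  have sep : ∀ a b p q r s : V, NonTwin C a b →
      (∀ v, f v = v ∨ v = a ∨ v = b ∨ v = p ∨ v = q ∨ v = r ∨ v = s) →
      (f a = b ∧ f b = a) → (f p = q ∧ f q = p) → (f r = s ∧ f s = r) →
      ¬(C.Adj a p ↔ C.Adj a q) ∨ ¬(C.Adj a r ↔ C.Adj a s) := by
    clear middle hnd hnd' hab hpq hrs hfix h1 h2 h3 a b p q r s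
    rintro a b p q r s ⟨-, w, w1, w2, w3⟩ hfix h1 h2 h3
    have k0 := hf w a
    have k1 := hf p a
    have k2 := hf q a
    have k3 := hf r a
    have k4 := hf s a
    simp only [h1.1, h2.1, h2.2, h3.1, h3.2] at k0 k1 k2 k3 k4
    simp only [C.adj_comm a]
    clear hf
    rcases hfix w with h | h | h | h | h | h | h
    · rw [h] at k0
      exact absurd k0.symm w3
    · exact absurd h w1
    · exact absurd h w2
    all_goals
      subst h
      clear hfix h1 h2 h3
      grind only
  have s1 := sep a b p q r s hab hfix h1 h2 h3
  have s2 := sep p q a b r s hpq (fun v => by rcases hfix v with h | h | h | h | h | h | h <;>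
    simp [h]) h2 h1 h3
  have s3 := sep r s a b p q hrs (fun v => by rcases hfix v with h | h | h | h | h | h | h <;>
    simp [h]) h3 h1 h2
  have c1 : (C.Adj a p ↔ C.Adj a q) ↔ (C.Adj p a ↔ C.Adj p b) := by
    have := hf a q
    rw [h1.1, h2.2] at this
    rw [C.adj_comm p a, C.adj_comm p b, this]
  have c2 : (C.Adj a r ↔ C.Adj a s) ↔ (C.Adj r a ↔ C.Adj r b) := by
    have := hf a s
    rw [h1.1, h3.2] at this
    rw [C.adj_comm r a, C.adj_comm r b, this]
  have c3 : (C.Adj p r ↔ C.Adj p s) ↔ (C.Adj r p ↔ C.Adj r q) := by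
    have := hf p s
    rw [h2.1, h3.2] at this
    rw [C.adj_comm r p, C.adj_comm r q, this]
  rw [← c1] at s2
  rw [← c2, ← c3] at s3
  by_cases m12 : C.Adj a p ↔ C.Adj a q
  · refine middle a b r s p q ?_ hab.1 hrs.1 hpq.1 ?_ h1 h3 h2
      (s1.resolve_left (not_not.2 m12)) (mt c3.2 (s2.resolve_left (not_not.2 m12)))
    · simp [hnd', Ne.symm hnd'.2.2.1.2.1, Ne.symm hnd'.2.2.1.2.2, Ne.symm hnd'.2.2.2.1.1,
        Ne.symm hnd'.2.2.2.1.2]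
    · intro v; rcases hfix v with h | h | h | h | h | h | h <;> simp [h]
  · by_cases m23 : C.Adj p r ↔ C.Adj p s
    · refine middle p q a b r s ?_ hpq.1 hab.1 hrs.1 ?_ h2 h1 h3 (mt c1.2 m12)
        (s3.resolve_right (not_not.2 m23))
      · simp [hnd', Ne.symm hnd'.1.2.1, Ne.symm hnd'.1.2.2.1, Ne.symm hnd'.2.1.1,
        Ne.symm hnd'.2.1.2.1]
      · intro v; rcases hfix v with h | h | h | h | h | h | h <;> simp [h]
    · exact middle a b p q r s hnd hab.1 hpq.1 hrs.1 hfix h1 h2 h3 m12 m23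

end Core
/-! ### Four-cycles that are modules -/

section C4

variable {V : Type*} {C : SimpleGraph V}

/-- The vertices `a, b, c, d` induce a 4-cycle in this order, and every other vertex is adjacent
to all or none of them. -/
structure IsC4Module (C : SimpleGraph V) (a b c d : V) : Prop where
  nodup : [a, b, c, d].Nodup
  ab : C.Adj a b
  bc : C.Adj b c
  cd : C.Adj c d
  da : C.Adj d a
  ac : ¬C.Adj a c
  bd : ¬C.Adj b d
  outside : ∀ w ∉ [a, b, c, d],
    (C.Adj w a ↔ C.Adj w b) ∧ (C.Adj w a ↔ C.Adj w c) ∧ (C.Adj w a ↔ C.Adj w d)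

/-- If both pairs of opposite edges of a 4-cycle are linked, it is a module. -/
theorem IsC4Module.of_linked {a b p q : V} (hnd : [a, b, p, q].Nodup) (hab : C.Adj a b)
    (hpq : C.Adj p q) (h : Linked C a b p q) (h' : Linked C a p b q) : IsC4Module C a b q p := by
  obtain ⟨h1, h2, h3, h4, h5⟩ := h
  simp only [List.nodup_cons, List.mem_cons, List.not_mem_nil, or_false, not_or,
    List.nodup_nil, not_false_eq_true, and_true] at hnd
  refine ⟨by simp [hnd, Ne.symm hnd.2.2], hab, h2, hpq.symm, h1.symm, h3, h4, fun w hw => ?_⟩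
  simp only [List.mem_cons, List.not_mem_nil, or_false, not_or] at hw
  have e1 := h5 w hw.1 hw.2.1 hw.2.2.2 hw.2.2.1
  have e2 := h'.2.2.2.2 w hw.1 hw.2.2.2 hw.2.1 hw.2.2.1
  exact ⟨e1.1, by rw [e1.1, e2.2], e2.1⟩

theorem IsC4Module.nonTwin_ab {a b c d : V} (h : IsC4Module C a b c d) : NonTwin C a b := by
  have hnd := h.nodup
  simp only [List.nodup_cons, List.mem_cons, List.not_mem_nil, or_false, not_or,
    List.nodup_nil, not_false_eq_true, and_true] at hnd
  exact ⟨h.ab, c, Ne.symm hnd.1.2.1, Ne.symm hnd.2.1.1, fun e => h.ac (e.2 h.bc.symm).symm⟩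

/-- At most one vertex outside a 4-cycle module is adjacent to it. -/
theorem IsC4Module.eq_of_adj [Fintype V] (hd : Fintype.card V ≤ chiD Cᶜ + 2) {a b c d t t' : V}
    (h : IsC4Module C a b c d) (ht : t ∉ [a, b, c, d]) (ht' : t' ∉ [a, b, c, d])
    (hta : C.Adj t a) (hta' : C.Adj t' a) : t = t' := by
  by_contra hne
  obtain ⟨o1, o2, o3⟩ := h.outside t ht
  obtain ⟨o1', o2', o3'⟩ := h.outside t' ht'
  have hnd := h.nodup
  simp only [List.nodup_cons, List.mem_cons, List.not_mem_nil, or_false, not_or,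
    List.nodup_nil, not_false_eq_true, and_true] at hnd ht ht'
  -- the three classes induce a triangle on the three antipodal pairs of the octahedron
  obtain ⟨f, hf, hfix, e1, e2, e3, e4⟩ := exists_perm_of_three_pairs hd
    (a := a) (b := t) (p := c) (q := b) (r := d) (s := t')
    (by
      simp only [List.nodup_cons, List.mem_cons, List.not_mem_nil, or_false, not_or,
        List.nodup_nil, not_false_eq_true, and_true]
      grind only)
    hta.symm h.bc.symm (o3'.1 hta').symm
  have k1 := hf a c
  have k2 := hf b d
  have f1 := h.ac
  have f2 := h.bd
  have f3 := h.ab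
  have f4 := h.cd
  have f5 := h.bc
  have f6 := h.da
  have g1 := o1.1 hta
  have g2 := o2.1 hta
  have g3 := o3.1 hta
  have g1' := o1'.1 hta'
  have g2' := o2'.1 hta'
  have g3' := o3'.1 hta'
  have f3' := f3.symm
  have hta'' := hta'.symm
  have g2'' := g2'.symm
  have g1'' := g1'.symm
  clear hf hfix o1 o2 o3 o1' o2' o3' h hnd ht ht'
  grind only

/-- If some vertex `t` is adjacent to a 4-cycle module, then all other non-twin edges meet the
4-cycle or `t`. -/
theorem IsC4Module.not_nonTwin [Fintype V] (hd : Fintype.card V ≤ chiD Cᶜ + 2) {a b c d t : V}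
    (h : IsC4Module C a b c d) (ht : t ∉ [a, b, c, d]) (hta : C.Adj t a) {u v : V}
    (hu : u ∉ [a, b, c, d]) (hv : v ∉ [a, b, c, d]) (hut : u ≠ t) (hvt : v ≠ t) :
    ¬NonTwin C u v := by
  rintro ⟨huv, w, w1, w2, w3⟩
  have hua : ¬C.Adj u a := fun h' => hut (h.eq_of_adj hd hu ht h' hta)
  have hva : ¬C.Adj v a := fun h' => hvt (h.eq_of_adj hd hv ht h' hta)
  obtain ⟨o1, o2, o3⟩ := h.outside t ht
  obtain ⟨u1, u2, u3⟩ := h.outside u hu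
  obtain ⟨v1, v2, v3⟩ := h.outside v hv
  have hnd := h.nodup
  simp only [List.nodup_cons, List.mem_cons, List.not_mem_nil, or_false, not_or,
    List.nodup_nil, not_false_eq_true, and_true] at hnd ht hu hv
  have hw : w ≠ a ∧ w ≠ b ∧ w ≠ c ∧ w ≠ d := by
    have key : ∀ x, ¬C.Adj u x → ¬C.Adj v x → w ≠ x := by
      rintro x h1 h2 rfl
      exact w3 ⟨fun h => absurd h.symm h1, fun h => absurd h.symm h2⟩
    exact ⟨key a hua hva, key b (mt u1.2 hua) (mt v1.2 hva), key c (mt u2.2 hua) (mt v2.2 hva),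
      key d (mt u3.2 hua) (mt v3.2 hva)⟩
  -- merge the edges `ta`, `bc` and `uv`: `w` blocks the exchange of `u` and `v`, and the
  -- adjacencies among `t`, `a`, `b`, `c` block the other exchanges
  obtain ⟨f, hf, hfix, e1, e2, e3, e4⟩ := exists_perm_of_three_pairs hd
    (a := t) (b := a) (p := b) (q := c) (r := u) (s := v)
    (by
      simp only [List.nodup_cons, List.mem_cons, List.not_mem_nil, or_false, not_or,
        List.nodup_nil, not_false_eq_true, and_true]
      have := huv.ne
      grind only) hta h.bc huv
  have k1 := hf t b
  have k2 := hf t c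
  have k3 := hf a b
  have k4 := hf w u
  have fw := hfix w
  have f1 := h.ac
  have f3 := h.ab
  have g1 := o1.1 hta
  have g2 := o2.1 hta
  have hta' := hta.symm
  clear hf hfix h hnd o1 o2 o3 u1 u2 u3 v1 v2 v3
  grind only

/-- A graph without two disjoint edges and without a triangle is a star. -/
theorem exists_cover_of_no_disjoint {R : V → V → Prop} [Nonempty V]
    (hs : ∀ u v, R u v → R v u) (h2 : ∀ a b p q, [a, b, p, q].Nodup → R a b → ¬R p q)
    (hne : ∀ u v, R u v → u ≠ v)
    (h3 : ∀ a b c, R a b → R a c → ¬R b c) : ∃ x, ∀ u v, R u v → u = x ∨ v = x := by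
  by_cases hex : ∃ a b, R a b
  swap
  · push Not at hex
    exact ⟨Classical.arbitrary V, fun u v h => absurd h (hex u v)⟩
  obtain ⟨a, b, hab⟩ := hex
  have hmeet : ∀ u v, R u v → u = a ∨ u = b ∨ v = a ∨ v = b := by
    intro u v huv
    by_contra! hh
    refine h2 a b u v ?_ hab huv
    have := hne _ _ hab
    have := hne _ _ huv
    simp only [List.nodup_cons, List.mem_cons, List.not_mem_nil, or_false, not_or,
      List.nodup_nil, not_false_eq_true, and_true]
    grind only
  by_contra! hcon
  obtain ⟨u, v, huv, hua, hva⟩ := hcon a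
  obtain ⟨x, y, hxy, hxb, hyb⟩ := hcon b
  -- an edge at `b` avoiding `a` and an edge at `a` avoiding `b`
  obtain ⟨w, hw, hwa⟩ : ∃ w, R b w ∧ w ≠ a := by
    rcases hmeet u v huv with h | h | h | h
    · exact absurd h hua
    · exact ⟨v, h ▸ huv, hva⟩
    · exact absurd h hva
    · exact ⟨u, h ▸ hs _ _ huv, hua⟩
  obtain ⟨z, hz, hzb⟩ : ∃ z, R a z ∧ z ≠ b := by
    rcases hmeet x y hxy with h | h | h | h
    · exact ⟨y, h ▸ hxy, hyb⟩
    · exact absurd h hxb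
    · exact ⟨x, h ▸ hs _ _ hxy, hxb⟩
    · exact absurd h hyb
  by_cases hwz : w = z
  · subst hwz
    exact h3 a b w hab hz hw
  · refine h2 b w a z ?_ hw hz
    have := hne _ _ hab
    have := hne _ _ hw
    have := hne _ _ hz
    simp only [List.nodup_cons, List.mem_cons, List.not_mem_nil, or_false, not_or,
      List.nodup_nil, not_false_eq_true, and_true]
    grind only

/-- The four vertices of a 4-cycle module, indexed as the complement of `2K₂`. -/
theorem IsC4Module.index {a b c d : V} (h : IsC4Module C a b c d) :
    Function.Injective (Sum.elim ![a, c] ![b, d]) ∧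
      (∀ i j, i ≠ j → (C.Adj (Sum.elim ![a, c] ![b, d] i) (Sum.elim ![a, c] ![b, d] j) ↔
        ¬(K 2 ⊕g K 2).Adj i j)) ∧
      ∀ w, w ∈ Set.range (Sum.elim ![a, c] ![b, d]) ↔ w ∈ [a, b, c, d] := by
  obtain ⟨hnd, h1, h2, h3, h4, n1, n2, -⟩ := h
  refine ⟨?_, ?_, ?_⟩
  · simp only [List.nodup_cons, List.mem_cons, List.not_mem_nil, or_false, not_or,
      List.nodup_nil, not_false_eq_true, and_true] at hnd
    intro i j
    revert i j
    simp [Sum.forall, Fin.forall_fin_succ, hnd]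
    grind only
  · simp [Sum.forall, Fin.forall_fin_succ, h1, h2, h3, h4, n1, n2, C.adj_comm c a,
      C.adj_comm d b, C.adj_comm b a, C.adj_comm c b, C.adj_comm d c, C.adj_comm a d]
  · intro w
    simp
    grind only

/-- The two edges joining a linked pair are non-twin. -/
theorem linked_nonTwin {a b p q : V} (hab : C.Adj a b) (hnd : [a, b, p, q].Nodup)
    (h : Linked C a b p q) : NonTwin C a p ∧ NonTwin C b q := by
  simp only [List.nodup_cons, List.mem_cons, List.not_mem_nil, or_false, not_or,
    List.nodup_nil, not_false_eq_true, and_true] at hnd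
  exact ⟨⟨h.1, b, Ne.symm hnd.1.1, hnd.2.1.1, fun e => h.2.2.2.1 (e.1 hab.symm)⟩,
    ⟨h.2.1, a, hnd.1.1, hnd.1.2.2, fun e => h.2.2.1 (e.1 hab)⟩⟩

/-- A linked pair of edges together with a third non-twin edge disjoint from both: the other two
edges of the 4-cycle are non-twin as well, and the alternative for three disjoint non-twin edges
applies to them too. -/
theorem coreType_or_c4_of_linked [Fintype V] (hd : Fintype.card V ≤ chiD Cᶜ + 2)
    {a b p q r s : V} (hnd : [a, b, p, q, r, s].Nodup) (hab : C.Adj a b) (hpq : C.Adj p q)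
    (hrs : NonTwin C r s) (h : Linked C a b p q) :
    CoreType C ∨ IsC4Module C a b q p := by
  have hnd' := hnd
  simp only [List.nodup_cons, List.mem_cons, List.not_mem_nil, or_false, not_or,
    List.nodup_nil, not_false_eq_true, and_true] at hnd'
  have hnd2 : [a, p, b, q, r, s].Nodup := by
    simp [hnd', Ne.symm hnd'.2.1.1]
  have hnd4 : [a, b, p, q].Nodup := by simp [hnd']
  obtain ⟨hap, hbq⟩ := linked_nonTwin hab hnd4 h
  rcases linked_of_three_nonTwin hd hnd2 hap hbq hrs with h' | h' | h' | ⟨f, hf, hfix, e1, e2, e3⟩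
  · rcases h' with h' | h'
    · exact Or.inr (.of_linked hnd4 hab hpq h h')
    · exact absurd h'.1 h.2.2.1
  · -- `b` sees `a` but not `p`, so the pair `a, p` is not linked to a pair not containing `b`
    refine absurd hab.symm (mt (fun e => ?_) h.2.2.2.1)
    rcases h' with h' | h'
    · exact (h'.2.2.2.2 b (Ne.symm hnd'.1.1) hnd'.2.1.1 hnd'.2.1.2.2.1 hnd'.2.1.2.2.2).1.1 e
    · exact (h'.2.2.2.2 b (Ne.symm hnd'.1.1) hnd'.2.1.1 hnd'.2.1.2.2.2 hnd'.2.1.2.2.1).1.1 e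
  · refine absurd hab (mt (fun e => ?_) h.2.2.1)
    rcases h' with h' | h'
    · exact (h'.2.2.2.2 a hnd'.1.1 hnd'.1.2.2.1 hnd'.1.2.2.2.1 hnd'.1.2.2.2.2).1.1 e
    · exact (h'.2.2.2.2 a hnd'.1.1 hnd'.1.2.2.1 hnd'.1.2.2.2.2 hnd'.1.2.2.2.1).1.1 e
  · exact Or.inl (coreType_of_swap_three_nonTwin hd hnd2 hap hbq hrs hf hfix e1 e2 e3)

/-- Three disjoint non-twin edges. -/
theorem coreType_or_c4_of_three [Fintype V] (hd : Fintype.card V ≤ chiD Cᶜ + 2)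
    {a b p q r s : V} (hnd : [a, b, p, q, r, s].Nodup) (hab : NonTwin C a b)
    (hpq : NonTwin C p q) (hrs : NonTwin C r s) :
    CoreType C ∨ ∃ a b c d, IsC4Module C a b c d := by
  have hnd' := hnd
  simp only [List.nodup_cons, List.mem_cons, List.not_mem_nil, or_false, not_or,
    List.nodup_nil, not_false_eq_true, and_true] at hnd'
  obtain ⟨⟨n1, n2, n3, n4, n5⟩, ⟨n6, n7, n8, n9⟩, ⟨n10, n11, n12⟩, ⟨n13, n14⟩, n15⟩ := hnd'
  rcases linked_of_three_nonTwin hd hnd hab hpq hrs with h | h | h | ⟨f, hf, hfix, e1, e2, e3⟩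
  · rcases h with h | h
    · exact (coreType_or_c4_of_linked hd hnd hab.1 hpq.1 hrs h).imp_right fun h => ⟨_, _, _, _, h⟩
    · exact (coreType_or_c4_of_linked hd (p := q) (q := p) (by simp [*, Ne.symm n10]) hab.1
        hpq.1.symm hrs h).imp_right fun h => ⟨_, _, _, _, h⟩
  · rcases h with h | h
    · exact (coreType_or_c4_of_linked hd (p := r) (q := s) (r := p) (s := q)
        (by simp [*, Ne.symm n11, Ne.symm n12, Ne.symm n13, Ne.symm n14]) hab.1
        hrs.1 hpq h).imp_right fun h => ⟨_, _, _, _, h⟩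
    · exact (coreType_or_c4_of_linked hd (p := s) (q := r) (r := p) (s := q)
        (by simp [*, Ne.symm n11, Ne.symm n12, Ne.symm n13, Ne.symm n14, Ne.symm n15]) hab.1
        hrs.1.symm hpq h).imp_right fun h => ⟨_, _, _, _, h⟩
  · rcases h with h | h
    · exact (coreType_or_c4_of_linked hd (a := p) (b := q) (p := r) (q := s) (r := a) (s := b)
        (by simp [*, Ne.symm n2, Ne.symm n3, Ne.symm n4, Ne.symm n5, Ne.symm n6, Ne.symm n7,
          Ne.symm n8, Ne.symm n9]) hpq.1 hrs.1 hab h).imp_right fun h => ⟨_, _, _, _, h⟩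
    · exact (coreType_or_c4_of_linked hd (a := p) (b := q) (p := s) (q := r) (r := a) (s := b)
        (by simp [*, Ne.symm n2, Ne.symm n3, Ne.symm n4, Ne.symm n5, Ne.symm n6, Ne.symm n7,
          Ne.symm n8, Ne.symm n9, Ne.symm n15]) hpq.1
        hrs.1.symm hab h).imp_right fun h => ⟨_, _, _, _, h⟩
  · exact Or.inl (coreType_of_swap_three_nonTwin hd hnd hab hpq hrs hf hfix e1 e2 e3)

end C4
/-! ### From 4-cycle modules and 5-cycles to the structure -/

section House

variable {V : Type*} {C : SimpleGraph V}

/-- A 4-cycle module gives one of the structures with a 4-cycle. -/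
theorem IsC4Module.coreType [Fintype V] (hd : Fintype.card V ≤ chiD Cᶜ + 2) {a b c d : V}
    (h : IsC4Module C a b c d) : CoreType C := by
  obtain ⟨i1, i2, i3⟩ := h.index
  by_cases hex : ∃ t ∉ [a, b, c, d], C.Adj t a
  · obtain ⟨t, ht, hta⟩ := hex
    obtain ⟨o1, o2, o3⟩ := h.outside t ht
    refine .c4Cone _ t i1 i2 (fun hm => ht ((i3 t).1 hm)) ?_ ?_ ?_
    · simp [Sum.forall, Fin.forall_fin_succ, hta, o1.1 hta, o2.1 hta, o3.1 hta]
    · intro w hw hwt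
      rw [i3] at hw
      have hwa : ¬C.Adj w a := fun h' => hwt (h.eq_of_adj hd hw ht h' hta)
      obtain ⟨w1, w2, w3⟩ := h.outside w hw
      simp [Sum.forall, Fin.forall_fin_succ, hwa, ← w1, ← w2, ← w3]
    · rw [coversPairs_compl_iff]
      intro u v hu hv
      simp only [Set.mem_insert_iff, i3, not_or] at hu hv
      exact h.not_nonTwin hd ht hta hu.2 hv.2 hu.1 hv.1
  push Not at hex
  have hout : ∀ w ∉ [a, b, c, d], ¬C.Adj w a ∧ ¬C.Adj w b ∧ ¬C.Adj w c ∧ ¬C.Adj w d := by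
    intro w hw
    have hwa := hex w hw
    obtain ⟨w1, w2, w3⟩ := h.outside w hw
    exact ⟨hwa, mt w1.2 hwa, mt w2.2 hwa, mt w3.2 hwa⟩
  have he : IsCoComponent C (K 2 ⊕g K 2) (Sum.elim ![a, c] ![b, d]) := by
    refine ⟨i1, i2, fun w hw => ?_⟩
    rw [i3] at hw
    simp [Sum.forall, Fin.forall_fin_succ, hout w hw]
  have hnd := h.nodup
  simp only [List.nodup_cons, List.mem_cons, List.not_mem_nil, or_false, not_or,
    List.nodup_nil, not_false_eq_true, and_true] at hnd
  -- two disjoint non-twin edges away from the 4-cycle are linked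
  have hlink : ∀ u v x y, u ∉ [a, b, c, d] → v ∉ [a, b, c, d] → x ∉ [a, b, c, d] →
      y ∉ [a, b, c, d] → [u, v, x, y].Nodup → NonTwin C u v → NonTwin C x y →
      Linked C u v x y ∨ Linked C u v y x := by
    intro u v x y hu hv hx hy hn huv hxy
    have hu' := hout u hu
    have hv' := hout v hv
    have hx' := hout x hx
    have hy' := hout y hy
    simp only [List.nodup_cons, List.mem_cons, List.not_mem_nil, or_false, not_or,
      List.nodup_nil, not_false_eq_true, and_true] at hn hu hv hx hy
    have hn6 : [a, b, u, v, x, y].Nodup := by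
      simp [hn, hnd, Ne.symm hu.1, Ne.symm hu.2.1, Ne.symm hv.1, Ne.symm hv.2.1, Ne.symm hx.1,
        Ne.symm hx.2.1, Ne.symm hy.1, Ne.symm hy.2.1]
    rcases linked_of_three_nonTwin hd hn6 h.nonTwin_ab huv hxy with
      (h' | h') | (h' | h') | h' | ⟨f, hf, hfix, e1, e2, e3⟩
    · exact absurd h'.1.symm hu'.1
    · exact absurd h'.1.symm hv'.1
    · exact absurd h'.1.symm hx'.1
    · exact absurd h'.1.symm hy'.1
    · exact h'
    · have fc : f c = c := (hfix c).resolve_right (by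
        clear * - hnd hu hv hx hy
        grind only)
      have := hf c b
      rw [fc, e1.2] at this
      exact absurd (this.2 h.bc.symm).symm h.ac
  by_cases hdis : ∃ u v x y, (u ∉ [a, b, c, d] ∧ v ∉ [a, b, c, d] ∧ x ∉ [a, b, c, d] ∧
      y ∉ [a, b, c, d]) ∧ [u, v, x, y].Nodup ∧ NonTwin C u v ∧ NonTwin C x y
  · obtain ⟨u, v, x, y, ⟨hu, hv, hx, hy⟩, hn, huv, hxy⟩ := hdis
    obtain ⟨x, y, hx, hy, hn, hxy, hl⟩ : ∃ x y, x ∉ [a, b, c, d] ∧ y ∉ [a, b, c, d] ∧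
        [u, v, x, y].Nodup ∧ NonTwin C x y ∧ Linked C u v x y := by
      rcases hlink u v x y hu hv hx hy hn huv hxy with h' | h'
      · exact ⟨x, y, hx, hy, hn, hxy, h'⟩
      · refine ⟨y, x, hy, hx, ?_, hxy.symm, h'⟩
        simp only [List.nodup_cons, List.mem_cons, List.not_mem_nil, or_false, not_or,
          List.nodup_nil, not_false_eq_true, and_true] at hn ⊢
        clear * - hn
        grind only
    have hn2 : [u, x, v, y].Nodup := by
      simp only [List.nodup_cons, List.mem_cons, List.not_mem_nil, or_false, not_or,
        List.nodup_nil, not_false_eq_true, and_true] at hn ⊢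
      clear * - hn
      grind only
    obtain ⟨hux, hvy⟩ := linked_nonTwin huv.1 hn hl
    have hl2 : Linked C u x v y := by
      rcases hlink u x v y hu hx hv hy hn2 hux hvy with h' | h'
      · exact h'
      · exact absurd h'.1 hl.2.2.1
    have h2 : IsC4Module C u v y x := .of_linked hn huv.1 hxy.1 hl hl2
    obtain ⟨j1, j2, j3⟩ := h2.index
    have hn4 := h2.nodup
    have ha : a ∉ [u, v, y, x] ∧ b ∉ [u, v, y, x] ∧ c ∉ [u, v, y, x] ∧ d ∉ [u, v, y, x] := by
      simp only [List.mem_cons, List.not_mem_nil, or_false, not_or] at hu hv hx hy ⊢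
      exact ⟨⟨Ne.symm hu.1, Ne.symm hv.1, Ne.symm hy.1, Ne.symm hx.1⟩,
        ⟨Ne.symm hu.2.1, Ne.symm hv.2.1, Ne.symm hy.2.1, Ne.symm hx.2.1⟩,
        ⟨Ne.symm hu.2.2.1, Ne.symm hv.2.2.1, Ne.symm hy.2.2.1, Ne.symm hx.2.2.1⟩,
        ⟨Ne.symm hu.2.2.2, Ne.symm hv.2.2.2, Ne.symm hy.2.2.2, Ne.symm hx.2.2.2⟩⟩
    -- the first 4-cycle contains non-twin edges, so no vertex is adjacent to the second one
    have hout2 : ∀ w ∉ [u, v, y, x], ¬C.Adj w u ∧ ¬C.Adj w v ∧ ¬C.Adj w y ∧ ¬C.Adj w x := by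
      intro w hw
      have hwu : ¬C.Adj w u := by
        intro hwu
        have hwa : a ≠ w := by rintro rfl; exact (hout u hu).1 hwu.symm
        have hwb : b ≠ w := by rintro rfl; exact (hout u hu).2.1 hwu.symm
        exact h2.not_nonTwin hd hw hwu ha.1 ha.2.1 hwa hwb h.nonTwin_ab
      obtain ⟨w1, w2, w3⟩ := h2.outside w hw
      exact ⟨hwu, mt w1.2 hwu, mt w2.2 hwu, mt w3.2 hwu⟩
    have hdisj : ∀ i j, Sum.elim ![a, c] ![b, d] i ≠ Sum.elim ![u, y] ![v, x] j := by
      intro i j hij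
      have h1 := (i3 _).1 ⟨i, rfl⟩
      have h2 := (j3 _).1 ⟨j, rfl⟩
      rw [← hij] at h2
      simp only [List.mem_cons, List.not_mem_nil, or_false] at h1
      rcases h1 with h1 | h1 | h1 | h1 <;> rw [h1] at h2
      exacts [ha.1 h2, ha.2.1 h2, ha.2.2.1 h2, ha.2.2.2 h2]
    have hnadj : ∀ i j, ¬C.Adj (Sum.elim ![u, y] ![v, x] j) (Sum.elim ![a, c] ![b, d] i) :=
      fun i j => he.2.2 _ (fun ⟨k, hk⟩ => hdisj k j hk) i
    refine .twoC4 (Sum.elim (Sum.elim ![a, c] ![b, d]) (Sum.elim ![u, y] ![v, x])) ⟨?_, ?_, ?_⟩ ?_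
    · rintro (i | i) (j | j) hij
      · exact congrArg _ (i1 hij)
      · exact absurd hij (hdisj i j)
      · exact absurd hij.symm (hdisj j i)
      · exact congrArg _ (j1 hij)
    · rintro (i | i) (j | j) hij
      · simpa [join] using i2 i j (fun h => hij (congrArg _ h))
      · simpa [join] using fun h => hnadj i j h.symm
      · simpa [join] using hnadj j i
      · simpa [join] using j2 i j (fun h => hij (congrArg _ h))
    · intro w hw
      rintro (i | i)
      · exact he.2.2 w (fun ⟨k, hk⟩ => hw ⟨.inl k, hk⟩) i
      · have hw2 : w ∉ [u, v, y, x] := fun h => by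
          obtain ⟨k, hk⟩ := (j3 w).2 h
          exact hw ⟨.inr k, hk⟩
        revert i
        simp [Sum.forall, Fin.forall_fin_succ, hout2 w hw2]
    · rw [coversPairs_compl_iff]
      intro p q hp hq hpq
      have hp1 : p ∉ [a, b, c, d] := fun h => by
        obtain ⟨k, hk⟩ := (i3 p).2 h
        exact hp ⟨.inl k, hk⟩
      have hq1 : q ∉ [a, b, c, d] := fun h => by
        obtain ⟨k, hk⟩ := (i3 q).2 h
        exact hq ⟨.inl k, hk⟩
      have hp2 : p ∉ [u, v, y, x] := fun h => by
        obtain ⟨k, hk⟩ := (j3 p).2 h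
        exact hp ⟨.inr k, hk⟩
      have hq2 : q ∉ [u, v, y, x] := fun h => by
        obtain ⟨k, hk⟩ := (j3 q).2 h
        exact hq ⟨.inr k, hk⟩
      have hpu := hout2 p hp2
      have hqu := hout2 q hq2
      have hne := hpq.1.ne
      simp only [List.nodup_cons, List.mem_cons, List.not_mem_nil, or_false, not_or,
        List.nodup_nil, not_false_eq_true, and_true] at hn hp2 hq2
      rcases hlink u v p q hu hv hp1 hq1 (by simp [hn, hne, Ne.symm hp2.1, Ne.symm hp2.2.1,
        Ne.symm hq2.1, Ne.symm hq2.2.1]) huv hpq with h' | h'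
      · exact hpu.1 h'.1.symm
      · exact hqu.1 h'.1.symm
  · -- the non-twin edges away from the 4-cycle form a star
    have : Nonempty V := ⟨a⟩
    obtain ⟨x, hx⟩ := exists_cover_of_no_disjoint
      (R := fun u v => u ∉ [a, b, c, d] ∧ v ∉ [a, b, c, d] ∧ NonTwin C u v)
      (fun u v h => ⟨h.2.1, h.1, h.2.2.symm⟩)
      (fun u v x y hn h1 h2 => hdis ⟨u, v, x, y, ⟨h1.1, h1.2.1, h2.1, h2.2.1⟩, hn, h1.2.2, h2.2.2⟩)
      (fun u v h => h.2.2.1.ne) (fun u v w h1 h2 h3 => by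
        have hu := hout u h1.1
        have hv := hout v h1.2.1
        have hw := hout w h2.2.1
        have k1 := h1.1
        have k2 := h1.2.1
        have k3 := h2.2.1
        have n1 := h1.2.2.1.ne
        have n2 := h2.2.2.1.ne
        have n3 := h3.2.2.1.ne
        simp only [List.mem_cons, List.not_mem_nil, or_false, not_or] at k1 k2 k3
        rcases linked_of_triangle_nonTwin hd (d := a) (e := b) (by simp [*]) h1.2.2 h2.2.2
          h3.2.2 h.nonTwin_ab with (h' | h') | (h' | h') | (h' | h')
        · exact hu.1 h'.1
        · exact hu.2.1 h'.1
        · exact hu.1 h'.1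
        · exact hu.2.1 h'.1
        · exact hv.1 h'.1
        · exact hv.2.1 h'.1)
    have hin : ∀ u v, NonTwin C u v → u ∈ [a, b, c, d] → v ∈ [a, b, c, d] := by
      intro u v huv hu
      by_contra hv
      have hv' := hout v hv
      simp only [List.mem_cons, List.not_mem_nil, or_false] at hu
      rcases hu with rfl | rfl | rfl | rfl
      exacts [hv'.1 huv.1.symm, hv'.2.1 huv.1.symm, hv'.2.2.1 huv.1.symm, hv'.2.2.2 huv.1.symm]
    -- if the center lies on the 4-cycle, there are no such edges
    by_cases hxQ : x ∈ [a, b, c, d]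
    · refine .cover a c ?_
      rw [coversPairs_compl_iff]
      intro u v hu hv huv
      simp only [Set.mem_insert_iff, Set.mem_singleton_iff, not_or] at hu hv
      by_cases huQ : u ∈ [a, b, c, d]
      · have hvQ := hin u v huv huQ
        have hu' : u = b ∨ u = d := by simpa [hu] using huQ
        have hv' : v = b ∨ v = d := by simpa [hv] using hvQ
        rcases hu' with rfl | rfl <;> rcases hv' with rfl | rfl
        exacts [huv.1.ne rfl, h.bd huv.1, h.bd huv.1.symm, huv.1.ne rfl]
      · have hvQ : v ∉ [a, b, c, d] := fun hv => huQ (hin v u huv.symm hv)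
        rcases hx u v ⟨huQ, hvQ, huv⟩ with rfl | rfl
        · exact huQ hxQ
        · exact hvQ hxQ
    · refine .c4Star _ he x (fun hm => hxQ ((i3 x).1 hm)) ?_
      rw [coversPairs_compl_iff]
      intro u v hu hv huv
      simp only [Set.mem_insert_iff, i3, not_or] at hu hv
      rcases hx u v ⟨hu.2, hv.2, huv⟩ with rfl | rfl
      · exact hu.1 rfl
      · exact hv.1 rfl

/-- A 5-cycle of non-twin edges is a component, if there are no three disjoint non-twin edges and
no triangle of non-twin edges with a further disjoint one. -/
theorem coreType_of_cycle5 [Fintype V] (hd : Fintype.card V ≤ chiD Cᶜ + 2)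
    (h3 : ∀ a b p q r s, [a, b, p, q, r, s].Nodup → NonTwin C a b → NonTwin C p q →
      ¬NonTwin C r s)
    (h32 : ∀ a b c d g, [a, b, c, d, g].Nodup → NonTwin C a b → NonTwin C a c → NonTwin C b c →
      ¬NonTwin C d g)
    {a b c d g : V} (hnd : [a, b, c, d, g].Nodup) (hab : NonTwin C a b) (hbc : NonTwin C b c)
    (hcd : NonTwin C c d) (hdg : NonTwin C d g) (hga : NonTwin C g a) : CoreType C := by
  -- edges that would complete a forbidden configuration join twins
  have twin : ∀ {u v}, C.Adj u v → ¬NonTwin C u v → ∀ w, w ≠ u → w ≠ v →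
      (C.Adj w u ↔ C.Adj w v) := by
    intro u v huv h w h1 h2
    by_contra h'
    exact h ⟨huv, w, h1, h2, h'⟩
  -- a chord `ac` would join twins, and so would `ad`; then `c` and `d` are twins
  have chord : ∀ a b c d g : V, [a, b, c, d, g].Nodup → NonTwin C a b → NonTwin C b c →
      NonTwin C c d → NonTwin C d g → NonTwin C g a → ¬C.Adj a c := by
    clear hnd hab hbc hcd hdg hga a b c d g
    intro a b c d g hnd hab hbc hcd hdg hga hac
    have nac : ¬NonTwin C a c := fun h => h32 a b c d g hnd hab h hbc hdg
    simp only [List.nodup_cons, List.mem_cons, List.not_mem_nil, or_false, not_or,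
      List.nodup_nil, not_false_eq_true, and_true] at hnd
    have had : C.Adj a d := ((twin hac nac d (Ne.symm hnd.1.2.2.1)
      (Ne.symm hnd.2.2.1.1)).2 hcd.1.symm).symm
    have nad : ¬NonTwin C a d := fun h => h32 a d g b c (by
      simp [hnd, Ne.symm hnd.2.1.2.1, Ne.symm hnd.2.1.2.2,
        Ne.symm hnd.2.2.1.1, Ne.symm hnd.2.2.1.2]) h hga.symm hdg hbc
    obtain ⟨-, w, w1, w2, w3⟩ := hcd
    by_cases hwa : w = a
    · subst hwa
      exact w3 ⟨fun _ => had, fun _ => hac⟩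
    · exact w3 ((twin hac nac w hwa w1).symm.trans (twin had nad w hwa w2))
  -- an edge `wa` leaving the cycle would join twins, and so would `wb`; then `a` and `b` are twins
  have outside : ∀ a b c d g : V, [a, b, c, d, g].Nodup → NonTwin C a b → NonTwin C b c →
      NonTwin C c d → NonTwin C d g → NonTwin C g a → ∀ w ∉ [a, b, c, d, g], ¬C.Adj w a := by
    clear hnd hab hbc hcd hdg hga a b c d g
    intro a b c d g hnd hab hbc hcd hdg hga w hw hwa
    simp only [List.nodup_cons, List.mem_cons, List.not_mem_nil, or_false, not_or,
      List.nodup_nil, not_false_eq_true, and_true] at hnd hw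
    have nwa : ¬NonTwin C w a := fun h => h3 w a b c d g (by simp [hnd, hw]) h hbc hdg
    have hwb : C.Adj w b := ((twin hwa nwa b (Ne.symm hw.2.1) (Ne.symm hnd.1.1)).2
      hab.1.symm).symm
    have nwb : ¬NonTwin C w b := fun h => h3 w b c d g a (by
      simp [hnd, hw, Ne.symm hnd.1.1, Ne.symm hnd.1.2.1, Ne.symm hnd.1.2.2.1,
        Ne.symm hnd.1.2.2.2]) h hcd hga
    obtain ⟨-, x, x1, x2, x3⟩ := hab
    by_cases hxw : x = w
    · subst hxw
      exact x3 ⟨fun _ => hwb, fun _ => hwa⟩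
    · exact x3 ((twin hwa nwa x hxw x1).symm.trans (twin hwb nwb x hxw x2))
  have rot : ∀ {a b c d g : V}, [a, b, c, d, g].Nodup → [b, c, d, g, a].Nodup := by
    intro a b c d g h
    exact (List.nodup_rotate (l := [a, b, c, d, g]) (n := 1)).2 h
  have hn1 := rot hnd
  have hn2 := rot hn1
  have hn3 := rot hn2
  have hn4 := rot hn3
  have c1 := chord _ _ _ _ _ hnd hab hbc hcd hdg hga
  have c2 := chord _ _ _ _ _ hn1 hbc hcd hdg hga hab
  have c3 := chord _ _ _ _ _ hn2 hcd hdg hga hab hbc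
  have c4 := chord _ _ _ _ _ hn3 hdg hga hab hbc hcd
  have c5 := chord _ _ _ _ _ hn4 hga hab hbc hcd hdg
  have he : IsCoComponent C (cycleGraph 5) ![a, c, g, b, d] := by
    have o1 := outside _ _ _ _ _ hnd hab hbc hcd hdg hga
    have o2 := outside _ _ _ _ _ hn1 hbc hcd hdg hga hab
    have o3 := outside _ _ _ _ _ hn2 hcd hdg hga hab hbc
    have o4 := outside _ _ _ _ _ hn3 hdg hga hab hbc hcd
    have o5 := outside _ _ _ _ _ hn4 hga hab hbc hcd hdg
    have c1' : ¬C.Adj c a := fun h => c1 h.symm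
    have c2' : ¬C.Adj d b := fun h => c2 h.symm
    have c3' : ¬C.Adj g c := fun h => c3 h.symm
    have c4' : ¬C.Adj a d := fun h => c4 h.symm
    have c5' : ¬C.Adj b g := fun h => c5 h.symm
    clear chord outside rot twin hn1 hn2 hn3 hn4 h3 h32
    refine ⟨?_, ?_, fun w hw => ?_⟩
    · refine List.nodup_ofFn.1 ?_
      simp only [List.nodup_cons, List.mem_cons, List.not_mem_nil, or_false, not_or,
        List.nodup_nil, not_false_eq_true, and_true] at hnd
      simp
      grind only
    · simp +decide [Fin.forall_fin_succ, c1, c2, c3, c4, c5, hab.1, hbc.1, hcd.1, hdg.1, hga.1,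
        hab.1.symm, hbc.1.symm, hcd.1.symm, hdg.1.symm, hga.1.symm, c1', c2', c3', c4', c5']
    · have hw' : w ≠ a ∧ w ≠ b ∧ w ≠ c ∧ w ≠ d ∧ w ≠ g := by
        simp at hw
        grind only
      simp [Fin.forall_fin_succ, o1 w (by simp [hw']), o2 w (by simp [hw']),
        o3 w (by simp [hw']), o4 w (by simp [hw']), o5 w (by simp [hw'])]
  exact .cycle5 _ he (he.coversPairs hd (i := 0) (j := 3) (k := 1) (l := 4) (u := 2) (v := 2)
    (by decide) (by decide) (by decide) (by decide) (by decide) (by decide) (by decide))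

end House
/-! ### Triangles of non-twin edges -/

section Triangle

variable {V : Type*} {C : SimpleGraph V}

/-- A triangle `abc` of non-twin edges whose edge `ab` is linked to an edge `dg` spans a wheel or
a house with it; the first forces a 4-cycle module, the second is a component. -/
theorem coreType_of_linked_triangle [Fintype V] (hd : Fintype.card V ≤ chiD Cᶜ + 2)
    (h3 : ∀ a b p q r s, [a, b, p, q, r, s].Nodup → NonTwin C a b → NonTwin C p q →
      ¬NonTwin C r s)
    {a b c d g : V} (hnd : [a, b, c, d, g].Nodup) (hab : C.Adj a b) (hac : C.Adj a c)
    (hbc : C.Adj b c) (hdg : C.Adj d g) (hl : Linked C a b d g) : CoreType C := by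
  obtain ⟨had, hbg, hag, hbd, hout⟩ := hl
  have hnd0 := hnd
  simp only [List.nodup_cons, List.mem_cons, List.not_mem_nil, or_false, not_or,
    List.nodup_nil, not_false_eq_true, and_true] at hnd
  have hcdg := (hout c (Ne.symm hnd.1.2.1) (Ne.symm hnd.2.1.1) hnd.2.2.1.1 hnd.2.2.1.2).2
  -- a vertex seeing the whole 4-cycle forces any other vertex to be uniform on it
  have wheel : ∀ c w, [a, b, c, d, g].Nodup → C.Adj a c → C.Adj b c → C.Adj c d → C.Adj c g →
      w ∉ [a, b, c, d, g] → (C.Adj w a ↔ C.Adj w b) → (C.Adj w d ↔ C.Adj w g) →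
      (C.Adj w a ↔ C.Adj w d) := by
    clear h3 hnd hac hbc hcdg hnd0
    intro c w hnd hac hbc hcd hcg hw h1 h2
    by_contra h12
    have hnd2 : [a, d, c, b, g].Nodup := by
      simp only [List.nodup_cons, List.mem_cons, List.not_mem_nil, or_false, not_or,
        List.nodup_nil, not_false_eq_true, and_true] at hnd ⊢
      clear * - hnd
      grind only
    obtain ⟨f, hf, hfix, e1, e2, e3, e4, e5⟩ :=
      exists_perm_of_triangle_pair hd hnd2 had hac hcd.symm hbg
    have fw : f w = w := (hfix w).resolve_right (by
      clear * - hw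
      simp only [List.mem_cons, List.not_mem_nil, or_false] at hw
      tauto)
    have k1 := hf w a
    have k2 := hf w b
    have k3 := hf w d
    have k4 := hf c b
    have k5 := hf c g
    have k6 := f.injective.ne hac.ne
    have k7 := f.injective.ne hcd.ne
    have hba := hab.symm
    have hcb := hbc.symm
    have hdb : ¬C.Adj d b := fun h => hbd h.symm
    clear hf hfix hout hnd hnd2 hw
    grind only
  by_cases hcd : C.Adj c d
  · refine IsC4Module.coreType hd (a := a) (b := b) (c := g) (d := d) ⟨?_, hab, hbg, hdg.symm,
      had.symm, hag, hbd, fun w hw => ?_⟩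
    · simp [hnd, Ne.symm hnd.2.2.2]
    · simp only [List.mem_cons, List.not_mem_nil, or_false, not_or] at hw
      have ho := hout w hw.1 hw.2.1 hw.2.2.2 hw.2.2.1
      have : C.Adj w a ↔ C.Adj w d := by
        by_cases hwc : w = c
        · subst hwc
          exact ⟨fun _ => hcd, fun _ => hac.symm⟩
        · exact wheel c w hnd0 hac hbc hcd (hcdg.1 hcd) (by simp [hw, hwc]) ho.1 ho.2
      exact ⟨ho.1, by rw [this, ho.2], this⟩
  have hcg : ¬C.Adj c g := mt hcdg.2 hcd
  have hdc : ¬C.Adj d c := fun h => hcd h.symm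
  have hgc : ¬C.Adj g c := fun h => hcg h.symm
  have hga : ¬C.Adj g a := fun h => hag h.symm
  have hdb : ¬C.Adj d b := fun h => hbd h.symm
  -- an outside vertex seeing the house gives three merged edges respected by no automorphism, or
  -- three disjoint non-twin edges
  have house : ∀ w ∉ [a, b, c, d, g], ¬C.Adj w a ∧ ¬C.Adj w b ∧ ¬C.Adj w c ∧ ¬C.Adj w d ∧
      ¬C.Adj w g := by
    intro w hw
    have hw' := hw
    simp only [List.mem_cons, List.not_mem_nil, or_false, not_or] at hw
    obtain ⟨o1, o2⟩ := hout w hw.1 hw.2.1 hw.2.2.2.1 hw.2.2.2.2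
    by_cases hwa : C.Adj w a <;> by_cases hwd : C.Adj w d
    · exfalso
      have := wheel w c (by simp [hnd, Ne.symm hw.1, Ne.symm hw.2.1, hw.2.2.2.1, hw.2.2.2.2])
        hwa.symm (o1.1 hwa).symm hwd (o2.1 hwd) (by simp [hnd, Ne.symm hw.2.2.1,
          Ne.symm hnd.1.2.1, Ne.symm hnd.2.1.1]) ⟨fun _ => hbc.symm, fun _ => hac.symm⟩ hcdg
      exact hcd (this.1 hac.symm)
    · exfalso
      obtain ⟨f, hf, hfix, e1, e2, e3, e4⟩ := exists_perm_of_three_pairs hd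
        (a := a) (b := c) (p := b) (q := w) (r := d) (s := g)
        (by
          simp only [List.nodup_cons, List.mem_cons, List.not_mem_nil, or_false, not_or,
            List.nodup_nil, not_false_eq_true, and_true]
          clear * - hnd hw
          grind only) hac (o1.1 hwa).symm hdg
      have k1 := hf a d
      have k2 := hf b g
      have hwg := mt o2.2 hwd
      clear hf hfix hout hnd hnd0 hw wheel h3
      grind only
    · exfalso
      by_cases hwc : C.Adj w c
      · -- the complement of a 6-cycle
        refine h3 a d b g c w ?_ ⟨had, b, Ne.symm hnd.1.1, hnd.2.1.2.1, fun h => hbd (h.1 hab.symm)⟩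
          ⟨hbg, a, hnd.1.1, hnd.1.2.2.2, fun h => hag (h.1 hab)⟩
          ⟨hwc.symm, a, hnd.1.2.1, Ne.symm hw.1, fun h => hwa (h.1 hac).symm⟩
        simp only [List.nodup_cons, List.mem_cons, List.not_mem_nil, or_false, not_or,
          List.nodup_nil, not_false_eq_true, and_true]
        clear * - hnd hw
        grind only
      · obtain ⟨f, hf, hfix, e1, e2, e3, e4⟩ := exists_perm_of_three_pairs hd
          (a := c) (b := a) (p := b) (q := g) (r := d) (s := w)
          (by
            simp only [List.nodup_cons, List.mem_cons, List.not_mem_nil, or_false, not_or,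
              List.nodup_nil, not_false_eq_true, and_true]
            clear * - hnd hw
            grind only) hac.symm hbg hwd.symm
        have k1 := hf a d
        have k2 := hf a b
        have k3 := hf c b
        have k4 := hf c w
        have k5 := hf g w
        have k6 := hf d g
        have hwb := mt o1.2 hwa
        have hwg := o2.1 hwd
        have hwg' := hwg.symm
        have hcw : ¬C.Adj c w := fun h => hwc h.symm
        have haw : ¬C.Adj a w := fun h => hwa h.symm
        have hcb := hbc.symm
        clear hf hfix hout hnd hnd0 hw wheel h3
        grind only
    · by_cases hwc : C.Adj w c
      · exfalso
        obtain ⟨f, hf, hfix, e1, e2, e3, e4⟩ := exists_perm_of_three_pairs hd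
          (a := c) (b := w) (p := a) (q := d) (r := b) (s := g)
          (by
            simp only [List.nodup_cons, List.mem_cons, List.not_mem_nil, or_false, not_or,
              List.nodup_nil, not_false_eq_true, and_true]
            clear * - hnd hw
            grind only) hwc.symm had hbg
        have k1 := hf c a
        have k2 := hf c b
        have hwb := mt o1.2 hwa
        have hwg := mt o2.2 hwd
        have hca := hac.symm
        have hcb := hbc.symm
        clear hf hfix hout hnd hnd0 hw wheel h3
        grind only
      · exact ⟨hwa, mt o1.2 hwa, hwc, hwd, mt o2.2 hwd⟩
  have he : IsCoComponent C (pathGraph 5) ![b, d, c, g, a] := by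
    refine ⟨?_, ?_, fun w hw => ?_⟩
    · refine List.nodup_ofFn.1 ?_
      clear * - hnd
      simp
      grind only
    · simp +decide [pathGraph_adj, Fin.forall_fin_succ, hab, hab.symm, hac, hac.symm, hbc,
        hbc.symm, hdg, hdg.symm, had, had.symm, hbg, hbg.symm, hag, hga, hbd, hdb, hcd, hdc,
        hcg, hgc]
    · have := house w (by simp at hw ⊢; clear * - hw; grind only)
      simp [Fin.forall_fin_succ, this]
  exact .path _ he (he.coversPairs hd (i := 4) (j := 1) (k := 0) (l := 3) (u := 2) (v := 2)
    (by decide) (by decide) (by decide) (by simp [pathGraph_adj]) (by simp [pathGraph_adj])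
    (by simp [pathGraph_adj]) (by simp [pathGraph_adj]))

end Triangle

/-! ### The structure theorem for the complement -/

section Structure

variable {V : Type*} {C : SimpleGraph V}

/-- A graph without `3K₂`, `K₃ ∪ K₂`, `C₅` and `K₄` as (not necessarily induced) subgraphs has two
vertices that meet all edges. -/
theorem exists_cover_pair {R : V → V → Prop} [Nonempty V]
    (hs : ∀ u v, R u v → R v u) (hne : ∀ u v, R u v → u ≠ v)
    (h3 : ∀ a b p q r s, [a, b, p, q, r, s].Nodup → R a b → R p q → ¬R r s)
    (h32 : ∀ a b c d g, [a, b, c, d, g].Nodup → R a b → R a c → R b c → ¬R d g)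
    (h5 : ∀ a b c d g, [a, b, c, d, g].Nodup → R a b → R b c → R c d → R d g → ¬R g a)
    (h4 : ∀ a b c d, R a b → R a c → R a d → R b c → R b d → ¬R c d) :
    ∃ x y, ∀ u v, R u v → u = x ∨ u = y ∨ v = x ∨ v = y := by
  simp only [List.nodup_cons, List.mem_cons, List.not_mem_nil, or_false, not_or,
    List.nodup_nil, not_false_eq_true, and_true] at h3 h32 h5
  by_cases hex : ∃ a b, R a b
  swap
  · push Not at hex
    exact ⟨Classical.arbitrary V, Classical.arbitrary V, fun u v h => absurd h (hex u v)⟩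
  obtain ⟨a, b, hab⟩ := hex
  by_cases hdis : ∃ c d, R c d ∧ c ≠ a ∧ c ≠ b ∧ d ≠ a ∧ d ≠ b
  swap
  · push Not at hdis
    refine ⟨a, b, fun u v huv => ?_⟩
    by_contra! hh
    exact hh.2.2.2 (hdis u v huv hh.1 hh.2.1 hh.2.2.1)
  obtain ⟨c, d, hcd, n1, n2, n3, n4⟩ := hdis
  have n5 := hne _ _ hab
  have n6 := hne _ _ hcd
  -- two matching edges with neighbors elsewhere at `a` and `b` would extend to three
  have out : ∀ a b c d, R a b → R c d → c ≠ a → c ≠ b → d ≠ a → d ≠ b →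
      (∀ w, R a w → w = b ∨ w = c ∨ w = d) ∨ (∀ w, R b w → w = a ∨ w = c ∨ w = d) := by
    intro a b c d hab hcd m1 m2 m3 m4
    by_contra! hh
    obtain ⟨⟨p, hp, p1, p2, p3⟩, ⟨q, hq, q1, q2, q3⟩⟩ := hh
    have e1 := hne _ _ hab
    have e2 := hne _ _ hcd
    have e3 := hne _ _ hp
    have e4 := hne _ _ hq
    by_cases hpq : p = q
    · subst hpq
      exact h32 a b p c d (by simp [*, Ne.symm m1, Ne.symm m2, Ne.symm m3, Ne.symm m4])
        hab hp hq hcd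
    · exact h3 a p b q c d (by simp [*, Ne.symm m1, Ne.symm m2, Ne.symm m3, Ne.symm m4,
        Ne.symm q1]) hp hq hcd
  -- the case that `b` and `d` have no neighbors elsewhere
  have key : ∀ a b c d, R a b → R c d → c ≠ a → c ≠ b → d ≠ a → d ≠ b →
      (∀ w, R b w → w = a ∨ w = c ∨ w = d) → (∀ w, R d w → w = a ∨ w = b ∨ w = c) →
      ∃ x y, ∀ u v, R u v → u = x ∨ u = y ∨ v = x ∨ v = y := by
    clear n1 n2 n3 n4 n5 n6 hab hcd a b c d
    intro a b c d hab hcd m1 m2 m3 m4 hb hd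
    have e1 := hne _ _ hab
    have e2 := hne _ _ hcd
    have hmeet : ∀ u v, R u v → (u = a ∨ u = b ∨ u = c ∨ u = d) ∨
        (v = a ∨ v = b ∨ v = c ∨ v = d) := by
      intro u v huv
      by_contra! hh
      have := hne _ _ huv
      exact h3 a b c d u v (by clear * - hh this e1 e2 m1 m2 m3 m4; grind only) hab hcd huv
    -- two of the four vertices cover if the other two are not adjacent and have no neighbors
    -- elsewhere
    have cov : ∀ x y z w, (∀ u v, R u v → (u = x ∨ u = y ∨ u = z ∨ u = w) ∨
        (v = x ∨ v = y ∨ v = z ∨ v = w)) → ¬R z w → (∀ v, R z v → v = x ∨ v = y ∨ v = w) →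
        (∀ v, R w v → v = x ∨ v = y ∨ v = z) →
        ∃ x y, ∀ u v, R u v → u = x ∨ u = y ∨ v = x ∨ v = y := by
      intro x y z w hm hzw hz hw
      refine ⟨x, y, fun u v huv => ?_⟩
      by_contra! hh
      have hvu := hs _ _ huv
      rcases hm u v huv with (h | h | h | h) | (h | h | h | h)
      · exact hh.1 h
      · exact hh.2.1 h
      · subst h
        rcases hz v huv with h | h | h
        exacts [hh.2.2.1 h, hh.2.2.2 h, hzw (h ▸ huv)]
      · subst h
        rcases hw v huv with h | h | h
        exacts [hh.2.2.1 h, hh.2.2.2 h, hzw (h ▸ hvu)]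
      · exact hh.2.2.1 h
      · exact hh.2.2.2 h
      · subst h
        rcases hz u hvu with h | h | h
        exacts [hh.1 h, hh.2.1 h, hzw (h ▸ hvu)]
      · subst h
        rcases hw u hvu with h | h | h
        exacts [hh.1 h, hh.2.1 h, hzw (h ▸ huv)]
    by_cases hbd : R b d
    swap
    · exact cov a c b d (fun u v h => by have := hmeet u v h; tauto) hbd
        (fun v hv => by have := hb v hv; tauto) (fun v hv => by have := hd v hv; tauto)
    -- the case that `c` has no neighbors elsewhere either
    have key2 : ∀ a b c d, R a b → R c d → c ≠ a → c ≠ b → d ≠ a → d ≠ b → R b d →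
        (∀ u v, R u v → (u = a ∨ u = b ∨ u = c ∨ u = d) ∨ (v = a ∨ v = b ∨ v = c ∨ v = d)) →
        (∀ w, R b w → w = a ∨ w = c ∨ w = d) → (∀ w, R d w → w = a ∨ w = b ∨ w = c) →
        (∀ w, R c w → w = a ∨ w = b ∨ w = d) →
        ∃ x y, ∀ u v, R u v → u = x ∨ u = y ∨ v = x ∨ v = y := by
      clear m1 m2 m3 m4 e1 e2 hmeet hab hcd hb hd hbd a b c d
      intro a b c d hab hcd m1 m2 m3 m4 hbd hmeet hb hd hc
      have e1 := hne _ _ hab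
      have e2 := hne _ _ hcd
      have e3 := hne _ _ hbd
      by_cases hbc : R b c
      swap
      · exact cov a d b c (fun u v h => by have := hmeet u v h; tauto) hbc
          (fun v hv => by have := hb v hv; tauto) (fun v hv => by have := hc v hv; tauto)
      have ha : ∀ w, R a w → w = b ∨ w = c ∨ w = d := by
        intro w hw
        by_contra! hh
        have := hne _ _ hw
        exact h32 b c d a w (by clear * - hh this e1 e2 e3 m1 m2 m3 m4; grind only)
          hbc hbd hcd hw
      by_cases hac : R a c
      · by_cases had : R a d
        · exact absurd hcd (h4 a b c d hab hac had hbc hbd)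
        · exact cov b c a d (fun u v h => by have := hmeet u v h; tauto) had
            (fun v hv => by have := ha v hv; tauto) (fun v hv => by have := hd v hv; tauto)
      · exact cov b d a c (fun u v h => by have := hmeet u v h; tauto) hac
          (fun v hv => by have := ha v hv; tauto) (fun v hv => by have := hc v hv; tauto)
    by_cases hc : ∀ w, R c w → w = a ∨ w = b ∨ w = d
    · exact key2 a b c d hab hcd m1 m2 m3 m4 hbd hmeet hb hd hc
    by_cases ha : ∀ w, R a w → w = c ∨ w = d ∨ w = b
    · exact key2 c d a b hcd hab m1.symm m3.symm m2.symm m4.symm (hs _ _ hbd)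
        (fun u v h => by have := hmeet u v h; tauto)
        (fun v hv => by have := hd v hv; tauto) (fun v hv => by have := hb v hv; tauto) ha
    push Not at hc ha
    obtain ⟨p, hp, p1, p2, p3⟩ := ha
    obtain ⟨q, hq, q1, q2, q3⟩ := hc
    have e3 := hne _ _ hp
    have e4 := hne _ _ hq
    have e5 := hne _ _ hbd
    by_cases hpq : p = q
    · subst hpq
      exact absurd (hs _ _ hp) (h5 a b d c p (by
        clear * - e1 e2 e3 e4 e5 m1 m2 m3 m4 p1 p2 p3 q1 q2 q3; grind only) hab hbd
        (hs _ _ hcd) hq)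
    · exact absurd hbd (h3 a p c q b d (by
        clear * - hpq e1 e2 e3 e4 e5 m1 m2 m3 m4 p1 p2 p3 q1 q2 q3; grind only) hp hq)
  have hba := hs _ _ hab
  have hdc := hs _ _ hcd
  rcases out a b c d hab hcd n1 n2 n3 n4 with h1 | h1 <;>
    rcases out c d a b hcd hab n1.symm n3.symm n2.symm n4.symm with h2 | h2
  · exact key b a d c hba hdc n4 n3 n2 n1 (fun v hv => by have := h1 v hv; tauto)
      (fun v hv => by have := h2 v hv; tauto)
  · exact key b a c d hba hcd n2 n1 n4 n3 (fun v hv => by have := h1 v hv; tauto)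
      (fun v hv => by have := h2 v hv; tauto)
  · exact key a b d c hab hdc n3 n4 n1 n2 (fun v hv => by have := h1 v hv; tauto)
      (fun v hv => by have := h2 v hv; tauto)
  · exact key a b c d hab hcd n1 n2 n3 n4 (fun v hv => by have := h1 v hv; tauto)
      (fun v hv => by have := h2 v hv; tauto)

/-- The structure of the complement `C` of a graph with `χ_D ≥ n - 2`. -/
theorem coreType_of_le_chiD [Fintype V] [Nonempty V] (hd : Fintype.card V ≤ chiD Cᶜ + 2) :
    CoreType C := by
  by_cases h3 : ∀ a b p q r s, [a, b, p, q, r, s].Nodup → NonTwin C a b → NonTwin C p q →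
      ¬NonTwin C r s
  swap
  · push Not at h3
    obtain ⟨a, b, p, q, r, s, hnd, h1, h2, h3⟩ := h3
    rcases coreType_or_c4_of_three hd hnd h1 h2 h3 with h | ⟨_, _, _, _, h⟩
    · exact h
    · exact h.coreType hd
  by_cases h32 : ∀ a b c d g, [a, b, c, d, g].Nodup → NonTwin C a b → NonTwin C a c →
      NonTwin C b c → ¬NonTwin C d g
  swap
  · push Not at h32
    obtain ⟨a, b, c, d, g, hnd, hab, hac, hbc, hdg⟩ := h32
    have hl := linked_of_triangle_nonTwin hd hnd hab hac hbc hdg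
    simp only [List.nodup_cons, List.mem_cons, List.not_mem_nil, or_false, not_or,
      List.nodup_nil, not_false_eq_true, and_true] at hnd
    rcases hl with (h | h) | (h | h) | (h | h)
    · exact coreType_of_linked_triangle hd h3 (by simp [hnd]) hab.1 hac.1 hbc.1 hdg.1 h
    · exact coreType_of_linked_triangle hd h3 (by simp [hnd, Ne.symm hnd.2.2.2]) hab.1 hac.1
        hbc.1 hdg.1.symm h
    · exact coreType_of_linked_triangle hd h3 (by simp [hnd, Ne.symm hnd.2.1.1]) hac.1 hab.1
        hbc.1.symm hdg.1 h
    · exact coreType_of_linked_triangle hd h3 (by simp [hnd, Ne.symm hnd.2.1.1,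
        Ne.symm hnd.2.2.2]) hac.1 hab.1 hbc.1.symm hdg.1.symm h
    · exact coreType_of_linked_triangle hd h3 (by simp [hnd, Ne.symm hnd.1.1,
        Ne.symm hnd.1.2.1]) hbc.1 hab.1.symm hac.1.symm hdg.1 h
    · exact coreType_of_linked_triangle hd h3 (by simp [hnd, Ne.symm hnd.1.1,
        Ne.symm hnd.1.2.1, Ne.symm hnd.2.2.2]) hbc.1 hab.1.symm hac.1.symm hdg.1.symm h
  by_cases h5 : ∀ a b c d g, [a, b, c, d, g].Nodup → NonTwin C a b → NonTwin C b c →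
      NonTwin C c d → NonTwin C d g → ¬NonTwin C g a
  swap
  · push Not at h5
    obtain ⟨a, b, c, d, g, hnd, h1, h2, h3', h4, h5⟩ := h5
    exact coreType_of_cycle5 hd h3 h32 hnd h1 h2 h3' h4 h5
  obtain ⟨x, y, hxy⟩ := exists_cover_pair (R := NonTwin C) (fun _ _ h => h.symm)
    (fun _ _ h => h.1.ne) h3 h32 h5
    (fun a b c d h1 h2 h3 h4 h5 h6 => not_four_nonTwin hd h1 h2 h3 h4 h5 h6)
  refine .cover x y ?_
  rw [coversPairs_compl_iff]
  intro u v hu hv huv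
  simp only [Set.mem_insert_iff, Set.mem_singleton_iff, not_or] at hu hv
  rcases hxy u v huv with h | h | h | h
  exacts [hu.1 h, hu.2 h, hv.1 h, hv.2 h]

end Structure
/-! ### Decomposing graphs into joins, disjoint unions and substitutions -/

section Isom

variable {V W V' W' : Type*} {G : SimpleGraph V} {H : SimpleGraph W} {G' : SimpleGraph V'}
  {H' : SimpleGraph W'}

theorem Isom.refl (G : SimpleGraph V) : G ≅g G := ⟨Iso.refl⟩

theorem Isom.symm (h : G ≅g H) : H ≅g G := h.map Iso.symm

theorem Isom.trans (h : G ≅g H) (h' : H ≅g G') : G ≅g G' :=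
  h.elim fun e => h'.map fun e' => e.trans e'

@[simp] theorem join_adj_inl {u v : V} : (G ∨g H).Adj (.inl u) (.inl v) ↔ G.Adj u v := by
  simp [join]

@[simp] theorem join_adj_inr {u v : W} : (G ∨g H).Adj (.inr u) (.inr v) ↔ H.Adj u v := by
  simp [join]

@[simp] theorem join_adj_inl_inr {u : V} {v : W} : (G ∨g H).Adj (.inl u) (.inr v) := by
  simp [join]

@[simp] theorem join_adj_inr_inl {u : W} {v : V} : (G ∨g H).Adj (.inr u) (.inl v) := by
  simp [join]

theorem Isom.join (h : G ≅g G') (h' : H ≅g H') : G ∨g H ≅g G' ∨g H' := by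
  obtain ⟨e⟩ := h
  obtain ⟨e'⟩ := h'
  exact ⟨⟨e.toEquiv.sumCongr e'.toEquiv, by
    rintro (u | u) (v | v) <;> simp [e.map_adj_iff, e'.map_adj_iff]⟩⟩

theorem Isom.sum (h : G ≅g G') (h' : H ≅g H') : G ⊕g H ≅g G' ⊕g H' := by
  obtain ⟨e⟩ := h
  obtain ⟨e'⟩ := h'
  exact ⟨Iso.sumCongr e e'⟩

theorem isom_join_of_adj {s : Set V} (h : ∀ u ∈ s, ∀ v ∉ s, G.Adj u v) :
    G ≅g G.induce s ∨g G.induce sᶜ := by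
  classical
  refine Isom.symm ⟨⟨Equiv.Set.sumCompl s, ?_⟩⟩
  rintro (u | u) (v | v)
  · simp
  · simpa using h u u.2 v v.2
  · simpa using (h v v.2 u u.2).symm
  · simp

theorem isom_sum_of_not_adj {s : Set V} (h : ∀ u ∈ s, ∀ v ∉ s, ¬G.Adj u v) :
    G ≅g G.induce s ⊕g G.induce sᶜ := by
  classical
  refine Isom.symm ⟨⟨Equiv.Set.sumCompl s, ?_⟩⟩
  rintro (u | u) (v | v)
  · simp
  · simpa using h u u.2 v v.2
  · simpa using fun h' => h v v.2 u u.2 h'.symm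
  · simp

/-- An injective map onto `s` that reflects adjacency. -/
theorem isom_of_injective {s : Set V} (e : W → V) (he : Function.Injective e)
    (hs : Set.range e = s) (hadj : ∀ i j, G.Adj (e i) (e j) ↔ H.Adj i j) : G.induce s ≅g H := by
  subst hs
  exact Isom.symm ⟨⟨Equiv.ofInjective e he, by
    intro i j
    simpa using hadj i j⟩⟩

theorem exists_cmGraph [Finite V] [Nonempty V] (hG : ∀ a b c, ¬G.Adj a b → ¬G.Adj b c →
    ¬G.Adj a c) : ∃ M : CMGraph, G ≅g M.graph := by
  obtain ⟨n, ⟨e⟩⟩ := Finite.exists_equiv_fin V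
  refine ⟨⟨n, Nat.pos_of_ne_zero ?_, G.map e.toEmbedding, ⟨?_⟩⟩, ⟨Iso.map e G⟩⟩
  · rintro rfl
    exact (e (Classical.arbitrary V)).elim0
  · intro a b c h1 h2
    obtain ⟨a, rfl⟩ := e.surjective a
    obtain ⟨b, rfl⟩ := e.surjective b
    obtain ⟨c, rfl⟩ := e.surjective c
    have h := hG a b c
    simp only [← Equiv.coe_toEmbedding, map_adj_apply] at h1 h2 ⊢
    exact h h1 h2

theorem isom_one_of_subsingleton {s : Set V} {x : V} (hs : s = {x}) :
    G.induce s ≅g CMGraph.one.graph := by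
  refine isom_of_injective (fun _ => x) (fun i j _ => Subsingleton.elim (α := Fin 1) i j) ?_ ?_
  · rw [hs]
    ext v
    constructor
    · rintro ⟨_, rfl⟩; rfl
    · rintro rfl; exact ⟨(0 : Fin 1), rfl⟩
  · intro i j
    rw [Subsingleton.elim (α := Fin 1) i j]
    simp

theorem isom_edgeless [Finite V] (h : ∀ u v, ¬G.Adj u v) : G ≅g E (Nat.card V) :=
  ⟨⟨Finite.equivFin V, by simp [h]⟩⟩

theorem isom_complete [Finite V] (h : ∀ u v, u ≠ v → G.Adj u v) : G ≅g K (Nat.card V) :=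
  ⟨⟨Finite.equivFin V, by
    intro u v
    by_cases huv : u = v
    · simp [huv]
    · simp [h u v huv, huv]⟩⟩

/-- A graph is a substitution into `Γ` if adjacency between the fibers of a map to the vertices of
`Γ` is that of `Γ`. -/
theorem isom_subst {n : ℕ} {Γ : SimpleGraph (Fin n)} (p : V → Fin n) (M : Fin n → CMGraph)
    (hM : ∀ i, G.induce {v | p v = i} ≅g (M i).graph)
    (hadj : ∀ u v, p u ≠ p v → (G.Adj u v ↔ Γ.Adj (p u) (p v))) : G ≅g subst Γ M := by
  let f := fun i => (hM i).some
  let e : (Σ i, {v // p v = i}) ≃ Σ i, Fin (M i).order :=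
    Equiv.sigmaCongrRight fun i => (f i).toEquiv
  refine ⟨⟨(Equiv.sigmaFiberEquiv p).symm.trans e, ?_⟩⟩
  intro u v
  have hu : (Equiv.sigmaFiberEquiv p).symm.trans e u = ⟨p u, f (p u) ⟨u, rfl⟩⟩ := rfl
  have hv : (Equiv.sigmaFiberEquiv p).symm.trans e v = ⟨p v, f (p v) ⟨v, rfl⟩⟩ := rfl
  rw [hu, hv]
  change (Γ.Adj (p u) (p v) ∨ ∃ i a b, _) ↔ _
  by_cases huv : p u = p v
  · have hv' : (⟨p v, f (p v) ⟨v, rfl⟩⟩ : Σ i, Fin (M i).order) =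
        ⟨p u, f (p u) ⟨v, huv.symm⟩⟩ := by
      generalize_proofs h1 h2
      revert h2
      rw [huv]
      intro h2
      rfl
    have hn : ¬Γ.Adj (p u) (p v) := by rw [huv]; exact Γ.irrefl
    rw [hv']
    simp only [hn, false_or]
    have key : (M (p u)).graph.Adj (f (p u) ⟨u, rfl⟩) (f (p u) ⟨v, huv.symm⟩) ↔ G.Adj u v :=
      (f (p u)).map_adj_iff
    rw [← key]
    constructor
    · rintro ⟨i, a, b, h1, h2, h3⟩
      obtain ⟨rfl, h1⟩ := Sigma.mk.inj_iff.1 h1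
      obtain ⟨-, h2⟩ := Sigma.mk.inj_iff.1 h2
      rwa [eq_of_heq h1, eq_of_heq h2]
    · intro h
      exact ⟨p u, _, _, rfl, rfl, h⟩
  · rw [hadj u v huv]
    refine ⟨?_, Or.inl⟩
    rintro (h | ⟨i, a, b, h1, h2, h3⟩)
    · exact h
    · exact absurd ((Sigma.mk.inj_iff.1 h1).1.trans (Sigma.mk.inj_iff.1 h2).1.symm) huv

/-- A complete multipartite graph with an edge is the join of two. -/
theorem exists_join_two [Finite V] (hG : ∀ a b c, ¬G.Adj a b → ¬G.Adj b c → ¬G.Adj a c)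
    {a b : V} (hab : G.Adj a b) : ∃ M₁ M₂ : CMGraph, G ≅g M₁.graph ∨g M₂.graph := by
  have hs : ∀ u ∈ {v | ¬G.Adj a v}, ∀ v ∉ {v | ¬G.Adj a v}, G.Adj u v := by
    intro u hu v hv
    by_contra h
    exact hv (hG a u v hu h)
  have : Nonempty {v | ¬G.Adj a v} := ⟨a, by simp⟩
  have : Nonempty ({v | ¬G.Adj a v}ᶜ : Set V) := ⟨b, by simpa using hab⟩
  obtain ⟨M₁, h1⟩ := exists_cmGraph (G := G.induce {v | ¬G.Adj a v}) fun x y z => hG x y z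
  obtain ⟨M₂, h2⟩ := exists_cmGraph (G := G.induce {v | ¬G.Adj a v}ᶜ) fun x y z => hG x y z
  exact ⟨M₁, M₂, (isom_join_of_adj hs).trans (h1.join h2)⟩

/-- A complete multipartite graph with a triangle is the join of three. -/
theorem exists_join_three [Finite V] (hG : ∀ a b c, ¬G.Adj a b → ¬G.Adj b c → ¬G.Adj a c)
    {a b c : V} (hab : G.Adj a b) (hac : G.Adj a c) (hbc : G.Adj b c) :
    ∃ M₁ M₂ M₃ : CMGraph, G ≅g M₁.graph ∨g M₂.graph ∨g M₃.graph := by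
  have hs : ∀ u ∈ {v | G.Adj a v}, ∀ v ∉ {v | G.Adj a v}, G.Adj u v := by
    intro u hu v hv
    by_contra h
    exact hG a v u hv (fun h' => h h'.symm) hu
  have : Nonempty ({v | G.Adj a v}ᶜ : Set V) := ⟨a, by simp⟩
  obtain ⟨M₁, M₂, h1⟩ := exists_join_two (G := G.induce {v | G.Adj a v}) (fun x y z => hG x y z)
    (a := ⟨b, hab⟩) (b := ⟨c, hac⟩) hbc
  obtain ⟨M₃, h2⟩ := exists_cmGraph (G := G.induce {v | G.Adj a v}ᶜ) fun x y z => hG x y z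
  exact ⟨M₁, M₂, M₃, (isom_join_of_adj hs).trans (h1.join h2)⟩

theorem BaseFamily.of_isom (h : G ≅g H) (hH : BaseFamily H) : BaseFamily G := by
  cases hH with
  | a i => exact .a (h.trans i)
  | b i => exact .b (h.trans i)
  | c i => exact .c (h.trans i)
  | d i => exact .d (h.trans i)
  | e r hr i => exact .e r hr (h.trans i)
  | f r hr M i => exact .f r hr M (h.trans i)
  | g M₁ M₂ M₃ i => exact .g M₁ M₂ M₃ (h.trans i)
  | h M₁ M₂ i => exact .h M₁ M₂ (h.trans i)
  | i i => exact .i (h.trans i)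
  | j M₁ M₂ i => exact .j M₁ M₂ (h.trans i)
  | k i => exact .k (h.trans i)
  | l M i => exact .l M (h.trans i)
  | m M₁ M₂ M₃ Γ hΓ i => exact .m M₁ M₂ M₃ Γ hΓ (h.trans i)
  | n M₁ M₂ i => exact .n M₁ M₂ (h.trans i)
  | o M₁ M₂ i => exact .o M₁ M₂ (h.trans i)
  | p M₁ M₂ M₃ i => exact .p M₁ M₂ M₃ (h.trans i)
  | q M₁ M₂ M₃ M₄ i => exact .q M₁ M₂ M₃ M₄ (h.trans i)

/-- A family member joined to all remaining vertices, which induce a complete multipartite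
graph. -/
theorem BaseFamily.of_induce [Finite V] {s : Set V} (hs : ∀ u ∈ s, ∀ v ∉ s, G.Adj u v)
    (hG : ∀ a b c, a ∉ s → b ∉ s → c ∉ s → ¬G.Adj a b → ¬G.Adj b c → ¬G.Adj a c)
    (hF : BaseFamily (G.induce s)) :
    (∃ (M : CMGraph) (k : ℕ) (F : SimpleGraph (Fin k)), BaseFamily F ∧ (G ≅g M.graph ∨g F)) ∨
      BaseFamily G := by
  obtain ⟨e⟩ : Nonempty (s ≃ Fin (Nat.card s)) := ⟨Finite.equivFin s⟩
  have hiso : G.induce s ≅g (G.induce s).map e.toEmbedding := ⟨Iso.map e _⟩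
  by_cases hne : ∃ v, v ∉ s
  · obtain ⟨v, hv⟩ := hne
    have : Nonempty (sᶜ : Set V) := ⟨v, hv⟩
    obtain ⟨M, hM⟩ := exists_cmGraph (G := G.induce sᶜ) fun a b c => hG a b c a.2 b.2 c.2
    have hjoin : G ≅g G.induce sᶜ ∨g G.induce s := by
      have := isom_join_of_adj (G := G) (s := sᶜ) fun u hu v hv =>
        (hs v (not_not.1 hv) u hu).symm
      rwa [compl_compl] at this
    exact Or.inl ⟨M, _, _, hF.of_isom hiso.symm, hjoin.trans (hM.join hiso)⟩
  · push Not at hne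
    refine Or.inr (hF.of_isom ?_)
    have hu : s = Set.univ := Set.eq_univ_of_forall hne
    subst hu
    exact Isom.symm ⟨induceUnivIso G⟩

end Isom
/-! ### Graphs whose non-adjacent non-twins are covered by two vertices -/

section Cover

variable {V : Type*} {G : SimpleGraph V}

theorem bull_adj (i j : Fin 5) : bull.Adj i j ↔ (i, j) ∈ [((0 : Fin 5), (1 : Fin 5)), (1, 0),
    (0, 2), (2, 0), (1, 2), (2, 1), (1, 3), (3, 1), (2, 4), (4, 2)] := by
  revert i j
  simp +decide [bull, Fin.forall_fin_succ]

theorem house_adj (i j : Fin 5) : house.Adj i j ↔ (i, j) ∈ [((0 : Fin 5), (1 : Fin 5)), (1, 0),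
    (0, 2), (2, 0), (1, 2), (2, 1), (1, 3), (3, 1), (2, 4), (4, 2), (3, 4), (4, 3)] := by
  revert i j
  simp +decide [house, Fin.forall_fin_succ]

theorem G5_adj (i j : Fin 4) : G5.Adj i j ↔ (i, j) ∈ [((0 : Fin 4), (1 : Fin 4)), (1, 0),
    (1, 2), (2, 1), (2, 3), (3, 2)] := by
  revert i j
  simp +decide [G5, Fin.forall_fin_succ]

theorem G6_adj (i j : Fin 5) : G6.Adj i j ↔ (i, j) ∈ [((0 : Fin 5), (1 : Fin 5)), (1, 0),
    (1, 2), (2, 1), (2, 3), (3, 2), (1, 3), (3, 1)] := by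
  revert i j
  simp +decide [G6, Fin.forall_fin_succ]

theorem G7_adj (i j : Fin 6) : G7.Adj i j ↔ (i, j) ∈ [((0 : Fin 6), (1 : Fin 6)), (1, 0),
    (1, 2), (2, 1), (2, 3), (3, 2), (3, 4), (4, 3), (4, 5), (5, 4), (5, 0), (0, 5), (0, 3), (3, 0),
    (0, 2), (2, 0), (1, 3), (3, 1), (1, 5), (5, 1), (2, 4), (4, 2)] := by
  revert i j
  simp +decide [G7, Fin.forall_fin_succ]

/-- A map to the vertices of `Γ` that exhibits `G` as a substitution of complete multipartite graphs,
with `K₁` substituted where the fiber is a single vertex. -/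
theorem exists_isom_subst [Finite V] {n : ℕ} {Γ : SimpleGraph (Fin n)} (p : V → Fin n)
    (hsurj : Function.Surjective p)
    (htrans : ∀ a b c, p a = p b → p b = p c → ¬G.Adj a b → ¬G.Adj b c → ¬G.Adj a c)
    (hadj : ∀ u v, p u ≠ p v → (G.Adj u v ↔ Γ.Adj (p u) (p v))) :
    ∃ M : Fin n → CMGraph, (G ≅g subst Γ M) ∧
      ∀ i, (∃ x, ∀ v, p v = i → v = x) → M i = .one := by
  classical
  have hM : ∀ i, ∃ M : CMGraph, (G.induce {v | p v = i} ≅g M.graph) ∧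
      ((∃ x, ∀ v, p v = i → v = x) → M = .one) := by
    intro i
    obtain ⟨a, ha⟩ := hsurj i
    by_cases h : ∃ x, ∀ v, p v = i → v = x
    · obtain ⟨x, hx⟩ := h
      refine ⟨.one, isom_one_of_subsingleton (x := x) ?_, fun _ => rfl⟩
      ext v
      refine ⟨fun h => hx v h, ?_⟩
      rintro rfl
      rw [← hx a ha]
      exact ha
    · have : Nonempty {v | p v = i} := ⟨a, ha⟩
      obtain ⟨M, hM⟩ := exists_cmGraph (G := G.induce {v | p v = i}) fun a b c =>
        htrans a b c (a.2.trans b.2.symm) (b.2.trans c.2.symm)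
      exact ⟨M, hM, fun h' => absurd h' h⟩
  choose M h1 h2 using hM
  exact ⟨M, isom_subst p M h1 hadj, h2⟩

/-- The vertices `x` and `y` cover all non-adjacent non-twins, and no other vertex is adjacent to
both. -/
structure PairCover (G : SimpleGraph V) (x y : V) : Prop where
  ne : x ≠ y
  twin : ∀ u v, u ≠ x → u ≠ y → v ≠ x → v ≠ y → ¬G.Adj u v → ∀ w, G.Adj w u ↔ G.Adj w v
  dom : ∀ v, v ≠ x → v ≠ y → ¬G.Adj x v ∨ ¬G.Adj y v

theorem PairCover.symm {x y : V} (h : PairCover G x y) : PairCover G y x :=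
  ⟨h.ne.symm, fun u v h1 h2 h3 h4 => h.twin u v h2 h1 h4 h3, fun v h1 h2 => (h.dom v h2 h1).symm⟩

theorem PairCover.trans {x y : V} (h : PairCover G x y) {a b c : V}
    (hb : b ≠ x ∧ b ≠ y) (hc : c ≠ x ∧ c ≠ y) (hab : ¬G.Adj a b) (hbc : ¬G.Adj b c) :
    ¬G.Adj a c := by
  rwa [← h.twin b c hb.1 hb.2 hc.1 hc.2 hbc a]

/-- There are further vertices adjacent only to `x`, only to `y`, and to neither. -/
theorem PairCover.subst_bull_or_house [Finite V] {x y : V} (h : PairCover G x y) {a b c : V}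
    (ha : a ≠ x ∧ a ≠ y) (hb : b ≠ x ∧ b ≠ y) (hc : c ≠ x ∧ c ≠ y)
    (hax : ¬G.Adj x a) (hay : ¬G.Adj y a) (hbx : G.Adj x b) (hcy : G.Adj y c) :
    BaseFamily G := by
  classical
  obtain ⟨hne, htw, hdom⟩ := id h
  let p : V → Fin 5 := fun v => if v = x then 3 else if v = y then 4 else
    if G.Adj x v then 1 else if G.Adj y v then 2 else 0
  have hp : ∀ v, (v = x ∧ p v = 3) ∨ (v = y ∧ p v = 4) ∨
      (v ≠ x ∧ v ≠ y ∧ G.Adj x v ∧ ¬G.Adj y v ∧ p v = 1) ∨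
      (v ≠ x ∧ v ≠ y ∧ ¬G.Adj x v ∧ G.Adj y v ∧ p v = 2) ∨
      (v ≠ x ∧ v ≠ y ∧ ¬G.Adj x v ∧ ¬G.Adj y v ∧ p v = 0) := by
    intro v
    have := hdom v
    by_cases h1 : v = x
    · simp [p, h1]
    by_cases h2 : v = y
    · simp [p, h2, hne.symm]
    by_cases h3 : G.Adj x v <;> by_cases h4 : G.Adj y v <;> simp_all [p]
  clear_value p
  have hex : ∃ Γ : SimpleGraph (Fin 5), (Γ = bull ∨ Γ = house) ∧
      ∀ u v, p u ≠ p v → (G.Adj u v ↔ Γ.Adj (p u) (p v)) := by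
    by_cases hxy : G.Adj x y
    · refine ⟨house, Or.inr rfl, fun u v huv => ?_⟩
      have := htw u v
      rcases hp u with h1 | h1 | h1 | h1 | h1 <;> rcases hp v with h2 | h2 | h2 | h2 | h2 <;>
      simp only [h1, h2, house_adj] <;> simp <;> grind [G.adj_comm]
    · refine ⟨bull, Or.inl rfl, fun u v huv => ?_⟩
      have := htw u v
      rcases hp u with h1 | h1 | h1 | h1 | h1 <;> rcases hp v with h2 | h2 | h2 | h2 | h2 <;>
      simp only [h1, h2, bull_adj] <;> simp <;> grind [G.adj_comm]
  obtain ⟨Γ, hΓ, hadj⟩ := hex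
  have hsurj : Function.Surjective p := by
    intro i
    fin_cases i
    · exact ⟨a, by grind⟩
    · exact ⟨b, by grind⟩
    · exact ⟨c, by grind⟩
    · exact ⟨x, by grind⟩
    · exact ⟨y, by grind⟩
  have htrans : ∀ u v w, p u = p v → p v = p w → ¬G.Adj u v → ¬G.Adj v w → ¬G.Adj u w := by
    intro u v w
    have := @h.trans _ _ _ _ u v w
    grind
  obtain ⟨M, hM, h1⟩ := exists_isom_subst p (Γ := Γ) hsurj htrans hadj
  have : M = ![M 0, M 1, M 2, .one, .one] := by
    funext i
    fin_cases i
    · rfl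
    · rfl
    · rfl
    · exact h1 3 ⟨x, fun v hv => by grind⟩
    · exact h1 4 ⟨y, fun v hv => by grind⟩
  rw [this] at hM
  exact .m _ _ _ Γ hΓ hM

/-- No further vertex is non-adjacent to both `x` and `y`. -/
theorem PairCover.subst_G5_of_not_adj [Finite V] {x y : V} (h : PairCover G x y) (hxy : ¬G.Adj x y)
    (hno : ∀ v, v ≠ x → v ≠ y → G.Adj x v ∨ G.Adj y v) {b c : V} (hb : b ≠ x ∧ b ≠ y)
    (hc : c ≠ x ∧ c ≠ y) (hbx : G.Adj x b) (hcy : G.Adj y c) :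
    BaseFamily G := by
  classical
  obtain ⟨hne, htw, hdom⟩ := id h
  let p : V → Fin 4 := fun v => if v = x then 0 else if v = y then 3 else
    if G.Adj x v then 1 else 2
  have hp : ∀ v, (v = x ∧ p v = 0) ∨
      (v = y ∧ p v = 3) ∨
      (v ≠ x ∧ v ≠ y ∧ G.Adj x v ∧ ¬G.Adj y v ∧ p v = 1) ∨
      (v ≠ x ∧ v ≠ y ∧ ¬G.Adj x v ∧ G.Adj y v ∧ p v = 2) := by
    intro v
    have := hdom v
    by_cases h1 : v = x
    · simp [p, h1]
    by_cases h2 : v = y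
    · simp [p, h2, hne.symm]
    have := hno v
    by_cases h3 : G.Adj x v <;> by_cases h4 : G.Adj y v <;> simp_all [p]
  clear_value p
  have hadj : ∀ u v, p u ≠ p v → (G.Adj u v ↔ G5.Adj (p u) (p v)) := by
    intro u v huv
    have := htw u v
    rcases hp u with h1 | h1 | h1 | h1 <;>
      rcases hp v with h2 | h2 | h2 | h2 <;>
      simp only [h1, h2, G5_adj] <;> simp <;> grind [G.adj_comm]
  have hsurj : Function.Surjective p := by
    intro i
    fin_cases i
    · exact ⟨x, by grind⟩
    · exact ⟨b, by grind⟩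
    · exact ⟨c, by grind⟩
    · exact ⟨y, by grind⟩
  have htrans : ∀ u v w, p u = p v → p v = p w → ¬G.Adj u v → ¬G.Adj v w → ¬G.Adj u w := by
    intro u v w
    have := @h.trans _ _ _ _ u v w
    grind
  obtain ⟨M, hM, h1⟩ := exists_isom_subst p (Γ := G5) hsurj htrans hadj
  have : M = ![.one, M 1, M 2, .one] := by
    funext i
    fin_cases i
    · exact h1 0 ⟨x, fun v hv => by grind⟩
    · rfl
    · rfl
    · exact h1 3 ⟨y, fun v hv => by grind⟩
  rw [this] at hM
  exact .o (M 1) (M 2) hM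

/-- All further vertices are non-adjacent to `x`. -/
theorem PairCover.subst_G5_of_adj [Finite V] {x y : V} (h : PairCover G x y) (hxy : G.Adj x y)
    (hno : ∀ v, v ≠ x → v ≠ y → ¬G.Adj x v) {a c : V} (ha : a ≠ x ∧ a ≠ y) (hc : c ≠ x ∧ c ≠ y)
    (hay : ¬G.Adj y a) (hcy : G.Adj y c) :
    BaseFamily G := by
  classical
  obtain ⟨hne, htw, hdom⟩ := id h
  let p : V → Fin 4 := fun v => if v = x then 3 else if v = y then 2 else
    if G.Adj y v then 1 else 0
  have hp : ∀ v, (v = x ∧ p v = 3) ∨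
      (v = y ∧ p v = 2) ∨
      (v ≠ x ∧ v ≠ y ∧ ¬G.Adj x v ∧ G.Adj y v ∧ p v = 1) ∨
      (v ≠ x ∧ v ≠ y ∧ ¬G.Adj x v ∧ ¬G.Adj y v ∧ p v = 0) := by
    intro v
    have := hdom v
    by_cases h1 : v = x
    · simp [p, h1]
    by_cases h2 : v = y
    · simp [p, h2, hne.symm]
    have := hno v
    by_cases h3 : G.Adj x v <;> by_cases h4 : G.Adj y v <;> simp_all [p]
  clear_value p
  have hadj : ∀ u v, p u ≠ p v → (G.Adj u v ↔ G5.Adj (p u) (p v)) := by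
    intro u v huv
    have := htw u v
    rcases hp u with h1 | h1 | h1 | h1 <;>
      rcases hp v with h2 | h2 | h2 | h2 <;>
      simp only [h1, h2, G5_adj] <;> simp <;> grind [G.adj_comm]
  have hsurj : Function.Surjective p := by
    intro i
    fin_cases i
    · exact ⟨a, by grind⟩
    · exact ⟨c, by grind⟩
    · exact ⟨y, by grind⟩
    · exact ⟨x, by grind⟩
  have htrans : ∀ u v w, p u = p v → p v = p w → ¬G.Adj u v → ¬G.Adj v w → ¬G.Adj u w := by
    intro u v w
    have := @h.trans _ _ _ _ u v w
    grind
  obtain ⟨M, hM, h1⟩ := exists_isom_subst p (Γ := G5) hsurj htrans hadj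
  have : M = ![M 0, M 1, .one, .one] := by
    funext i
    fin_cases i
    · rfl
    · rfl
    · exact h1 2 ⟨y, fun v hv => by grind⟩
    · exact h1 3 ⟨x, fun v hv => by grind⟩
  rw [this] at hM
  exact .n (M 0) (M 1) hM

/-- All further vertices are non-adjacent to `x`, and there are adjacent ones among those
non-adjacent to `y`. -/
theorem PairCover.subst_G6 [Finite V] {x y : V} (h : PairCover G x y) (hxy : ¬G.Adj x y)
    (hno : ∀ v, v ≠ x → v ≠ y → ¬G.Adj x v) {a b c : V} (ha : a ≠ x ∧ a ≠ y) (hb : b ≠ x ∧ b ≠ y)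
    (hc : c ≠ x ∧ c ≠ y) (hay : ¬G.Adj y a) (hby : ¬G.Adj y b) (hab : G.Adj a b)
    (hcy : G.Adj y c) :
    BaseFamily G := by
  classical
  obtain ⟨hne, htw, hdom⟩ := id h
  let p : V → Fin 5 := fun v => if v = x then 4 else if v = y then 0 else
    if G.Adj y v then 1 else if G.Adj a v then 2 else 3
  have hp : ∀ v, (v = x ∧ p v = 4) ∨
      (v = y ∧ p v = 0) ∨
      (v ≠ x ∧ v ≠ y ∧ ¬G.Adj x v ∧ G.Adj y v ∧ p v = 1) ∨
      (v ≠ x ∧ v ≠ y ∧ ¬G.Adj x v ∧ ¬G.Adj y v ∧ G.Adj a v ∧ p v = 2) ∨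
      (v ≠ x ∧ v ≠ y ∧ ¬G.Adj x v ∧ ¬G.Adj y v ∧ ¬G.Adj a v ∧ p v = 3) := by
    intro v
    have := hdom v
    by_cases h1 : v = x
    · simp [p, h1]
    by_cases h2 : v = y
    · simp [p, h2, hne.symm]
    have := hno v
    by_cases h4 : G.Adj y v <;> by_cases h5 : G.Adj a v <;> simp_all [p]
  clear_value p
  have hadj : ∀ u v, p u ≠ p v → (G.Adj u v ↔ G6.Adj (p u) (p v)) := by
    intro u v huv
    have := htw u v
    rcases hp u with h1 | h1 | h1 | h1 | h1 <;>
      rcases hp v with h2 | h2 | h2 | h2 | h2 <;>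
      simp only [h1, h2, G6_adj] <;> simp <;> grind [G.adj_comm]
  have hsurj : Function.Surjective p := by
    intro i
    fin_cases i
    · exact ⟨y, by grind⟩
    · exact ⟨c, by grind⟩
    · exact ⟨b, by grind⟩
    · exact ⟨a, by grind [G.irrefl (v := a)]⟩
    · exact ⟨x, by grind⟩
  have htrans : ∀ u v w, p u = p v → p v = p w → ¬G.Adj u v → ¬G.Adj v w → ¬G.Adj u w := by
    intro u v w
    have := @h.trans _ _ _ _ u v w
    grind
  obtain ⟨M, hM, h1⟩ := exists_isom_subst p (Γ := G6) hsurj htrans hadj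
  have : M = ![.one, M 1, M 2, M 3, .one] := by
    funext i
    fin_cases i
    · exact h1 0 ⟨y, fun v hv => by grind⟩
    · rfl
    · rfl
    · rfl
    · exact h1 4 ⟨x, fun v hv => by grind⟩
  rw [this] at hM
  exact .p (M 1) (M 2) (M 3) hM

set_option maxHeartbeats 1000000 in
/-- Among the vertices adjacent to just one of `x` and `y`, there are adjacent ones of both
kinds. -/
theorem PairCover.subst_G7 [Finite V] {x y : V} (h : PairCover G x y) (hxy : G.Adj x y)
    (hno : ∀ v, v ≠ x → v ≠ y → G.Adj x v ∨ G.Adj y v) {a b c d : V} (ha : a ≠ x ∧ a ≠ y)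
    (hb : b ≠ x ∧ b ≠ y) (hc : c ≠ x ∧ c ≠ y) (hd : d ≠ x ∧ d ≠ y) (hax : ¬G.Adj x a)
    (hbx : ¬G.Adj x b) (hab : G.Adj a b) (hcy : ¬G.Adj y c) (hdy : ¬G.Adj y d) (hcd : G.Adj c d) :
    BaseFamily G := by
  classical
  obtain ⟨hne, htw, hdom⟩ := id h
  let p : V → Fin 6 := fun v => if v = x then 4 else if v = y then 5 else if G.Adj y v then
    (if G.Adj a v then 0 else 1) else if G.Adj c v then 2 else 3
  have hp : ∀ v, (v = x ∧ p v = 4) ∨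
      (v = y ∧ p v = 5) ∨
      (v ≠ x ∧ v ≠ y ∧ ¬G.Adj x v ∧ G.Adj y v ∧ G.Adj a v ∧ p v = 0) ∨
      (v ≠ x ∧ v ≠ y ∧ ¬G.Adj x v ∧ G.Adj y v ∧ ¬G.Adj a v ∧ p v = 1) ∨
      (v ≠ x ∧ v ≠ y ∧ G.Adj x v ∧ ¬G.Adj y v ∧ G.Adj c v ∧ p v = 2) ∨
      (v ≠ x ∧ v ≠ y ∧ G.Adj x v ∧ ¬G.Adj y v ∧ ¬G.Adj c v ∧ p v = 3) := by
    intro v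
    have := hdom v
    by_cases h1 : v = x
    · simp [p, h1]
    by_cases h2 : v = y
    · simp [p, h2, hne.symm]
    have := hno v
    by_cases h3 : G.Adj x v <;> by_cases h4 : G.Adj a v <;> by_cases h5 : G.Adj c v <;>
      simp_all [p]
  clear_value p
  have hadj : ∀ u v, p u ≠ p v → (G.Adj u v ↔ G7.Adj (p u) (p v)) := by
    intro u v huv
    have := htw u v
    rcases hp u with h1 | h1 | h1 | h1 | h1 | h1 <;>
      rcases hp v with h2 | h2 | h2 | h2 | h2 | h2 <;>
      simp only [h1, h2, G7_adj] <;> simp <;> grind [G.adj_comm]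
  have hsurj : Function.Surjective p := by
    intro i
    fin_cases i
    · exact ⟨b, by grind⟩
    · exact ⟨a, by grind [G.irrefl (v := a)]⟩
    · exact ⟨d, by grind⟩
    · exact ⟨c, by grind [G.irrefl (v := c)]⟩
    · exact ⟨x, by grind⟩
    · exact ⟨y, by grind⟩
  have htrans : ∀ u v w, p u = p v → p v = p w → ¬G.Adj u v → ¬G.Adj v w → ¬G.Adj u w := by
    intro u v w
    have := @h.trans _ _ _ _ u v w
    grind
  obtain ⟨M, hM, h1⟩ := exists_isom_subst p (Γ := G7) hsurj htrans hadj
  have : M = ![M 0, M 1, M 2, M 3, .one, .one] := by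
    funext i
    fin_cases i
    · rfl
    · rfl
    · rfl
    · rfl
    · exact h1 4 ⟨x, fun v hv => by grind⟩
    · exact h1 5 ⟨y, fun v hv => by grind⟩
  rw [this] at hM
  exact .q (M 0) (M 1) (M 2) (M 3) hM

theorem isom_pair {x y : V} (hne : x ≠ y) {s : Set V} (hs : s = {x, y}) :
    (G.Adj x y → G.induce s ≅g K 2) ∧ (¬G.Adj x y → G.induce s ≅g E 2) := by
  have hinj : Function.Injective ![x, y] := by
    intro i j
    fin_cases i <;> fin_cases j <;> simp [hne, hne.symm]
  have hr : Set.range ![x, y] = s := by simp [hs, Set.pair_comm]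
  constructor
  · intro h
    refine isom_of_injective _ hinj hr fun i j => ?_
    fin_cases i <;> fin_cases j <;> simp [h, h.symm]
  · intro h
    refine isom_of_injective _ hinj hr fun i j => ?_
    fin_cases i <;> fin_cases j <;> simp [h, G.adj_comm y x]

/-- Without further vertices adjacent to `x` or `y`, these two split off. -/
theorem PairCover.isom_sum {x y : V} (hx : ∀ v, v ≠ x → v ≠ y → ¬G.Adj x v)
    (hy : ∀ v, v ≠ x → v ≠ y → ¬G.Adj y v) {W U : Type*} {H : SimpleGraph W} {T : SimpleGraph U}
    (hH : G.induce ({x, y}ᶜ : Set V) ≅g H) (hT : G.induce ({x, y}ᶜᶜ : Set V) ≅g T) :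
    G ≅g H ⊕g T := by
  refine (isom_sum_of_not_adj (s := ({x, y}ᶜ : Set V)) ?_).trans (hH.sum hT)
  intro u hu v hv h
  simp only [Set.mem_compl_iff, Set.mem_insert_iff, Set.mem_singleton_iff, not_or] at hu hv
  have hv' : v = x ∨ v = y := by
    by_contra! h'
    exact hv h'
  rcases hv' with rfl | rfl
  · exact hx u hu.1 hu.2 h.symm
  · exact hy u hu.1 hu.2 h.symm

/-- `x` and `y` are not adjacent, and no further vertex is adjacent to `x`. -/
theorem PairCover.baseFamily_of_not_adj [Finite V] {x y : V} (h : PairCover G x y)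
    (h1 : ∀ z, ¬CoversPairs G {z}) (hxy : ¬G.Adj x y)
    (hno : ∀ v, v ≠ x → v ≠ y → ¬G.Adj x v) : BaseFamily G := by
  by_cases hab : ∃ a b, (a ≠ x ∧ a ≠ y) ∧ (b ≠ x ∧ b ≠ y) ∧ ¬G.Adj y a ∧ ¬G.Adj y b ∧ G.Adj a b
  · obtain ⟨a, b, ha, hb, hay, hby, hab⟩ := hab
    by_cases hc : ∃ c, (c ≠ x ∧ c ≠ y) ∧ G.Adj y c
    · obtain ⟨c, hc, hcy⟩ := hc
      exact h.subst_G6 hxy hno ha hb hc hay hby hab hcy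
    · push Not at hc
      obtain ⟨M₁, M₂, hM⟩ := exists_join_two (G := G.induce ({x, y}ᶜ : Set V))
        (a := ⟨a, by simp [ha]⟩) (b := ⟨b, by simp [hb]⟩)
        (fun u v w => h.trans (not_or.1 v.2) (not_or.1 w.2)) hab
      exact .h M₁ M₂ (PairCover.isom_sum hno (fun v h1 h2 => hc v ⟨h1, h2⟩) hM
        ((isom_pair h.ne (compl_compl _)).2 hxy))
  · refine absurd ?_ (h1 x)
    obtain ⟨hne, htw, hdom⟩ := id h
    have key : ∀ v, v ≠ x → v ≠ y → ¬G.Adj y v → ∀ w, G.Adj w y ↔ G.Adj w v := by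
      intro v hvx hvy hyv w
      have h2 := htw v w hvx hvy
      have h3 : ¬(_ ∧ _) := fun h => hab ⟨v, w, h⟩
      by_cases hwx : w = x
      · simp [hwx, hxy, hno v hvx hvy]
      by_cases hwy : w = y
      · simp [hwy, hyv]
      have h4 := fun h => h2 hwx hwy h y
      grind [G.adj_comm]
    intro u v hu hv huv w
    simp only [Set.mem_singleton_iff] at hu hv
    by_cases huy : u = y
    · subst huy
      by_cases hvy : v = u
      · rw [hvy]
      exact key v hv hvy huv w
    by_cases hvy : v = y
    · subst hvy
      exact (key u hu huy (fun h => huv h.symm) w).symm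
    exact htw u v hu huy hv hvy huv w

/-- `x` and `y` are adjacent, no further vertex is adjacent to `x`, but one is adjacent to `y`. -/
theorem PairCover.baseFamily_of_adj [Finite V] {x y : V} (h : PairCover G x y)
    (h1 : ∀ z, ¬CoversPairs G {z}) (hxy : G.Adj x y)
    (hno : ∀ v, v ≠ x → v ≠ y → ¬G.Adj x v) {c : V} (hc : c ≠ x ∧ c ≠ y) (hcy : G.Adj y c) :
    BaseFamily G := by
  by_cases ha : ∃ a, (a ≠ x ∧ a ≠ y) ∧ ¬G.Adj y a
  · obtain ⟨a, ha, hay⟩ := ha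
    exact h.subst_G5_of_adj hxy hno ha hc hay hcy
  · push Not at ha
    refine absurd ?_ (h1 x)
    have hy : ∀ v, v ≠ y → G.Adj y v := by
      intro v hv
      by_cases hvx : v = x
      · rw [hvx]
        exact hxy.symm
      · exact ha v ⟨hvx, hv⟩
    intro u v hu hv huv w
    simp only [Set.mem_singleton_iff] at hu hv
    by_cases huvn : u = v
    · rw [huvn]
    exact h.twin u v hu (fun h => huv (h ▸ hy v (fun h' => huvn (h.trans h'.symm)))) hv
      (fun h => huv (h ▸ (hy u (fun h' => huvn (h'.trans h.symm))).symm)) huv w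

/-- Every further vertex is adjacent to just one of the adjacent vertices `x` and `y`, and the
vertices adjacent to `y` form an independent set. -/
theorem PairCover.coversPairs_singleton {x y : V} (h : PairCover G x y) (hxy : G.Adj x y)
    (hno : ∀ v, v ≠ x → v ≠ y → G.Adj x v ∨ G.Adj y v)
    (hab : ∀ a b, (a ≠ x ∧ a ≠ y) → (b ≠ x ∧ b ≠ y) → ¬G.Adj x a → ¬G.Adj x b → ¬G.Adj a b) :
    CoversPairs G {y} := by
  obtain ⟨hne, htw, hdom⟩ := id h
  have key : ∀ v, v ≠ x → v ≠ y → ¬G.Adj x v → ∀ w, G.Adj w x ↔ G.Adj w v := by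
    intro v hvx hvy hyv w
    have h2 := htw v w hvx hvy
    have h3 := hab v w
    have h4 := hno v
    have h5 := hdom w
    by_cases hwx : w = x
    · simp [hwx, hyv]
    by_cases hwy : w = y
    · simp only [hwy, hxy.symm, true_iff]
      tauto
    have h6 := fun h => h2 hwx hwy h x
    grind [G.adj_comm]
  intro u v hu hv huv w
  simp only [Set.mem_singleton_iff] at hu hv
  by_cases hux : u = x
  · subst hux
    by_cases hvx : v = u
    · rw [hvx]
    exact key v hvx hv huv w
  by_cases hvx : v = x
  · subst hvx
    exact (key u hux hu (fun h => huv h.symm) w).symm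
  exact htw u v hux hu hvx hv huv w

/-- `x` and `y` are the ends of an isolated edge. -/
theorem PairCover.baseFamily_of_isolated_edge [Finite V] {x y : V} (h : PairCover G x y)
    (h1 : ∀ z, ¬CoversPairs G {z}) (hxy : G.Adj x y)
    (h4 : ∀ e : Fin 2 ⊕ Fin 2 → V, IsCoComponent Gᶜ (K 2 ⊕g K 2) e →
      ¬CoversPairs G (Set.range e))
    (hx : ∀ v, v ≠ x → v ≠ y → ¬G.Adj x v) (hy : ∀ v, v ≠ x → v ≠ y → ¬G.Adj y v) :
    BaseFamily G := by
  classical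
  have hK : G.induce ({x, y}ᶜᶜ : Set V) ≅g K 2 := (isom_pair h.ne (compl_compl _)).1 hxy
  have htr : ∀ a b c : ({x, y}ᶜ : Set V), ¬(G.induce ({x, y}ᶜ : Set V)).Adj a b →
      ¬(G.induce ({x, y}ᶜ : Set V)).Adj b c → ¬(G.induce ({x, y}ᶜ : Set V)).Adj a c :=
    fun u v w => h.trans (not_or.1 v.2) (not_or.1 w.2)
  by_cases hab : ∃ a b : ({x, y}ᶜ : Set V), G.Adj a b
  swap
  · push Not at hab
    have hE := isom_edgeless (G := G.induce ({x, y}ᶜ : Set V)) fun u v => hab u v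
    by_cases hr : 2 ≤ Nat.card ({x, y}ᶜ : Set V)
    · exact .e _ hr (PairCover.isom_sum hx hy hE hK)
    · have hsub : Subsingleton ({x, y}ᶜ : Set V) := Finite.card_le_one_iff_subsingleton.1 (by omega)
      have hsub' : ∀ a b, a ≠ x → a ≠ y → b ≠ x → b ≠ y → a = b := fun a b h1 h2 h3 h4 =>
        congrArg Subtype.val (Subsingleton.elim (⟨a, by simp [h1, h2]⟩ : ({x, y}ᶜ : Set V))
          ⟨b, by simp [h3, h4]⟩)
      by_cases ha : ∃ a, a ≠ x ∧ a ≠ y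
      · obtain ⟨a, hax, hay⟩ := ha
        refine absurd ?_ (h1 a)
        intro u v hu hv huv w
        simp only [Set.mem_singleton_iff] at hu hv
        have hux : u = x ∨ u = y := by
          by_contra! h
          exact hu (hsub' u a h.1 h.2 hax hay)
        have hvx : v = x ∨ v = y := by
          by_contra! h
          exact hv (hsub' v a h.1 h.2 hax hay)
        rcases hux with rfl | rfl <;> rcases hvx with rfl | rfl <;>
          first | rfl | exact absurd hxy huv | exact absurd hxy.symm huv
      · push Not at ha
        refine absurd ?_ (h1 x)
        intro u v hu hv huv w
        simp only [Set.mem_singleton_iff] at hu hv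
        rw [ha u hu, ha v hv]
  obtain ⟨a, b, hab⟩ := hab
  by_cases hc : ∃ c : ({x, y}ᶜ : Set V), G.Adj a c ∧ G.Adj b c
  · obtain ⟨c, hac, hbc⟩ := hc
    obtain ⟨M₁, M₂, M₃, hM⟩ := exists_join_three htr hab hac hbc
    exact .g M₁ M₂ M₃ (PairCover.isom_sum hx hy hM hK)
  push Not at hc
  -- the vertices other than `x` and `y` fall into two classes, one of them not a singleton
  have hf : ∀ a b : ({x, y}ᶜ : Set V), G.Adj a b → (∀ c : ({x, y}ᶜ : Set V), G.Adj a c →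
      ¬G.Adj b c) → (∃ c : ({x, y}ᶜ : Set V), c ≠ a ∧ ¬G.Adj a c) → BaseFamily G := by
    intro a b hab hc ⟨a', hne, hna⟩
    have : Nonempty ({v | ¬(G.induce ({x, y}ᶜ : Set V)).Adj a v}ᶜ : Set ({x, y}ᶜ : Set V)) :=
      ⟨b, by simpa using hab⟩
    obtain ⟨M, hM⟩ := exists_cmGraph (G := (G.induce ({x, y}ᶜ : Set V)).induce
      {v | ¬(G.induce ({x, y}ᶜ : Set V)).Adj a v}ᶜ) fun u v w => htr u v w
    have hE := isom_edgeless (G := (G.induce ({x, y}ᶜ : Set V)).induce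
      {v | ¬(G.induce ({x, y}ᶜ : Set V)).Adj a v}) fun u v =>
        htr u a v (fun h => u.2 h.symm) v.2
    refine .f _ ?_ M (PairCover.isom_sum hx hy ((isom_join_of_adj
      (s := {v | ¬(G.induce ({x, y}ᶜ : Set V)).Adj a v}) ?_).trans (hE.join hM)) hK)
    · have : Nontrivial {v | ¬(G.induce ({x, y}ᶜ : Set V)).Adj a v} :=
        ⟨⟨a, by simp⟩, ⟨a', hna⟩, fun h => hne (congrArg Subtype.val h).symm⟩
      exact Finite.one_lt_card
    · intro u hu v hv
      by_contra h
      exact hv (htr a u v hu h)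
  by_cases ha' : ∃ c : ({x, y}ᶜ : Set V), c ≠ a ∧ ¬G.Adj a c
  · exact hf a b hab hc ha'
  by_cases hb' : ∃ c : ({x, y}ᶜ : Set V), c ≠ b ∧ ¬G.Adj b c
  · exact hf b a hab.symm (fun c h1 h2 => hc c h2 h1) hb'
  push Not at ha' hb'
  have ha := a.2
  have hb := b.2
  simp only [Set.mem_compl_iff, Set.mem_insert_iff, Set.mem_singleton_iff, not_or] at ha hb
  have hall : ∀ v, v = x ∨ v = y ∨ v = a ∨ v = b := by
    intro v
    by_contra! hv
    have h2 := ha' ⟨v, by simp [hv]⟩ fun h => hv.2.2.1 (congrArg Subtype.val h)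
    have h3 := hb' ⟨v, by simp [hv]⟩ fun h => hv.2.2.2 (congrArg Subtype.val h)
    exact hc _ h2 h3
  have hr : ∀ v, v ∈ Set.range (Sum.elim ![x, y] ![(a : V), (b : V)]) := by
    intro v
    rcases hall v with rfl | rfl | rfl | rfl
    exacts [⟨.inl 0, rfl⟩, ⟨.inl 1, rfl⟩, ⟨.inr 0, rfl⟩, ⟨.inr 1, rfl⟩]
  -- only the join factor `2K₂` remains
  refine absurd (fun u v hu => absurd (hr u) hu) (h4 (Sum.elim ![x, y] ![(a : V), (b : V)])
    ⟨?_, ?_, fun w hw => absurd (hr w) hw⟩)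
  · have hne := h.ne
    have habne := hab.ne
    intro i j
    revert i j
    simp [Sum.forall, Fin.forall_fin_succ]
    grind only
  · have hne := h.ne
    have habne := hab.ne
    have h1 := hx a ha.1 ha.2
    have h2 := hx b hb.1 hb.2
    have h3 := hy a ha.1 ha.2
    have h4 := hy b hb.1 hb.2
    have h5 := hxy.symm
    have h6 := hab.symm
    simp [Sum.forall, Fin.forall_fin_succ]
    grind [G.adj_comm]

/-- If no single vertex and no join factor `2K₂` covers the non-adjacent non-twins, a graph in which
`x` and `y` do lies in one of the families. The cases are distinguished by which of the types
*adjacent only to `x`*, *only to `y`*, *to neither* occur among the further vertices. -/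
theorem PairCover.baseFamily [Finite V] {x y : V} (h : PairCover G x y)
    (h1 : ∀ z, ¬CoversPairs G {z})
    (h4 : ∀ e : Fin 2 ⊕ Fin 2 → V, IsCoComponent Gᶜ (K 2 ⊕g K 2) e →
      ¬CoversPairs G (Set.range e)) : BaseFamily G := by
  by_cases hb : ∃ b, (b ≠ x ∧ b ≠ y) ∧ G.Adj x b
  swap
  · push Not at hb
    have hno := fun v h1 h2 => hb v ⟨h1, h2⟩
    by_cases hxy : G.Adj x y
    · by_cases hc : ∃ c, (c ≠ x ∧ c ≠ y) ∧ G.Adj y c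
      · obtain ⟨c, hc, hcy⟩ := hc
        exact h.baseFamily_of_adj h1 hxy hno hc hcy
      · push Not at hc
        exact h.baseFamily_of_isolated_edge h1 hxy h4 hno fun v h1 h2 => hc v ⟨h1, h2⟩
    · exact h.baseFamily_of_not_adj h1 hxy hno
  obtain ⟨b, hb, hbx⟩ := hb
  by_cases hc : ∃ c, (c ≠ x ∧ c ≠ y) ∧ G.Adj y c
  swap
  · push Not at hc
    have hno := fun v h1 h2 => hc v ⟨h2, h1⟩
    by_cases hxy : G.Adj x y
    · exact h.symm.baseFamily_of_adj h1 hxy.symm hno hb.symm hbx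
    · exact h.symm.baseFamily_of_not_adj h1 (fun h => hxy h.symm) hno
  obtain ⟨c, hc, hcy⟩ := hc
  by_cases ha : ∃ a, (a ≠ x ∧ a ≠ y) ∧ ¬G.Adj x a ∧ ¬G.Adj y a
  · obtain ⟨a, ha, hax, hay⟩ := ha
    exact h.subst_bull_or_house ha hb hc hax hay hbx hcy
  have hno : ∀ v, v ≠ x → v ≠ y → G.Adj x v ∨ G.Adj y v := by
    intro v hvx hvy
    by_contra! hv
    exact ha ⟨v, ⟨hvx, hvy⟩, hv⟩
  by_cases hxy : G.Adj x y
  swap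
  · exact h.subst_G5_of_not_adj hxy hno hb hc hbx hcy
  by_cases hX : ∃ a b, (a ≠ x ∧ a ≠ y) ∧ (b ≠ x ∧ b ≠ y) ∧ ¬G.Adj x a ∧ ¬G.Adj x b ∧ G.Adj a b
  swap
  · push Not at hX
    exact absurd (h.coversPairs_singleton hxy hno hX) (h1 y)
  by_cases hY : ∃ a b, (a ≠ x ∧ a ≠ y) ∧ (b ≠ x ∧ b ≠ y) ∧ ¬G.Adj y a ∧ ¬G.Adj y b ∧ G.Adj a b
  swap
  · push Not at hY
    exact absurd (h.symm.coversPairs_singleton hxy.symm (fun v h1 h2 => (hno v h2 h1).symm)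
      fun a b h1 h2 => hY a b h1.symm h2.symm) (h1 x)
  obtain ⟨a, b, ha, hb, hax, hbx, hab⟩ := hX
  obtain ⟨c, d, hc, hd, hcy, hdy, hcd⟩ := hY
  exact h.subst_G7 hxy hno ha hb hc hd hax hbx hab hcy hdy hcd

end Cover
/-! ### Graphs of order `n` with distinguishing chromatic number `n - 2` -/

section Structure

variable {V : Type*} {G : SimpleGraph V}

theorem isom_induce_join {s t : Set V} (hd : Disjoint s t) (h : ∀ u ∈ s, ∀ v ∈ t, G.Adj u v) :
    G.induce (s ∪ t) ≅g G.induce s ∨g G.induce t := by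
  classical
  refine Isom.symm ⟨⟨(Equiv.Set.union hd).symm, ?_⟩⟩
  rintro (u | u) (v | v)
  · simp
  · simpa using h u u.2 v v.2
  · simpa using (h v v.2 u u.2).symm
  · simp

theorem isom_induce_sum {s t : Set V} (hd : Disjoint s t) (h : ∀ u ∈ s, ∀ v ∈ t, ¬G.Adj u v) :
    G.induce (s ∪ t) ≅g G.induce s ⊕g G.induce t := by
  classical
  refine Isom.symm ⟨⟨(Equiv.Set.union hd).symm, ?_⟩⟩
  rintro (u | u) (v | v)
  · simp
  · simpa using h u u.2 v v.2
  · simpa using fun h' => h v v.2 u u.2 h'.symm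
  · simp

/-- In `G`, a component of the complement is a join factor. -/
theorem IsCoComponent.adj {ι : Type*} {T : SimpleGraph ι} {e : ι → V}
    (he : IsCoComponent Gᶜ T e) :
    (∀ i j, G.Adj (e i) (e j) ↔ T.Adj i j) ∧ ∀ w ∉ Set.range e, ∀ i, G.Adj w (e i) := by
  obtain ⟨hinj, hadj, hout⟩ := he
  constructor
  · intro i j
    by_cases hij : i = j
    · simp [hij]
    have := hadj i j hij
    simp only [compl_adj, hinj.ne hij, ne_eq, not_false_eq_true, true_and, not_iff_not] at this
    exact this
  · intro w hw i
    have h1 := hout w hw i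
    have h2 : w ≠ e i := fun h => hw ⟨i, h.symm⟩
    simpa [h2] using h1

/-- Two edges whose exchange is an automorphism cannot carry the same two colors. -/
theorem not_isDistinguishing_of_exchange {α : Type*} {c : G.Coloring α} {a b p q : V}
    (hnd : [a, b, p, q].Nodup) (hab : G.Adj a b) (hpq : G.Adj p q) (haq : ¬G.Adj a q)
    (hbp : ¬G.Adj b p) (hout : ∀ w, w ∉ [a, b, p, q] → (G.Adj w a ↔ G.Adj w p) ∧
      (G.Adj w b ↔ G.Adj w q)) (hap : c a = c p) (hbq : c b = c q) : ¬IsDistinguishing c := by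
  classical
  intro hc
  simp only [List.nodup_cons, List.mem_cons, List.not_mem_nil, or_false, not_or,
    List.nodup_nil, not_false_eq_true, and_true] at hnd hout
  let f : V → V := fun w => if w = a then p else if w = p then a else if w = b then q else
    if w = q then b else w
  have hf : ∀ w, (w = a ∧ f w = p) ∨ (w = p ∧ f w = a) ∨ (w = b ∧ f w = q) ∨ (w = q ∧ f w = b) ∨
      ((w ≠ a ∧ w ≠ b ∧ w ≠ p ∧ w ≠ q) ∧ f w = w) := by
    intro w
    by_cases h1 : w = a
    · simp [f, h1]
    by_cases h2 : w = p
    · simp [f, h2]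
    by_cases h3 : w = b
    · simp_all [f]
    by_cases h4 : w = q
    · have h1' := Ne.symm h1
      have h2' := Ne.symm h2
      have h3' := Ne.symm h3
      simp_all [f]
    simp [f, h1, h2, h3, h4]
  clear_value f
  have hinv : Function.Involutive f := by
    intro w
    have := hf w
    have := hf (f w)
    grind
  have h1 := hc ⟨hinv.toPerm f, by
    intro u v
    change G.Adj (f u) (f v) ↔ G.Adj u v
    have h1 := hout u
    have h2 := hout v
    rcases hf u with ⟨hu, hu'⟩ | ⟨hu, hu'⟩ | ⟨hu, hu'⟩ | ⟨hu, hu'⟩ | ⟨hu, hu'⟩ <;>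
      rcases hf v with ⟨hv, hv'⟩ | ⟨hv, hv'⟩ | ⟨hv, hv'⟩ | ⟨hv, hv'⟩ | ⟨hv, hv'⟩ <;>
      grind [G.adj_comm, G.irrefl]⟩ (fun v => by
    change c (f v) = c v
    have := hf v
    grind) a
  change f a = a at h1
  have := hf a
  grind

/-- A graph with a join factor `2K₂` that covers the non-adjacent non-twins needs at least `n - 1`
colors. -/
theorem card_le_chiD_add_one [Fintype V] {e : Fin 2 ⊕ Fin 2 → V}
    (he : IsCoComponent Gᶜ (K 2 ⊕g K 2) e) (h : CoversPairs G (Set.range e)) :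
    Fintype.card V ≤ chiD G + 1 := by
  classical
  by_contra! hlt
  obtain ⟨c, hc⟩ := exists_coloring_of_chiD_le (le_refl (chiD G))
  have hinj := he.1
  obtain ⟨hadj, hout⟩ := he.adj
  have hrange : ∀ v, v ∈ Set.range e ↔
      v = e (.inl 0) ∨ v = e (.inl 1) ∨ v = e (.inr 0) ∨ v = e (.inr 1) := by
    intro v
    simp [Fin.exists_fin_two, eq_comm, or_assoc]
  have hab : G.Adj (e (.inl 0)) (e (.inl 1)) := (hadj _ _).2 (by simp)
  have hpq : G.Adj (e (.inr 0)) (e (.inr 1)) := (hadj _ _).2 (by simp)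
  have hno : ∀ i j, ¬G.Adj (e (.inl i)) (e (.inr j)) := fun i j => by simp [hadj]
  -- already the ends of one edge of the `2K₂` cover, so the colors off this edge are distinct
  have hcov : CoversPairs G (({e (.inl 0), e (.inl 1)} : Finset V) : Set V) := by
    intro u v hu hv huv w
    simp only [Finset.coe_insert, Finset.coe_singleton, Set.mem_insert_iff,
      Set.mem_singleton_iff, not_or] at hu hv
    by_cases huQ : u ∈ Set.range e
    · by_cases hvQ : v ∈ Set.range e
      · rw [hrange] at huQ hvQ
        have huQ' := huQ.resolve_left hu.1 |>.resolve_left hu.2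
        have hvQ' := hvQ.resolve_left hv.1 |>.resolve_left hv.2
        have hpq' := hpq.symm
        rcases huQ' with rfl | rfl <;> rcases hvQ' with rfl | rfl <;>
          first | rfl | contradiction
      · obtain ⟨i, rfl⟩ := huQ
        exact absurd (hout v hvQ i).symm huv
    · by_cases hvQ : v ∈ Set.range e
      · obtain ⟨i, rfl⟩ := hvQ
        exact absurd (hout u huQ i) huv
      · exact h u v huQ hvQ huv w
  have hcard : ({e (.inl 0), e (.inl 1)} : Finset V).card = 2 := Finset.card_pair hab.ne
  have hle := hcov.card_le_chiD_add
  rw [hcard] at hle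
  have hsurj : ∀ i, ∃ v ∉ ({e (.inl 0), e (.inl 1)} : Finset V), c v = i := by
    have h1 : (({e (.inl 0), e (.inl 1)} : Finset V)ᶜ.image c) = Finset.univ := by
      refine Finset.eq_univ_of_card _ ?_
      rw [Finset.card_image_of_injOn (by
        rw [Finset.coe_compl]
        exact hcov.injOn hc), Finset.card_compl, hcard,
        Fintype.card_fin]
      omega
    intro i
    obtain ⟨v, hv, rfl⟩ := Finset.mem_image.1 (h1 ▸ Finset.mem_univ i)
    exact ⟨v, Finset.mem_compl.1 hv, rfl⟩
  -- with only `n - 2` colors, both ends of that edge repeat colors, necessarily of the other edge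
  have hpart : ∀ i, ∃ j, c (e (.inl i)) = c (e (.inr j)) := by
    intro i
    obtain ⟨v, hv, hvi⟩ := hsurj (c (e (.inl i)))
    simp only [Finset.mem_insert, Finset.mem_singleton, not_or] at hv
    have hvQ : v ∈ Set.range e := by
      by_contra hvQ
      exact c.valid (hout v hvQ _) hvi
    rw [hrange] at hvQ
    rcases hvQ with h1 | h1 | h1 | h1
    · exact absurd h1 hv.1
    · exact absurd h1 hv.2
    · exact ⟨0, by rw [← hvi, h1]⟩
    · exact ⟨1, by rw [← hvi, h1]⟩
  have hcab := c.valid hab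
  obtain ⟨j, hj⟩ := hpart 0
  obtain ⟨k, hk⟩ := hpart 1
  have hjk : j ≠ k := by
    rintro rfl
    exact hcab (hj.trans hk.symm)
  refine not_isDistinguishing_of_exchange (a := e (.inl 0)) (b := e (.inl 1)) (p := e (.inr j))
    (q := e (.inr k)) ?_ hab ?_ (hno _ _) (hno _ _) ?_ hj hk hc
  · simp [hinj.eq_iff, hjk]
  · simpa [hadj] using hjk
  · intro w hw
    have hwQ : w ∉ Set.range e := by
      rw [hrange]
      fin_cases j <;> fin_cases k <;> simp at hjk hw ⊢ <;> grind only
    simp [hout w hwQ]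

/-- Removing a join factor does not affect components of the complement in the other one. -/
theorem IsCoComponent.of_induce {s : Set V} (hs : ∀ u ∈ s, ∀ v ∉ s, G.Adj u v) {ι : Type*}
    {T : SimpleGraph ι} {e : ι → s} (he : IsCoComponent (G.induce s)ᶜ T e) : IsCoComponent Gᶜ T (fun i => (e i : V)) := by
  refine ⟨Subtype.val_injective.comp he.1, fun i j hij => ?_, fun w hw i => ?_⟩
  · rw [← he.2.1 i j hij]
    simp [Subtype.ext_iff]
  · by_cases hws : w ∈ s
    · have := he.2.2 ⟨w, hws⟩ (fun ⟨j, hj⟩ => hw ⟨j, congrArg Subtype.val hj⟩) i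
      simpa [Subtype.ext_iff] using this
    · exact fun h => h.2 (hs _ (e i).2 w hws).symm

/-- Removing a complete multipartite join factor does not affect covering sets. -/
theorem CoversPairs.of_induce {s : Set V} (hs : ∀ u ∈ s, ∀ v ∉ s, G.Adj u v)
    (htr : ∀ a b c, a ∉ s → b ∉ s → c ∉ s → ¬G.Adj a b → ¬G.Adj b c → ¬G.Adj a c)
    {S : Set s} (h : CoversPairs (G.induce s) S) :
    CoversPairs G (Subtype.val '' S) := by
  intro u v hu hv huv w
  by_cases hus : u ∈ s
  · by_cases hvs : v ∈ s
    · by_cases hws : w ∈ s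
      · exact h ⟨u, hus⟩ ⟨v, hvs⟩ (fun h => hu ⟨_, h, rfl⟩) (fun h => hv ⟨_, h, rfl⟩) huv ⟨w, hws⟩
      · simp [(hs u hus w hws).symm, (hs v hvs w hws).symm]
    · exact absurd (hs u hus v hvs) huv
  · by_cases hvs : v ∈ s
    · exact absurd (hs v hvs u hus).symm huv
    · by_cases hws : w ∈ s
      · simp [hs w hws u hus, hs w hws v hvs]
      · have h1 := htr w u v hws hus hvs
        have h2 := htr w v u hws hvs hus
        have h3 : ¬G.Adj v u := fun h => huv h.symm
        tauto

/-- A graph of order `n` with `χ_D = n - 2` lies in one of the seventeen families, possibly after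
removing a complete multipartite join factor. -/
theorem exists_baseFamily [Fintype V] (hn : 4 ≤ Fintype.card V)
    (hG : chiD G = Fintype.card V - 2) :
    (∃ (M : CMGraph) (k : ℕ) (F : SimpleGraph (Fin k)), BaseFamily F ∧ (G ≅g M.graph ∨g F)) ∨
      BaseFamily G := by
  classical
  have hne : Nonempty V := Fintype.card_pos_iff.1 (by omega)
  have h1 : ∀ z, ¬CoversPairs G {z} := by
    intro z h
    have := CoversPairs.card_le_chiD_add (S := {z}) (by simpa using h)
    rw [Finset.card_singleton] at this
    omega
  have h4 : ∀ e : Fin 2 ⊕ Fin 2 → V, IsCoComponent Gᶜ (K 2 ⊕g K 2) e →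
      ¬CoversPairs G (Set.range e) := by
    intro e he h
    have := card_le_chiD_add_one he h
    omega
  -- an isolated piece of the complement containing all non-adjacent non-twins
  have hcomp : ∀ {ι : Type} {T : SimpleGraph ι} {e : ι → V}, IsCoComponent Gᶜ T e →
      CoversPairs G (Set.range e) → BaseFamily T →
      (∃ (M : CMGraph) (k : ℕ) (F : SimpleGraph (Fin k)), BaseFamily F ∧ (G ≅g M.graph ∨g F)) ∨
      BaseFamily G := by
    intro ι T e he h hT
    refine BaseFamily.of_induce (s := Set.range e) ?_ ?_
      (hT.of_isom (isom_of_injective e he.1 rfl he.adj.1))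
    · rintro _ ⟨i, rfl⟩ v hv
      exact (he.adj.2 v hv i).symm
    · intro a b c _ hb hc hab hbc
      rwa [← h b c hb hc hbc a]
  have hd : Fintype.card V ≤ chiD Gᶜᶜ + 2 := by
    rw [compl_compl]
    omega
  cases coreType_of_le_chiD hd with
  | cover x y h =>
    rw [compl_compl] at h
    have hxy : x ≠ y := by
      rintro rfl
      exact h1 x (by simpa using h)
    have htw : ∀ u v, u ≠ x → u ≠ y → v ≠ x → v ≠ y → ¬G.Adj u v → ∀ w, G.Adj w u ↔ G.Adj w v :=
      fun u v h1 h2 h3 h4 => h u v (by simp [h1, h2]) (by simp [h3, h4])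
    -- the vertices adjacent to both `x` and `y` form the join factor
    have hs : ∀ u ∈ {v | v = x ∨ v = y ∨ ¬G.Adj x v ∨ ¬G.Adj y v},
        ∀ v ∉ {v | v = x ∨ v = y ∨ ¬G.Adj x v ∨ ¬G.Adj y v}, G.Adj u v := by
      intro u hu v hv
      simp only [Set.mem_ofPred_eq, not_or, not_not] at hu hv
      by_cases hux : u = x
      · rw [hux]; exact hv.2.2.1
      by_cases huy : u = y
      · rw [huy]; exact hv.2.2.2
      by_contra huv
      have := htw u v hux huy hv.1 hv.2.1 huv
      have hx := this x
      have hy := this y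
      tauto
    have htr : ∀ a b c, a ∉ {v | v = x ∨ v = y ∨ ¬G.Adj x v ∨ ¬G.Adj y v} →
        b ∉ {v | v = x ∨ v = y ∨ ¬G.Adj x v ∨ ¬G.Adj y v} →
        c ∉ {v | v = x ∨ v = y ∨ ¬G.Adj x v ∨ ¬G.Adj y v} →
        ¬G.Adj a b → ¬G.Adj b c → ¬G.Adj a c := by
      intro a b c _ hb hc hab hbc
      simp only [Set.mem_ofPred_eq, not_or] at hb hc
      rwa [← htw b c hb.1 hb.2.1 hc.1 hc.2.1 hbc a]
    refine BaseFamily.of_induce hs htr ?_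
    have hpc : PairCover (G.induce {v | v = x ∨ v = y ∨ ¬G.Adj x v ∨ ¬G.Adj y v})
        ⟨x, Or.inl rfl⟩ ⟨y, Or.inr (Or.inl rfl)⟩ := by
      refine ⟨fun h => hxy (congrArg Subtype.val h), ?_, ?_⟩
      · rintro ⟨u, _⟩ ⟨v, _⟩ h1 h2 h3 h4 huv ⟨w, _⟩
        simp only [ne_eq, Subtype.mk.injEq] at h1 h2 h3 h4
        exact htw u v h1 h2 h3 h4 huv w
      · rintro ⟨v, hv⟩ h1 h2
        simp only [ne_eq, Subtype.mk.injEq] at h1 h2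
        simp only [Set.mem_ofPred_eq, h1, h2, false_or] at hv
        exact hv
    refine hpc.baseFamily (fun z hz => h1 z ?_) (fun e he h => h4 _ (IsCoComponent.of_induce hs he) ?_)
    · simpa using CoversPairs.of_induce hs htr hz
    · have := CoversPairs.of_induce hs htr h
      rwa [← Set.range_comp] at this
  | path e he h => exact hcomp he (by rwa [compl_compl] at h) (.a (Isom.refl _))
  | cycle5 e he h => exact hcomp he (by rwa [compl_compl] at h) (.b (Isom.refl _))
  | cycle6 e he h => exact hcomp he (by rwa [compl_compl] at h) (.c (Isom.refl _))
  | triangles e he h => exact hcomp he (by rwa [compl_compl] at h) (.d (Isom.refl _))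
  | twoC4 e he h => exact hcomp he (by rwa [compl_compl] at h) (.i (Isom.refl _))
  | c4Star e he x hx h =>
    rw [compl_compl] at h
    obtain ⟨hadj, hout⟩ := he.adj
    set Q := Set.range e with hQ
    have hQ' : ∀ u ∈ Q, ∀ v ∉ Q, G.Adj u v := by
      rintro _ ⟨i, rfl⟩ v hv
      exact (hout v hv i).symm
    set R : Set V := {v | v ∉ Q ∧ v ≠ x ∧ ¬G.Adj x v} with hR
    have htw : ∀ u v, u ∉ Q → u ≠ x → v ∉ Q → v ≠ x → ¬G.Adj u v → ∀ w, G.Adj w u ↔ G.Adj w v :=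
      fun u v h1 h2 h3 h4 => h u v (by simp [h1, h2]) (by simp [h3, h4])
    have hs : ∀ u ∈ Q ∪ (R ∪ {x}), ∀ v ∉ Q ∪ (R ∪ {x}), G.Adj u v := by
      intro u hu v hv
      simp only [hR, Set.mem_union, Set.mem_ofPred_eq, Set.mem_singleton_iff, not_or] at hu hv
      have hxv : G.Adj x v := by
        by_contra h
        exact hv.2.1 ⟨hv.1, hv.2.2, h⟩
      rcases hu with hu | hu | rfl
      · exact hQ' u hu v hv.1
      · by_contra huv
        exact hu.2.2 ((htw u v hu.1 hu.2.1 hv.1 hv.2.2 huv x).2 hxv)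
      · exact hxv
    have htr : ∀ a b c, a ∉ Q ∪ (R ∪ {x}) → b ∉ Q ∪ (R ∪ {x}) → c ∉ Q ∪ (R ∪ {x}) →
        ¬G.Adj a b → ¬G.Adj b c → ¬G.Adj a c := by
      intro a b c _ hb hc hab hbc
      simp only [Set.mem_union, Set.mem_singleton_iff, not_or] at hb hc
      rwa [← htw b c hb.1 hb.2.2 hc.1 hc.2.2 hbc a]
    by_cases hab : ∃ a b : R, G.Adj a b
    · obtain ⟨a, b, hab⟩ := hab
      obtain ⟨M₁, M₂, hM⟩ := exists_join_two (G := G.induce R) (a := a) (b := b) (by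
        rintro ⟨u, hu⟩ ⟨v, hv⟩ ⟨w, hw⟩ huv hvw
        change ¬G.Adj u w
        rwa [← htw v w hv.1 hv.2.1 hw.1 hw.2.1 hvw u]) hab
      refine BaseFamily.of_induce hs htr (.j M₁ M₂ ?_)
      refine (isom_induce_join ?_ ?_).trans
        ((isom_of_injective e he.1 rfl hadj).join ((isom_induce_sum ?_ ?_).trans
          (hM.sum (isom_one_of_subsingleton (x := x) rfl))))
      · rw [Set.disjoint_left]
        rintro u hu (hu' | rfl)
        · exact hu'.1 hu
        · exact hx hu
      · rintro u hu v (hv | rfl)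
        · exact hQ' u hu v hv.1
        · exact hQ' u hu v hx
      · simp [hR]
      · rintro u hu v rfl h
        exact hu.2.2 h.symm
    · -- without such an adjacent pair, the 4-cycle covers alone
      push Not at hab
      refine absurd ?_ (h4 e he)
      have key : ∀ v, v ∉ Q → v ≠ x → ¬G.Adj x v → ∀ w, G.Adj w x ↔ G.Adj w v := by
        intro v hvQ hvx hxv w
        by_cases hwQ : w ∈ Q
        · simp [hQ' w hwQ v hvQ, hQ' w hwQ x hx]
        by_cases hwx : w = x
        · simp [hwx, hxv]
        by_cases hxw : G.Adj x w
        · simp only [hxw.symm, true_iff]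
          by_contra hwv
          exact hxv ((htw w v hwQ hwx hvQ hvx hwv x).1 hxw)
        · have h1 : ¬G.Adj w x := fun h => hxw h.symm
          have h2 := hab ⟨w, hwQ, hwx, hxw⟩ ⟨v, hvQ, hvx, hxv⟩
          simp [h1, h2]
      intro u v hu hv huv w
      by_cases hux : u = x
      · subst hux
        by_cases hvx : v = u
        · rw [hvx]
        exact key v hv hvx huv w
      by_cases hvx : v = x
      · subst hvx
        exact (key u hu hux (fun h => huv h.symm) w).symm
      exact htw u v hu hux hv hvx huv w
  | c4Cone e t he hadj ht hte hout h =>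
    rw [compl_compl] at h
    replace hadj : ∀ i j, G.Adj (e i) (e j) ↔ (K 2 ⊕g K 2).Adj i j := by
      intro i j
      by_cases hij : i = j
      · simp [hij]
      have := hadj i j hij
      simp only [compl_adj, he.ne hij, ne_eq, not_false_eq_true, true_and, not_iff_not] at this
      exact this
    set Q := Set.range e with hQ
    have hQ' : ∀ u ∈ Q, ∀ v ∉ Q, v ≠ t → G.Adj u v := by
      rintro _ ⟨i, rfl⟩ v hv hvt
      have h1 := hout v hv hvt i
      have h2 : v ≠ e i := fun h => hv ⟨i, h.symm⟩
      have : G.Adj v (e i) := by simpa [h2] using h1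
      exact this.symm
    have hQt : ∀ u ∈ Q, ¬G.Adj u t := by
      rintro _ ⟨i, rfl⟩ h
      exact (hte i).2 h.symm
    set R : Set V := {v | v ∉ Q ∧ v ≠ t ∧ ¬G.Adj t v} with hR
    have htw : ∀ u v, u ∉ Q → u ≠ t → v ∉ Q → v ≠ t → ¬G.Adj u v → ∀ w, G.Adj w u ↔ G.Adj w v :=
      fun u v h1 h2 h3 h4 => h u v (by simp [h1, h2]) (by simp [h3, h4])
    have hs : ∀ u ∈ (Q ∪ R) ∪ {t}, ∀ v ∉ (Q ∪ R) ∪ {t}, G.Adj u v := by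
      intro u hu v hv
      simp only [hR, Set.mem_union, Set.mem_ofPred_eq, Set.mem_singleton_iff, not_or] at hu hv
      have hxv : G.Adj t v := by
        by_contra h
        exact hv.1.2 ⟨hv.1.1, hv.2, h⟩
      rcases hu with (hu | hu) | rfl
      · exact hQ' u hu v hv.1.1 hv.2
      · by_contra huv
        exact hu.2.2 ((htw u v hu.1 hu.2.1 hv.1.1 hv.2 huv t).2 hxv)
      · exact hxv
    have htr : ∀ a b c, a ∉ (Q ∪ R) ∪ {t} → b ∉ (Q ∪ R) ∪ {t} → c ∉ (Q ∪ R) ∪ {t} →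
        ¬G.Adj a b → ¬G.Adj b c → ¬G.Adj a c := by
      intro a b c _ hb hc hab hbc
      simp only [Set.mem_union, Set.mem_singleton_iff, not_or] at hb hc
      rwa [← htw b c hb.1.1 hb.2 hc.1.1 hc.2 hbc a]
    refine BaseFamily.of_induce hs htr ?_
    have hsum : G.induce ((Q ∪ R) ∪ {t}) ≅g G.induce (Q ∪ R) ⊕g CMGraph.one.graph := by
      refine (isom_induce_sum ?_ ?_).trans
        ((Isom.refl _).sum (isom_one_of_subsingleton (x := t) rfl))
      · simp [hR, ht]
      · rintro u (hu | hu) v rfl h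
        · exact hQt u hu h
        · exact hu.2.2 h.symm
    rcases R.eq_empty_or_nonempty with hR0 | ⟨r, hr⟩
    · refine .k (hsum.trans (Isom.sum ?_ (Isom.refl _)))
      rw [hR0, Set.union_empty]
      exact isom_of_injective e he rfl hadj
    · have : Nonempty R := ⟨r, hr⟩
      obtain ⟨M, hM⟩ := exists_cmGraph (G := G.induce R) (by
        rintro ⟨u, hu⟩ ⟨v, hv⟩ ⟨w, hw⟩ huv hvw
        change ¬G.Adj u w
        rwa [← htw v w hv.1 hv.2.1 hw.1 hw.2.1 hvw u])
      refine .l M (hsum.trans (Isom.sum ((isom_induce_join ?_ ?_).trans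
        ((isom_of_injective e he rfl hadj).join hM)) (Isom.refl _)))
      · rw [Set.disjoint_left]
        exact fun u hu hu' => hu'.1 hu
      · exact fun u hu v hv => hQ' u hu v hv.1 hv.2.1

end Structure
/-! ### Distinguishing colorings of disjoint unions -/

section Sum

variable {V W U : Type*} {A : SimpleGraph V} {B : SimpleGraph W} {X : SimpleGraph V}
  {Y : SimpleGraph W} {Z : SimpleGraph U} {α : Type*}

theorem IsDistinguishing.restrict_inl {c : (A ⊕g B).Coloring α} (hc : IsDistinguishing c) :
    ∃ c' : A.Coloring α, IsDistinguishing c' ∧ ∀ v, c' v = c (.inl v) := by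
  refine ⟨Coloring.mk (fun v => c (.inl v)) fun {u v} h => c.valid (by simpa using h),
    fun f hf v => ?_, fun _ => rfl⟩
  have := hc (Iso.sumCongr f Iso.refl) (by
    rintro (v | v)
    · exact hf v
    · rfl) (.inl v)
  exact Sum.inl_injective this

theorem chiD_le_chiD_sum [Finite V] [Finite W] : chiD A ≤ chiD (A ⊕g B) := by
  obtain ⟨c, hc⟩ := exists_coloring_of_chiD_le (le_refl (chiD (A ⊕g B)))
  obtain ⟨c', hc', -⟩ := hc.restrict_inl
  exact chiD_le_of_coloring hc'

/-- A connected graph maps to one side of a disjoint union. -/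
theorem hom_sum_cases (hA : X.Connected) (g : X →g (Y ⊕g Z)) :
    (∃ g' : X →g Y, ∀ x, g x = .inl (g' x)) ∨ ∃ g' : X →g Z, ∀ x, g x = .inr (g' x) := by
  have hside : ∀ x y, X.Reachable x y → ((g x).isLeft ↔ (g y).isLeft) := by
    rintro x y ⟨w⟩
    induction w with
    | nil => rfl
    | cons h _ ih =>
      rw [← ih]
      have := g.map_adj h
      revert this
      rcases g _ with u | u <;> rcases g _ with v | v <;> simp
  obtain ⟨x₀⟩ := hA.nonempty
  cases hx : g x₀ with
  | inl y₀ =>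
    have h : ∀ x, ∃ y, g x = .inl y := fun x => by
      have := (hside x₀ x (hA.preconnected x₀ x)).1 (by simp [hx])
      exact Sum.isLeft_iff.1 this
    choose g' hg' using h
    refine Or.inl ⟨⟨g', fun {u v} huv => ?_⟩, hg'⟩
    have := g.map_adj huv
    rw [hg', hg'] at this
    simpa using this
  | inr z₀ =>
    have h : ∀ x, ∃ y, g x = .inr y := fun x => by
      have := mt (hside x₀ x (hA.preconnected x₀ x)).2 (by simp [hx])
      exact Sum.isRight_iff.1 (by simpa using this)
    choose g' hg' using h
    refine Or.inr ⟨⟨g', fun {u v} huv => ?_⟩, hg'⟩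
    have := g.map_adj huv
    rw [hg', hg'] at this
    simpa using this

/-- A color-preserving self-embedding of a finite graph is the identity when the coloring is
distinguishing. -/
theorem IsDistinguishing.eq_of_embedding [Finite V] {c : A.Coloring α} (hc : IsDistinguishing c)
    (g : V → V) (hg : Function.Injective g) (hadj : ∀ u v, A.Adj (g u) (g v) ↔ A.Adj u v)
    (hcol : ∀ v, c (g v) = c v) (v : V) : g v = v :=
  hc ⟨Equiv.ofBijective g (Finite.injective_iff_bijective.1 hg), by
    intro u v
    simpa using hadj u v⟩ hcol v

/-- Distinguishing colorings of a connected graph and of another graph combine unless the former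
occurs, with its colors, in the latter. -/
theorem IsDistinguishing.sum [Finite V] [Finite W] {a : A.Coloring α} {b : B.Coloring α}
    (ha : IsDistinguishing a) (hb : IsDistinguishing b) (hA : A.Connected)
    (hAB : ∀ g : A →g B, Function.Injective g → ∃ x, b (g x) ≠ a x) :
    ∃ c : (A ⊕g B).Coloring α, IsDistinguishing c ∧ (∀ x, c (.inl x) = a x) ∧
      ∀ y, c (.inr y) = b y := by
  refine ⟨Coloring.mk (Sum.elim a b) ?_, ?_, fun _ => rfl, fun _ => rfl⟩
  · rintro (u | u) (v | v) h
    · exact a.valid (by simpa using h)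
    · simp at h
    · simp at h
    · exact b.valid (by simpa using h)
  intro f hf
  change ∀ v, Sum.elim a b (f v) = Sum.elim a b v at hf
  have hleft : ∀ x, f (.inl x) = .inl x := by
    let g : A →g (A ⊕g B) := ⟨fun x => f (.inl x), fun {u v} h =>
      f.map_adj_iff.2 (by simpa using h)⟩
    have hginj : Function.Injective g := fun u v h => Sum.inl_injective (f.injective h)
    have hgf : ∀ x, g x = f (.inl x) := fun _ => rfl
    rcases hom_sum_cases hA g with ⟨g', hg'⟩ | ⟨g', hg'⟩
    · intro x
      have hid := ha.eq_of_embedding g' (fun u v h => hginj (by rw [hg', hg', h])) (by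
        intro u v
        have := f.map_adj_iff (v := .inl u) (w := .inl v)
        rw [← hgf, ← hgf, hg', hg'] at this
        simpa using this) (by
        intro v
        have := hf (.inl v)
        rwa [← hgf, hg'] at this) x
      rw [← hgf, hg', hid]
    · obtain ⟨x, hx⟩ := hAB g' fun u v h => hginj (by rw [hg', hg', h])
      have := hf (.inl x)
      rw [← hgf, hg'] at this
      exact absurd this hx
  have hright : ∀ y, ∃ z, f (.inr y) = .inr z := by
    intro y
    cases h : f (.inr y) with
    | inl x =>
      rw [← hleft x] at h
      exact absurd (f.injective h) (by simp)
    | inr z => exact ⟨z, rfl⟩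
  choose g hg using hright
  rintro (x | y)
  · exact hleft x
  · rw [hg, hb.eq_of_embedding g (fun u v h => Sum.inr_injective (f.injective (by rw [hg, hg, h])))
      (by
        intro u v
        have := f.map_adj_iff (v := .inr u) (w := .inr v)
        rw [hg, hg] at this
        simpa using this) (by
        intro v
        have := hf (.inr v)
        rwa [hg] at this)]

/-- The colorings `c₁` and `c₂` are not carried to each other by an automorphism. -/
def NotEquivalent (c₁ c₂ : X.Coloring α) : Prop := ∀ φ : X ≃g X, ∃ x, c₂ (φ x) ≠ c₁ x

/-- Two inequivalent colorings of the connected graph `X`, and a coloring of `Y ∪ Y`, give a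
coloring of two copies of `X ∪ Y`. -/
theorem chiD_sum_self_le [Finite V] [Finite W] {k : ℕ} (hX : X.Connected)
    {c₁ c₂ : X.Coloring (Fin k)} (h₁ : IsDistinguishing c₁) (h₂ : IsDistinguishing c₂)
    (hne : NotEquivalent c₁ c₂) (hY : chiD (Y ⊕g Y) ≤ k)
    (hXY : ∀ g : X →g (Y ⊕g Y), ¬Function.Injective g) :
    chiD ((X ⊕g Y) ⊕g (X ⊕g Y)) ≤ k := by
  obtain ⟨b, hb⟩ := exists_coloring_of_chiD_le hY
  obtain ⟨c, hc, hcl, hcr⟩ := h₂.sum hb hX fun g hg => absurd hg (hXY g)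
  obtain ⟨c', hc', -, -⟩ := h₁.sum hc hX (by
    intro g hg
    rcases hom_sum_cases hX g with ⟨g', hg'⟩ | ⟨g', hg'⟩
    swap
    · exact absurd (fun u v h => hg (by rw [hg', hg', h])) (hXY g')
    have hinj : Function.Injective g' := fun u v h => hg (by rw [hg', hg', h])
    -- an injective endomorphism of a finite graph is an automorphism
    have hadj : ∀ u v, X.Adj (g' u) (g' v) ↔ X.Adj u v := by
      classical
      intro u v
      refine ⟨fun h => ?_, fun h => g'.map_adj h⟩
      -- it permutes the finitely many ordered pairs of adjacent vertices
      have hm : Function.Injective (fun p : {p : V × V // X.Adj p.1 p.2} =>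
          (⟨(g' p.1.1, g' p.1.2), g'.map_adj p.2⟩ : {p : V × V // X.Adj p.1 p.2})) := by
        rintro ⟨⟨a, b⟩, h1⟩ ⟨⟨a', b'⟩, h2⟩ h3
        simp only [Subtype.mk.injEq, Prod.mk.injEq] at h3 ⊢
        exact ⟨hinj h3.1, hinj h3.2⟩
      obtain ⟨⟨⟨a, b⟩, hab⟩, h1⟩ := (Finite.injective_iff_surjective.1 hm) ⟨(g' u, g' v), h⟩
      simp only [Subtype.mk.injEq, Prod.mk.injEq] at h1
      rwa [hinj h1.1, hinj h1.2] at hab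
    obtain ⟨x, hx⟩ := hne ⟨Equiv.ofBijective g' (Finite.injective_iff_bijective.1 hinj), by
      intro u v
      simpa using hadj u v⟩
    refine ⟨x, ?_⟩
    rw [hg', hcl]
    exact hx)
  refine (chiD_congr ?_).trans_le (chiD_le_of_coloring hc')
  refine ⟨⟨(Equiv.sumSumSumComm V W V W).trans (Equiv.sumAssoc V V (W ⊕ W)), ?_⟩⟩
  rintro ((u | u) | (u | u)) ((v | v) | (v | v)) <;> simp

/-- This allows connected graphs to be treated as `X ∪ Y` with `Y` empty. -/
theorem isom_sum_empty : A ≅g A ⊕g E 0 :=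
  Isom.symm ⟨⟨Equiv.sumEmpty V (Fin 0), by
    rintro (u | u) (v | v)
    · simp
    · exact v.elim0
    · exact u.elim0
    · exact u.elim0⟩⟩

/-- Exchanging two colors that are used a different number of times gives an inequivalent
coloring. -/
theorem exists_notEquivalent [Fintype V] {k : ℕ} {c : X.Coloring (Fin k)} (hc : IsDistinguishing c)
    {i j : Fin k} (hij : (Finset.univ.filter fun v => c v = i).card ≠
      (Finset.univ.filter fun v => c v = j).card) :
    ∃ c' : X.Coloring (Fin k), IsDistinguishing c' ∧ NotEquivalent c c' := by
  obtain ⟨c', hc', h⟩ := hc.comp_injective (Equiv.swap i j).injective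
  refine ⟨c', hc', fun φ => ?_⟩
  by_contra! hφ
  refine hij (Finset.card_equiv φ.toEquiv fun v => ?_)
  have := hφ v
  rw [h] at this
  simp only [Finset.mem_filter, Finset.mem_univ, true_and, ← this]
  change _ ↔ c (φ v) = j
  rw [Equiv.swap_apply_eq_iff, Equiv.swap_apply_left]

/-- Unless the number of colors divides the order, there are two inequivalent colorings. -/
theorem exists_notEquivalent_of_not_dvd [Fintype V] {k : ℕ} (hk : chiD X ≤ k)
    (hdvd : ¬k ∣ Fintype.card V) :
    ∃ c c' : X.Coloring (Fin k), IsDistinguishing c ∧ IsDistinguishing c' ∧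
      NotEquivalent c c' := by
  obtain ⟨c, hc⟩ := exists_coloring_of_chiD_le hk
  by_cases h : ∃ i j, (Finset.univ.filter fun v => c v = i).card ≠
      (Finset.univ.filter fun v => c v = j).card
  · obtain ⟨i, j, hij⟩ := h
    obtain ⟨c', hc', hne⟩ := exists_notEquivalent hc hij
    exact ⟨c, c', hc, hc', hne⟩
  · push Not at h
    refine absurd ?_ hdvd
    have hsum : Fintype.card V = ∑ i : Fin k, (Finset.univ.filter fun v => c v = i).card := by
      rw [← Finset.card_univ]
      exact Finset.card_eq_sum_card_fiberwise fun v _ => Finset.mem_univ _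
    rcases Nat.eq_zero_or_pos k with rfl | hk0
    · simp [hsum]
    · rw [hsum, Finset.sum_congr rfl fun i _ => h i ⟨0, hk0⟩]
      simp

/-- A connected graph which is not complete has two inequivalent colorings with a color for each
vertex: exchange the colors of two vertices that are not twins. -/
theorem exists_notEquivalent_of_ne_top [Fintype V] (hX : X.Connected) (htop : X ≠ ⊤) :
    ∃ c c' : X.Coloring (Fin (Fintype.card V)), IsDistinguishing c ∧ IsDistinguishing c' ∧
      NotEquivalent c c' := by
  classical
  obtain ⟨a, b, hab, hnab⟩ : ∃ a b, a ≠ b ∧ ¬X.Adj a b := by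
    by_contra! h
    exact htop (by ext u v; exact ⟨fun h => h.ne, h u v⟩)
  have : Nontrivial V := ⟨a, b, hab⟩
  obtain ⟨d, hd⟩ := hX.preconnected.exists_adj_of_nontrivial a
  let e := Fintype.equivFin V
  have mk : ∀ g : V ≃ Fin (Fintype.card V), ∃ c : X.Coloring (Fin (Fintype.card V)),
      IsDistinguishing c ∧ ∀ v, c v = g v := fun g =>
    ⟨Coloring.mk g fun h h' => h.ne (g.injective h'), fun f hf v => g.injective (hf v),
      fun _ => rfl⟩
  obtain ⟨c, hc, hce⟩ := mk e
  obtain ⟨c', hc', hce'⟩ := mk ((Equiv.swap b d).trans e)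
  refine ⟨c, c', hc, hc', fun φ => ?_⟩
  by_contra! hφ
  have hφ' : ∀ x, φ x = Equiv.swap b d x := by
    intro x
    have := hφ x
    rw [hce, hce'] at this
    have h1 : Equiv.swap b d (φ x) = x := e.injective this
    rw [← h1, Equiv.swap_apply_self, h1]
  have h1 : X.Adj (φ a) (φ b) ↔ X.Adj a b := φ.map_adj_iff
  rw [hφ', hφ', Equiv.swap_apply_left, Equiv.swap_apply_of_ne_of_ne hab hd.ne] at h1
  exact hnab (h1.1 hd)

/-- A graph is connected if all vertices are at distance at most two from some vertex. -/
theorem connected_of_hub (a : V) (h : ∀ v, v = a ∨ X.Adj a v ∨ ∃ w, X.Adj a w ∧ X.Adj w v) :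
    X.Connected := by
  have hr : ∀ v, X.Reachable a v := by
    intro v
    rcases h v with rfl | h | ⟨w, h1, h2⟩
    · rfl
    · exact h.reachable
    · exact h1.reachable.trans h2.reachable
  have : Nonempty V := ⟨a⟩
  exact ⟨fun u v => (hr u).symm.trans (hr v)⟩

theorem connected_join [Nonempty V] [Nonempty W] : (A ∨g B).Connected := by
  obtain ⟨a⟩ := ‹Nonempty V›
  obtain ⟨b⟩ := ‹Nonempty W›
  refine connected_of_hub (.inl a) ?_
  rintro (v | v)
  · exact Or.inr (Or.inr ⟨.inr b, by simp, by simp⟩)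
  · exact Or.inr (Or.inl (by simp))

theorem chiD_sum_self_le_of_connected [Fintype V] {k : ℕ} (hX : X.Connected) (hk : chiD X ≤ k)
    (hdvd : ¬k ∣ Fintype.card V) : chiD (X ⊕g X) ≤ k := by
  obtain ⟨c, c', hc, hc', hne⟩ := exists_notEquivalent_of_not_dvd hk hdvd
  rw [chiD_congr (isom_sum_empty.sum isom_sum_empty)]
  have h0 : chiD (E 0 ⊕g E 0) ≤ k := by
    refine chiD_le_of_coloring (c := Coloring.mk (fun v => v.elim Fin.elim0 Fin.elim0) ?_)
      fun f hf v => ?_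
    · rintro (v | v) <;> exact v.elim0
    · rcases v with v | v <;> exact v.elim0
  refine chiD_sum_self_le hX hc hc' hne h0 fun g => ?_
  obtain ⟨x⟩ := hX.nonempty
  rcases g x with v | v <;> exact v.elim0

/-- For a connected graph of order `n ≥ 5` with `χ_D = n - 2`, the color classes cannot all have
the same size, so that a second copy needs no further color. -/
theorem chiD_sum_self_of_connected [Fintype V] (hX : X.Connected) (hn : 5 ≤ Fintype.card V)
    (hchi : chiD X = Fintype.card V - 2) : chiD (X ⊕g X) = chiD X := by
  refine le_antisymm (chiD_sum_self_le_of_connected hX le_rfl ?_) chiD_le_chiD_sum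
  rw [hchi]
  rintro ⟨m, hm⟩
  obtain ⟨n, hn'⟩ : ∃ n, Fintype.card V = n + 2 := ⟨Fintype.card V - 2, by omega⟩
  rw [hn'] at hm hn
  simp only [Nat.add_sub_cancel] at hm
  rcases m with _ | _ | m
  · omega
  · omega
  · nlinarith

end Sum
/-! ### Two copies of a graph: values -/

section Values

variable {V W U : Type*} {G : SimpleGraph U} {X : SimpleGraph V} {Y : SimpleGraph W} {α : Type*}

theorem chiD_le_card_vertices [Fintype V] : chiD X ≤ Fintype.card V := by
  obtain ⟨c, hc⟩ := exists_isDistinguishing_of_injective (G := X) (Function.injective_id)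
  exact chiD_le_card hc

theorem chiD_sum_self_le_card [Fintype V] : chiD (X ⊕g X) ≤ 2 * Fintype.card V := by
  have := chiD_le_card_vertices (X := X ⊕g X)
  rw [Fintype.card_sum] at this
  omega

theorem Isom.chiD_sum_self [Finite U] [Finite V] {H : SimpleGraph V} (h : G ≅g H) :
    chiD (G ⊕g G) = chiD (H ⊕g H) := chiD_congr (h.sum h)

theorem not_injective_of_edgeless {a b : V} (hab : X.Adj a b) (hY : ∀ u v, ¬Y.Adj u v)
    (g : X →g (Y ⊕g Y)) : ¬Function.Injective g := by
  intro _
  have := g.map_adj hab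
  revert this
  rcases g a with u | u <;> rcases g b with v | v <;> simp [hY]

theorem not_injective_of_card_lt [Fintype V] [Fintype W] (hX : X.Connected)
    (h : Fintype.card W < Fintype.card V) (g : X →g (Y ⊕g Y)) : ¬Function.Injective g := by
  intro hg
  rcases hom_sum_cases hX g with ⟨g', hg'⟩ | ⟨g', hg'⟩
  all_goals
    have hinj : Function.Injective g' := fun u v h => hg (by rw [hg', hg', h])
    have := Fintype.card_le_of_injective g' hinj
    omega

/-- With more colors than vertices of `X`, the two copies of `X` can use different colors. -/
theorem chiD_sum_self_le_of_card_lt [Fintype V] [Finite W] {k : ℕ} (hX : X.Connected)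
    (hk : Fintype.card V < k) (hY : chiD (Y ⊕g Y) ≤ k)
    (hXY : ∀ g : X →g (Y ⊕g Y), ¬Function.Injective g) : chiD ((X ⊕g Y) ⊕g (X ⊕g Y)) ≤ k := by
  obtain ⟨x⟩ := hX.nonempty
  obtain ⟨n, rfl⟩ : ∃ n, k = n + 1 := ⟨k - 1, by omega⟩
  have hcard : Fintype.card V ≤ n := by omega
  let e := Fintype.equivFin V
  have mk : ∀ g : V → Fin (n + 1), Function.Injective g → ∃ c : X.Coloring (Fin (n + 1)),
      IsDistinguishing c ∧ ∀ v, c v = g v := fun g hg =>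
    ⟨Coloring.mk g fun h h' => h.ne (hg h'), fun f hf v => hg (hf v), fun _ => rfl⟩
  obtain ⟨c, hc, h1⟩ := mk (fun v => (Fin.castLE hcard (e v)).castSucc)
    ((Fin.castSucc_injective n).comp ((Fin.castLE_injective hcard).comp e.injective))
  obtain ⟨c', hc', h2⟩ := mk (fun v => (Fin.castLE hcard (e v)).succ)
    ((Fin.succ_injective n).comp ((Fin.castLE_injective hcard).comp e.injective))
  refine chiD_sum_self_le hX hc hc' (fun φ => ?_) hY hXY
  have hpos : 0 < Fintype.card V := Fintype.card_pos_iff.2 ⟨x⟩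
  refine ⟨e.symm ⟨0, hpos⟩, ?_⟩
  rw [h1, h2, Equiv.apply_symm_apply]
  intro h
  have := congrArg Fin.val h
  simp at this

/-- If `X` is connected and not complete, and `X ∪ Y` needs a color for each vertex of `X`, then the
second copy of `X` can be colored by a permutation of the colors. -/
theorem chiD_sum_self_of_ne_top [Fintype V] [Finite W] (hX : X.Connected) (htop : X ≠ ⊤)
    (hchi : chiD (X ⊕g Y) = Fintype.card V) (hY : chiD (Y ⊕g Y) ≤ Fintype.card V)
    (hXY : ∀ g : X →g (Y ⊕g Y), ¬Function.Injective g) :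
    chiD ((X ⊕g Y) ⊕g (X ⊕g Y)) = chiD (X ⊕g Y) := by
  refine le_antisymm ?_ chiD_le_chiD_sum
  obtain ⟨c, c', hc, hc', hne⟩ := exists_notEquivalent_of_ne_top hX htop
  rw [hchi]
  exact chiD_sum_self_le hX hc hc' hne hY hXY

/-- If `Y` is a single vertex and `X ∪ Y` needs one color less than `X` has vertices, the color
classes in `X` cannot all have the same size. -/
theorem chiD_sum_self_of_isolated [Fintype V] [Fintype W] (hX : X.Connected)
    (hV : 3 ≤ Fintype.card V) (hW : Fintype.card W = 1)
    (hchi : chiD (X ⊕g Y) = Fintype.card V - 1) :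
    chiD ((X ⊕g Y) ⊕g (X ⊕g Y)) = chiD (X ⊕g Y) := by
  refine le_antisymm ?_ chiD_le_chiD_sum
  obtain ⟨c, c', hc, hc', hne⟩ := exists_notEquivalent_of_not_dvd
    (X := X) (k := chiD (X ⊕g Y)) chiD_le_chiD_sum (by
      obtain ⟨k, hk⟩ : ∃ k, Fintype.card V = k + 1 := ⟨Fintype.card V - 1, by omega⟩
      rw [hchi, hk, Nat.add_sub_cancel]
      intro h
      have := (Nat.dvd_add_right (dvd_refl k)).1 h
      have := Nat.dvd_one.1 this
      omega)
  refine chiD_sum_self_le hX hc hc' hne ?_ (not_injective_of_card_lt hX (by omega))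
  have := chiD_sum_self_le_card (X := Y)
  omega

theorem connected_top [Nonempty V] : (⊤ : SimpleGraph V).Connected :=
  connected_of_hub (Classical.arbitrary V) fun v => by
    by_cases h : v = Classical.arbitrary V
    · exact Or.inl h
    · exact Or.inr (Or.inl (by simpa using Ne.symm h))

/-- Two copies of `K_m` need more than `m` colors, as otherwise matching the colors exchanges the
copies. -/
theorem lt_chiD_sum_complete (m : ℕ) (hm : 1 ≤ m) : m < chiD (K m ⊕g K m) := by
  by_contra! hle
  obtain ⟨c, hc⟩ := exists_coloring_of_chiD_le hle
  have hl : Function.Injective fun i => c (.inl i) := by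
    intro i j h
    by_contra hij
    exact c.valid (v := .inl i) (w := .inl j) (by simpa using hij) h
  have hr : Function.Injective fun i => c (.inr i) := by
    intro i j h
    by_contra hij
    exact c.valid (v := .inr i) (w := .inr j) (by simpa using hij) h
  let a := Equiv.ofBijective _ (Finite.injective_iff_bijective.1 hl)
  let b := Equiv.ofBijective _ (Finite.injective_iff_bijective.1 hr)
  have ha : ∀ i, a i = c (.inl i) := fun _ => rfl
  have hb : ∀ i, b i = c (.inr i) := fun _ => rfl
  have := hc ⟨(Equiv.sumCongr (a.trans b.symm) (b.trans a.symm)).trans (Equiv.sumComm _ _), by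
    rintro (u | u) (v | v) <;> simp⟩ (by
      rintro (u | u)
      · change c (.inr (b.symm (a u))) = _
        rw [← hb, Equiv.apply_symm_apply, ha]
      · change c (.inl (a.symm (b u))) = _
        rw [← ha, Equiv.apply_symm_apply, hb]) (.inl ⟨0, hm⟩)
  simp at this

/-- Isolated vertices have distinct colors. -/
theorem card_le_chiD_of_isolated [Finite V] {m : ℕ} (e : Fin m → V) (he : Function.Injective e)
    (hiso : ∀ i w, ¬X.Adj w (e i)) : m ≤ chiD X := by
  obtain ⟨c, hc⟩ := exists_coloring_of_chiD_le (le_refl (chiD X))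
  have : Function.Injective fun i => c (e i) := by
    intro i j h
    by_contra hij
    obtain ⟨w, hw⟩ := hc.exists_separating (he.ne hij) h
    exact hw (by simp [hiso])
  simpa using Fintype.card_le_of_injective _ this

/-- The isolated vertices of both copies have distinct colors. -/
theorem two_mul_le_chiD_sum_self [Finite V] {m : ℕ} :
    2 * m ≤ chiD ((X ⊕g E m) ⊕g (X ⊕g E m)) := by
  refine card_le_chiD_of_isolated
    (fun i : Fin (2 * m) => Sum.map (Sum.inr : Fin m → V ⊕ Fin m) (Sum.inr : Fin m → V ⊕ Fin m)
      (finSumFinEquiv.symm (i.cast (two_mul m)))) ?_ ?_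
  · exact (Function.Injective.sumMap Sum.inr_injective Sum.inr_injective).comp
      (finSumFinEquiv.symm.injective.comp (Fin.cast_injective _))
  · intro i w
    generalize finSumFinEquiv.symm (i.cast (two_mul m)) = j
    rcases w with (w | w) | (w | w) <;> rcases j with j | j <;> simp

theorem chiD_complete_sum_two {m : ℕ} (hm : 3 ≤ m) :
    chiD ((K m ⊕g K 2) ⊕g (K m ⊕g K 2)) = m + 1 := by
  have : Nonempty (Fin m) := ⟨⟨0, by omega⟩⟩
  refine le_antisymm (chiD_sum_self_le_of_card_lt connected_top (by simp) ?_
    (not_injective_of_card_lt connected_top (by simp only [Fintype.card_fin]; omega))) ?_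
  · have := chiD_sum_self_le_card (X := K 2)
    simp only [Fintype.card_fin] at this
    omega
  · refine (lt_chiD_sum_complete m (by omega)).trans_le ?_
    have h1 : chiD (K m ⊕g K m) ≤ chiD ((K m ⊕g K m) ⊕g (K 2 ⊕g K 2)) := chiD_le_chiD_sum
    refine h1.trans_eq (chiD_congr ⟨⟨Equiv.sumSumSumComm _ _ _ _, ?_⟩⟩)
    rintro ((u | u) | (u | u)) ((v | v) | (v | v)) <;> simp

theorem chiD_complete_sum_edgeless {m : ℕ} (hm : 3 ≤ m) :
    chiD ((K m ⊕g E 2) ⊕g (K m ⊕g E 2)) = m + 1 := by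
  have : Nonempty (Fin m) := ⟨⟨0, by omega⟩⟩
  refine le_antisymm (chiD_sum_self_le_of_card_lt connected_top (by simp) ?_
    (not_injective_of_card_lt connected_top (by simp only [Fintype.card_fin]; omega))) ?_
  · have := chiD_sum_self_le_card (X := E 2)
    simp only [Fintype.card_fin] at this
    omega
  · refine (lt_chiD_sum_complete m (by omega)).trans_le ?_
    have h1 : chiD (K m ⊕g K m) ≤ chiD ((K m ⊕g K m) ⊕g (E 2 ⊕g E 2)) := chiD_le_chiD_sum
    refine h1.trans_eq (chiD_congr ⟨⟨Equiv.sumSumSumComm _ _ _ _, ?_⟩⟩)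
    rintro ((u | u) | (u | u)) ((v | v) | (v | v)) <;> simp

theorem chiD_path_sum_edgeless :
    chiD ((pathGraph 3 ⊕g E 2) ⊕g (pathGraph 3 ⊕g E 2)) = 4 := by
  have hc : (pathGraph 3).Connected := pathGraph_connected 2
  refine le_antisymm (chiD_sum_self_le_of_card_lt hc (by simp)
    chiD_sum_self_le_card (not_injective_of_card_lt hc (by simp)))
    (two_mul_le_chiD_sum_self (m := 2))

theorem chiD_edgeless_sum {r : ℕ} (hr : 2 ≤ r) :
    chiD ((E r ⊕g K 2) ⊕g (E r ⊕g K 2)) = 2 * r := by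
  have hcomm : E r ⊕g K 2 ≅g K 2 ⊕g E r := ⟨Iso.sumComm⟩
  rw [hcomm.chiD_sum_self]
  refine le_antisymm (chiD_sum_self_le_of_card_lt connected_top (by simp; omega) ?_
    (not_injective_of_edgeless (a := 0) (b := 1) (by simp) (by simp))) two_mul_le_chiD_sum_self
  simpa using chiD_sum_self_le_card (X := E r)

/-- A coloring is distinguishing if vertices of the same color see different sets of colors. -/
theorem isDistinguishing_of_neighbor_colors {c : X.Coloring α} (h : ∀ u v, u ≠ v → c u = c v →
    (∃ w, X.Adj u w ∧ ∀ w', X.Adj v w' → c w' ≠ c w) ∨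
      ∃ w, X.Adj v w ∧ ∀ w', X.Adj u w' → c w' ≠ c w) : IsDistinguishing c := by
  intro f hf v
  by_contra hne
  rcases h _ _ hne (hf v) with ⟨w, h1, h2⟩ | ⟨w, h1, h2⟩
  · refine h2 (f.symm w) (f.map_adj_iff.1 (by simpa using h1)) ?_
    rw [← hf (f.symm w), f.apply_symm_apply]
  · exact h2 (f w) (f.map_adj_iff.2 h1) (hf w)

/-- Four isolated edges need four colors: three colors have only three pairs, so two of the edges
would carry the same two colors. -/
theorem four_le_chiD_of_four_edges [Finite V] (a b : Fin 4 → V)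
    (hinj : ∀ i j, i ≠ j → [a i, b i, a j, b j].Nodup) (hab : ∀ i, X.Adj (a i) (b i))
    (hout : ∀ i w, (w ≠ b i → ¬X.Adj w (a i)) ∧ (w ≠ a i → ¬X.Adj w (b i))) : 4 ≤ chiD X := by
  by_contra! hlt
  obtain ⟨c, hc⟩ := exists_coloring_of_chiD_le (Nat.le_of_lt_succ hlt)
  -- an edge determines the color missing on it, and conversely
  have hthird : ∀ i, ∃ k : Fin 3, k ≠ c (a i) ∧ k ≠ c (b i) := by
    intro i
    generalize c (a i) = x
    generalize c (b i) = y
    revert x y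
    decide
  choose k hk using hthird
  obtain ⟨i, j, hij, hkij⟩ := Fintype.exists_ne_map_eq_of_card_lt k (by simp)
  have hi := c.valid (hab i)
  have hj := c.valid (hab j)
  have hki := hk i
  have hkj := hk j
  rw [← hkij] at hkj
  have hmatch : (c (a i) = c (a j) ∧ c (b i) = c (b j)) ∨
      (c (a i) = c (b j) ∧ c (b i) = c (a j)) := by
    generalize c (a i) = x at *
    generalize c (b i) = y at *
    generalize c (a j) = z at *
    generalize c (b j) = w at *
    generalize k i = t at *
    clear * - hi hj hki hkj
    omega
  have hnd := hinj i j hij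
  simp only [List.nodup_cons, List.mem_cons, List.not_mem_nil, or_false, not_or,
    List.nodup_nil, not_false_eq_true, and_true] at hnd
  obtain ⟨⟨n1, n2, n3⟩, ⟨n4, n5⟩, n6⟩ := hnd
  have e : ∀ w, w ≠ a i → w ≠ b i → w ≠ a j → w ≠ b j → ¬X.Adj w (a i) ∧ ¬X.Adj w (b i) ∧
      ¬X.Adj w (a j) ∧ ¬X.Adj w (b j) := fun w h1 h2 h3 h4 =>
    ⟨(hout i w).1 h2, (hout i w).2 h1, (hout j w).1 h4, (hout j w).2 h3⟩
  rcases hmatch with ⟨h1, h2⟩ | ⟨h1, h2⟩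
  · refine not_isDistinguishing_of_exchange (hinj i j hij) (hab i) (hab j)
      ((hout j _).2 n2) ((hout j _).1 n5) (fun w hw => ?_) h1 h2 hc
    simp only [List.mem_cons, List.not_mem_nil, or_false, not_or] at hw
    simp [e w hw.1 hw.2.1 hw.2.2.1 hw.2.2.2]
  · refine not_isDistinguishing_of_exchange (a := a i) (b := b i) (p := b j) (q := a j) ?_ (hab i)
      (hab j).symm ((hout j _).1 n3) ((hout j _).2 n4) (fun w hw => ?_) h1 h2 hc
    · simp [n1, n2, n3, n4, n5, Ne.symm n6]
    simp only [List.mem_cons, List.not_mem_nil, or_false, not_or] at hw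
    simp [e w hw.1 hw.2.1 hw.2.2.2 hw.2.2.1]

instance [DecidableRel X.Adj] [DecidableRel Y.Adj] : DecidableRel (X ⊕g Y).Adj
  | .inl u, .inl v => decidable_of_iff (X.Adj u v) (by simp)
  | .inr u, .inr v => decidable_of_iff (Y.Adj u v) (by simp)
  | .inl _, .inr _ => isFalse (by simp)
  | .inr _, .inl _ => isFalse (by simp)

set_option maxRecDepth 100000 in
set_option synthInstance.maxSize 1000 in
set_option synthInstance.maxHeartbeats 400000 in
theorem chiD_two_edges_sum_one :
    chiD (((K 2 ⊕g K 2) ⊕g K 1) ⊕g ((K 2 ⊕g K 2) ⊕g K 1)) = 4 := by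
  refine le_antisymm ?_ ?_
  · refine chiD_le_of_coloring (c := Coloring.mk (Sum.elim
      (Sum.elim (Sum.elim ![0, 1] ![0, 2]) ![0]) (Sum.elim (Sum.elim ![0, 3] ![1, 2]) ![1])) ?_)
      (isDistinguishing_of_neighbor_colors ?_)
    · decide +kernel
    · decide +kernel
  · refine four_le_chiD_of_four_edges
      ![.inl (.inl (.inl 0)), .inl (.inl (.inr 0)), .inr (.inl (.inl 0)), .inr (.inl (.inr 0))]
      ![.inl (.inl (.inl 1)), .inl (.inl (.inr 1)), .inr (.inl (.inl 1)), .inr (.inl (.inr 1))]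
      ?_ ?_ ?_
    · decide +kernel
    · decide +kernel
    · decide +kernel

set_option maxRecDepth 100000 in
set_option synthInstance.maxSize 1000 in
set_option synthInstance.maxHeartbeats 400000 in
/-- Each of the four triangles misses a different color. -/
theorem chiD_triangles_sum :
    chiD ((K 3 ⊕g K 3) ⊕g (K 3 ⊕g K 3)) ≤ 4 := by
  refine chiD_le_of_coloring (c := Coloring.mk (Sum.elim
      (Sum.elim ![0, 1, 2] ![0, 1, 3]) (Sum.elim ![0, 2, 3] ![1, 2, 3])) ?_)
      (isDistinguishing_of_neighbor_colors ?_)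
  · decide +kernel
  · decide +kernel

/-- With two colors, two copies of `P₄` are colored alternately and can be exchanged. -/
theorem chiD_path_sum (h : chiD (pathGraph 4) ≤ 3) :
    chiD (pathGraph 4 ⊕g pathGraph 4) = 3 := by
  refine le_antisymm (chiD_sum_self_le_of_connected (pathGraph_connected 3) h (by simp)) ?_
  by_contra! hlt
  obtain ⟨c, hc⟩ := exists_coloring_of_chiD_le (k := 2) (Nat.le_of_lt_succ hlt)
  have hl : ∀ i j : Fin 4, i.val + 1 = j.val → c (.inl i) ≠ c (.inl j) := fun i j h =>
    c.valid (by simp [pathGraph_adj, h])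
  have hr : ∀ i j : Fin 4, i.val + 1 = j.val → c (.inr i) ≠ c (.inr j) := fun i j h =>
    c.valid (by simp [pathGraph_adj, h])
  have l0 := hl 0 1 rfl
  have l1 := hl 1 2 rfl
  have l2 := hl 2 3 rfl
  have r0 := hr 0 1 rfl
  have r1 := hr 1 2 rfl
  have r2 := hr 2 3 rfl
  -- the copies are exchanged, reversing them if their colorings do not agree
  by_cases h0 : c (.inl 0) = c (.inr 0)
  · have := hc Iso.sumComm (by
      simp only [Sum.forall, Fin.forall_fin_succ]
      simp
      omega) (.inl 0)
    simp at this
  · have := hc ⟨(Equiv.sumCongr Fin.revPerm Fin.revPerm).trans (Equiv.sumComm _ _), by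
      simp +decide [Sum.forall, Fin.forall_fin_succ, pathGraph_adj]⟩ (by
      simp only [Sum.forall, Fin.forall_fin_succ]
      simp +decide
      omega) (.inl 0)
    simp at this

end Values
/-! ### Two copies of the graphs in the families -/

section Families

variable {V W U : Type*} {G : SimpleGraph V} {X : SimpleGraph W} {Y : SimpleGraph U}

instance (M : CMGraph) : Nonempty (Fin M.order) := ⟨⟨0, M.order_pos⟩⟩

theorem card_subst {n : ℕ} (M : Fin n → CMGraph) :
    Fintype.card (Σ i, Fin (M i).order) = ∑ i, (M i).order := by
  simp

/-- A substitution is connected if each vertex of `Γ`, including `a`, is reached from `a` by a walk of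
length two, or of length one for vertices other than `a`. -/
theorem connected_subst {n : ℕ} {Γ : SimpleGraph (Fin n)} (M : Fin n → CMGraph) (a : Fin n)
    (h : ∀ i, (i ≠ a ∧ Γ.Adj a i) ∨ ∃ b, Γ.Adj a b ∧ Γ.Adj b i) : (subst Γ M).Connected := by
  refine connected_of_hub ⟨a, ⟨0, (M a).order_pos⟩⟩ ?_
  rintro ⟨i, v⟩
  rcases h i with ⟨-, h⟩ | ⟨b, h1, h2⟩
  · exact Or.inr (Or.inl (Or.inl h))
  · exact Or.inr (Or.inr ⟨⟨b, ⟨0, (M b).order_pos⟩⟩, Or.inl h1, Or.inl h2⟩)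

theorem chiD_sum_self_of_isom_connected [Fintype V] [Fintype W] (h : G ≅g X) (hX : X.Connected)
    (hn : 5 ≤ Fintype.card W) (hG : chiD G = Fintype.card V - 2) : chiD (G ⊕g G) = chiD G := by
  have hc : Fintype.card V = Fintype.card W := h.elim fun e => Fintype.card_congr e.toEquiv
  rw [h.chiD_sum_self, chiD_congr h]
  exact chiD_sum_self_of_connected hX hn (by rw [← chiD_congr h, hG, hc])

theorem chiD_sum_self_of_isom_ne_top [Fintype V] [Fintype W] [Fintype U] (h : G ≅g X ⊕g Y)
    (hX : X.Connected) (htop : X ≠ ⊤) (hU : Fintype.card U = 2)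
    (hG : chiD G = Fintype.card V - 2) (hY : chiD (Y ⊕g Y) ≤ Fintype.card W)
    (hXY : ∀ g : X →g (Y ⊕g Y), ¬Function.Injective g) : chiD (G ⊕g G) = chiD G := by
  have hc : Fintype.card V = Fintype.card W + Fintype.card U := by
    rw [← Fintype.card_sum]
    exact h.elim fun e => Fintype.card_congr e.toEquiv
  rw [h.chiD_sum_self, chiD_congr h]
  refine chiD_sum_self_of_ne_top hX htop ?_ hY hXY
  rw [← chiD_congr h, hG]
  omega

theorem chiD_sum_self_of_isom_isolated [Fintype V] [Fintype W] [Fintype U] (h : G ≅g X ⊕g Y)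
    (hX : X.Connected) (hU : Fintype.card U = 1) (hn : 4 ≤ Fintype.card V)
    (hG : chiD G = Fintype.card V - 2) : chiD (G ⊕g G) = chiD G := by
  have hc : Fintype.card V = Fintype.card W + Fintype.card U := by
    rw [← Fintype.card_sum]
    exact h.elim fun e => Fintype.card_congr e.toEquiv
  rw [h.chiD_sum_self, chiD_congr h]
  refine chiD_sum_self_of_isolated hX (by omega) hU ?_
  rw [← chiD_congr h, hG]
  omega

theorem isom_K_one {M : CMGraph} (h : M.order = 1) : M.graph ≅g K 1 := by
  obtain ⟨n, hn, Γ, hΓ⟩ := M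
  obtain rfl : n = 1 := h
  exact ⟨⟨Equiv.refl _, by
    intro u v
    simp [Subsingleton.elim u v]⟩⟩

theorem three_le_of_not_isom_one {M₁ M₂ : CMGraph}
    (h : ¬(M₁.graph ≅g K 1) ∨ ¬(M₂.graph ≅g K 1)) : 3 ≤ M₁.order + M₂.order := by
  have h1 := M₁.order_pos
  have h2 := M₂.order_pos
  have h3 := mt (isom_K_one (M := M₁))
  have h4 := mt (isom_K_one (M := M₂))
  rcases h with h | h
  · have := h3 h
    omega
  · have := h4 h
    omega

theorem chiD_two_edges_le : chiD (K 2 ⊕g K 2) ≤ 3 := by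
  refine chiD_le_of_coloring (c := Coloring.mk (Sum.elim ![0, 1] ![0, 2]) ?_)
    (isDistinguishing_of_neighbor_colors ?_)
  · decide +kernel
  · decide +kernel

/-- The last vertex of the substitution into `G6` is isolated, and the others induce a connected
graph. -/
theorem chiD_sum_self_of_isom_subst_G6 [Fintype V] {M₁ M₂ M₃ : CMGraph}
    (h : G ≅g subst G6 ![.one, M₁, M₂, M₃, .one]) (hn : 4 ≤ Fintype.card V)
    (hG : chiD G = Fintype.card V - 2) : chiD (G ⊕g G) = chiD G := by
  classical
  set M : Fin 5 → CMGraph := ![.one, M₁, M₂, M₃, .one] with hM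
  have hiso : ∀ u ∈ {p : Σ i, Fin (M i).order | p.1 ≠ 4}, ∀ v ∉ {p : Σ i, Fin (M i).order | p.1 ≠ 4},
      ¬(subst G6 M).Adj u v := by
    rintro ⟨i, u⟩ hi ⟨j, v⟩ hj hadj
    replace hi : i ≠ 4 := hi
    replace hj : j = 4 := not_not.1 hj
    subst hj
    rcases hadj with h | ⟨k, a, b, h1, h2, -⟩
    · rw [G6_adj] at h
      simp at h
    · exact hi ((Sigma.mk.inj_iff.1 h1).1.trans (Sigma.mk.inj_iff.1 h2).1.symm)
  have z : ∀ i, Fin (M i).order := fun i => ⟨0, (M i).order_pos⟩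
  refine chiD_sum_self_of_isom_isolated (h.trans (isom_sum_of_not_adj hiso)) ?_ ?_ hn hG
  · refine connected_of_hub ⟨⟨1, z 1⟩, by simp⟩ ?_
    rintro ⟨⟨i, v⟩, hi⟩
    replace hi : i ≠ 4 := hi
    by_cases h1 : i = 1
    · subst h1
      exact Or.inr (Or.inr ⟨⟨⟨0, z 0⟩, by simp⟩, Or.inl (by simp [G6_adj]),
        Or.inl (by simp [G6_adj])⟩)
    · refine Or.inr (Or.inl (Or.inl ?_))
      fin_cases i <;> simp [G6_adj] at h1 hi ⊢
  · rw [Fintype.card_eq_one_iff]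
    refine ⟨⟨⟨4, z 4⟩, by simp⟩, ?_⟩
    rintro ⟨⟨i, v⟩, hi⟩
    obtain rfl : i = 4 := not_not.1 hi
    have : v = z 4 := Subsingleton.elim (α := Fin 1) _ _
    rw [this]

theorem EqualFamily.chiD_sum_self [Fintype V] (hn : 4 ≤ Fintype.card V)
    (hG : chiD G = Fintype.card V - 2) (hF : EqualFamily G) : chiD (G ⊕g G) = chiD G := by
  cases hF with
  | c1 h => exact chiD_sum_self_of_isom_connected h (pathGraph_connected 4) (by simp) hG
  | c2 h => exact chiD_sum_self_of_isom_connected h cycleGraph_connected (by simp) hG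
  | c3 h => exact chiD_sum_self_of_isom_connected h cycleGraph_connected (by simp) hG
  | c4 h =>
    refine le_antisymm ?_ chiD_le_chiD_sum
    have hc : Fintype.card V = 6 := by
      simpa using h.elim fun e => Fintype.card_congr e.toEquiv
    rw [h.chiD_sum_self, hG, hc]
    exact chiD_triangles_sum
  | c5 h => exact chiD_sum_self_of_isom_connected h connected_join (by simp) hG
  | c6 r hr H₁ h =>
    have : Nonempty (Fin r) := ⟨⟨0, by omega⟩⟩
    have hpos := H₁.order_pos
    refine chiD_sum_self_of_isom_ne_top h connected_join ?_ (by simp) hG ?_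
      (not_injective_of_card_lt connected_join ?_)
    · intro htop
      have : (E r ∨g H₁.graph).Adj (.inl ⟨0, by omega⟩) (.inl ⟨1, by omega⟩) := by
        rw [htop]
        simp
      simp at this
    · refine chiD_two_edges_le.trans ?_
      simp only [Fintype.card_sum, Fintype.card_fin]
      omega
    · simp only [Fintype.card_sum, Fintype.card_fin]
      omega
  | c7 H₁ h => exact chiD_sum_self_of_isom_isolated h connected_join (by simp) hn hG
  | c8 H₁ H₂ h =>
    have h1 := H₁.order_pos
    have h2 := H₂.order_pos
    refine chiD_sum_self_of_isom_connected h connected_join ?_ hG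
    simp only [Fintype.card_sum, Fintype.card_fin]
    omega
  | c9 H₁ H₂ H₃ H₄ h =>
    refine chiD_sum_self_of_isom_connected h (connected_subst _ 0 ?_) ?_ hG
    · simp only [G7_adj]
      decide
    · have h1 := H₁.order_pos
      have h2 := H₂.order_pos
      have h3 := H₃.order_pos
      have h4 := H₄.order_pos
      rw [card_subst]
      simp [Fin.sum_univ_succ, CMGraph.one]
      omega
  | c10 H₁ H₂ H₃ G3 hG3 h =>
    refine chiD_sum_self_of_isom_connected h (connected_subst _ 1 ?_) ?_ hG
    · rcases hG3 with rfl | rfl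
      · simp only [bull_adj]
        decide
      · simp only [house_adj]
        decide
    · have h1 := H₁.order_pos
      have h2 := H₂.order_pos
      have h3 := H₃.order_pos
      rw [card_subst]
      simp [Fin.sum_univ_succ, CMGraph.one]
      omega
  | c11 H₁ H₂ H₃ h => exact chiD_sum_self_of_isom_subst_G6 h hn hG
  | c12 H₁ H₂ H₃ hK h =>
    have h1 := H₁.order_pos
    have h2 := H₂.order_pos
    have h3 := H₃.order_pos
    refine chiD_sum_self_of_isom_ne_top h connected_join hK (by simp) hG ?_
      (not_injective_of_card_lt connected_join ?_)
    · refine chiD_two_edges_le.trans ?_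
      simp only [Fintype.card_sum, Fintype.card_fin]
      omega
    · simp only [Fintype.card_sum, Fintype.card_fin]
      omega
  | c13 H₁ H₂ hK h4 h =>
    refine chiD_sum_self_of_isom_ne_top h connected_join hK (by simp) hG ?_
      (not_injective_of_card_lt connected_join ?_)
    · refine chiD_sum_self_le_card.trans ?_
      simpa using h4
    · simp only [Fintype.card_sum, Fintype.card_fin]
      omega
  | c14 H₁ H₂ hne h =>
    have h1 := three_le_of_not_isom_one hne
    refine chiD_sum_self_of_isom_connected h (connected_subst _ 1 ?_) ?_ hG
    · simp only [G5_adj]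
      decide
    · rw [card_subst]
      simp [Fin.sum_univ_succ, CMGraph.one]
      omega
  | c15 H₁ H₂ hne h =>
    have h1 := three_le_of_not_isom_one hne
    refine chiD_sum_self_of_isom_connected h (connected_subst _ 1 ?_) ?_ hG
    · simp only [G5_adj]
      decide
    · rw [card_subst]
      simp [Fin.sum_univ_succ, CMGraph.one]
      omega

theorem BaseFamily.four_le_card [Fintype V] (hF : BaseFamily G) : 4 ≤ Fintype.card V := by
  have key : ∀ {W : Type} [Fintype W] {H : SimpleGraph W}, (G ≅g H) → 4 ≤ Fintype.card W →
      4 ≤ Fintype.card V := by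
    intro W _ H h hW
    rwa [h.elim fun e => Fintype.card_congr e.toEquiv]
  cases hF with
  | a h | b h | c h | d h | i h | k h => exact key h (by simp)
  | e r hr h => exact key h (by simpa using hr)
  | f r hr M h =>
    refine key h ?_
    have := M.order_pos
    simp only [Fintype.card_sum, Fintype.card_fin]
    omega
  | g M₁ M₂ M₃ h =>
    refine key h ?_
    have := M₁.order_pos
    have := M₂.order_pos
    simp only [Fintype.card_sum, Fintype.card_fin]
    omega
  | h M₁ M₂ h =>
    refine key h ?_
    have := M₁.order_pos
    have := M₂.order_pos
    simp only [Fintype.card_sum, Fintype.card_fin]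
    omega
  | j M₁ M₂ h =>
    refine key h ?_
    simp only [Fintype.card_sum, Fintype.card_fin]
    omega
  | l M h =>
    refine key h ?_
    simp only [Fintype.card_sum, Fintype.card_fin]
    omega
  | m M₁ M₂ M₃ _ _ h =>
    refine key h ?_
    have := M₁.order_pos
    have := M₂.order_pos
    have := M₃.order_pos
    rw [card_subst]
    simp [Fin.sum_univ_succ, CMGraph.one]
    omega
  | n M₁ M₂ h | o M₁ M₂ h =>
    refine key h ?_
    have := M₁.order_pos
    have := M₂.order_pos
    rw [card_subst]
    simp [Fin.sum_univ_succ, CMGraph.one]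
    omega
  | p M₁ M₂ M₃ h =>
    refine key h ?_
    have := M₁.order_pos
    have := M₂.order_pos
    have := M₃.order_pos
    rw [card_subst]
    simp [Fin.sum_univ_succ, CMGraph.one]
    omega
  | q M₁ M₂ M₃ M₄ h =>
    refine key h ?_
    have := M₁.order_pos
    have := M₂.order_pos
    have := M₃.order_pos
    have := M₄.order_pos
    rw [card_subst]
    simp [Fin.sum_univ_succ, CMGraph.one]
    omega

theorem BaseFamily.chiD_sum_self_of_join [Fintype V] {M : CMGraph} {k : ℕ}
    {F : SimpleGraph (Fin k)} (hF : BaseFamily F) (h : G ≅g M.graph ∨g F)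
    (hG : chiD G = Fintype.card V - 2) : chiD (G ⊕g G) = chiD G := by
  have h4 := hF.four_le_card
  rw [Fintype.card_fin] at h4
  have := M.order_pos
  have : Nonempty (Fin k) := ⟨⟨0, by omega⟩⟩
  refine chiD_sum_self_of_isom_connected h connected_join ?_ hG
  simp only [Fintype.card_sum, Fintype.card_fin]
  omega

theorem isom_subst_of_order_one {n : ℕ} {Γ : SimpleGraph (Fin n)} {M : Fin n → CMGraph}
    (h : ∀ i, (M i).order = 1) : subst Γ M ≅g Γ := by
  have hsub : ∀ i (a b : Fin (M i).order), a = b := by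
    intro i a b
    have h1 := a.2
    have h2 := b.2
    have h3 := h i
    exact Fin.ext (by omega)
  refine ⟨⟨Equiv.ofBijective Sigma.fst ⟨?_, fun i => ⟨⟨i, ⟨0, (M i).order_pos⟩⟩, rfl⟩⟩, ?_⟩⟩
  · rintro ⟨i, a⟩ ⟨j, b⟩ hij
    obtain rfl : i = j := hij
    rw [hsub i a b]
  · intro p q
    refine ⟨Or.inl, ?_⟩
    rintro (h | ⟨i, a, b, -, -, hab⟩)
    · exact h
    · exact absurd (hsub i a b) hab.ne

theorem G5_eq_pathGraph : G5 = pathGraph 4 := by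
  ext i j
  rw [G5_adj, pathGraph_adj]
  revert i j
  decide

/-- A connected graph of order at most three is complete or a path. -/
theorem isom_path_three [Fintype V] (hG : G.Connected) (htop : G ≠ ⊤)
    (hn : Fintype.card V ≤ 3) : G ≅g pathGraph 3 := by
  classical
  obtain ⟨a, b, hab, hnab⟩ : ∃ a b, a ≠ b ∧ ¬G.Adj a b := by
    by_contra! h
    exact htop (by ext u v; exact ⟨fun h => h.ne, h u v⟩)
  have : Nontrivial V := ⟨a, b, hab⟩
  obtain ⟨d, hd⟩ := hG.preconnected.exists_adj_of_nontrivial a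
  have hbd : b ≠ d := by
    rintro rfl
    exact hnab hd
  have hall : ∀ v, v = a ∨ v = d ∨ v = b := by
    intro v
    by_contra! hv
    have h4 : ({v, a, d, b} : Finset V).card = 4 := by
      rw [Finset.card_insert_of_notMem (by simp [hv]), Finset.card_insert_of_notMem
        (by simp [hab, hd.ne]), Finset.card_pair hbd.symm]
    have := Finset.card_le_univ ({v, a, d, b} : Finset V)
    omega
  have hdb : G.Adj d b := by
    obtain ⟨w, hw⟩ := hG.preconnected.exists_adj_of_nontrivial b
    rcases hall w with rfl | rfl | rfl
    · exact absurd hw.symm hnab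
    · exact hw.symm
    · exact absurd rfl hw.ne
  have hinj : Function.Injective ![a, d, b] := by
    have := hd.ne
    intro i j
    fin_cases i <;> fin_cases j <;> simp [hab, hab.symm, hd.ne, hd.ne', hbd, hbd.symm]
  have hsurj : Function.Surjective ![a, d, b] := by
    intro v
    rcases hall v with rfl | rfl | rfl
    exacts [⟨0, rfl⟩, ⟨1, rfl⟩, ⟨2, rfl⟩]
  refine Isom.symm ⟨⟨Equiv.ofBijective _ ⟨hinj, hsurj⟩, ?_⟩⟩
  intro i j
  change G.Adj (![a, d, b] i) (![a, d, b] j) ↔ _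
  fin_cases i <;> fin_cases j <;>
    simp [pathGraph_adj, hd, hd.symm, hdb, hdb.symm, hnab, G.adj_comm b a]

/-- The members of the seventeen families that are not among the fifteen. -/
theorem BaseFamily.cases [Fintype V] (hF : BaseFamily G) : EqualFamily G ∨
    (G ≅g K (Fintype.card V - 2) ⊕g K 2) ∨ (G ≅g pathGraph 3 ⊕g E 2) ∨
    (∃ m : ℕ, 3 ≤ m ∧ (G ≅g K m ⊕g E 2)) ∨ (G ≅g (K 2 ⊕g K 2) ⊕g K 1) ∨
    (G ≅g pathGraph 4) ∨ ∃ r : ℕ, 2 ≤ r ∧ (G ≅g E r ⊕g K 2) := by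
  have hP4 : ∀ {M : Fin 4 → CMGraph}, (G ≅g subst G5 M) → (∀ i, (M i).order = 1) →
      G ≅g pathGraph 4 := fun h hM => by
    rw [← G5_eq_pathGraph]
    exact h.trans (isom_subst_of_order_one hM)
  have horder : ∀ {M : CMGraph}, (M.graph ≅g K 1) → M.order = 1 := fun h => by
    simpa using h.elim fun e => Fintype.card_congr e.toEquiv
  cases hF with
  | a h => exact Or.inl (.c1 h)
  | b h => exact Or.inl (.c2 h)
  | c h => exact Or.inl (.c3 h)
  | d h => exact Or.inl (.c4 h)
  | e r hr h => exact Or.inr (Or.inr (Or.inr (Or.inr (Or.inr (Or.inr ⟨r, hr, h⟩)))))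
  | f r hr M h => exact Or.inl (.c6 r hr M h)
  | g M₁ M₂ M₃ h =>
    by_cases hK : M₁.graph ∨g M₂.graph ∨g M₃.graph = ⊤
    · refine Or.inr (Or.inl (h.trans (Isom.sum ?_ (Isom.refl _))))
      have hc : Fintype.card V = _ := h.elim fun e => Fintype.card_congr e.toEquiv
      rw [Fintype.card_sum, Fintype.card_fin 2] at hc
      rw [hK, hc, Nat.add_sub_cancel, ← Nat.card_eq_fintype_card]
      exact isom_complete fun u v huv => huv
    · exact Or.inl (.c12 M₁ M₂ M₃ hK h)
  | h M₁ M₂ h =>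
    have h1 := M₁.order_pos
    have h2 := M₂.order_pos
    by_cases hK : M₁.graph ∨g M₂.graph = ⊤
    · have hiso : M₁.graph ∨g M₂.graph ≅g K (M₁.order + M₂.order) := by
        have := isom_complete (G := M₁.graph ∨g M₂.graph) fun u v huv => by rw [hK]; exact huv
        rwa [Nat.card_sum, Nat.card_fin, Nat.card_fin] at this
      by_cases h3 : 3 ≤ M₁.order + M₂.order
      · exact Or.inr (Or.inr (Or.inr (Or.inl ⟨_, h3, h.trans (hiso.sum (Isom.refl _))⟩)))
      · have h4 : M₁.order + M₂.order = 2 := by omega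
        rw [h4] at hiso
        exact Or.inr (Or.inr (Or.inr (Or.inr (Or.inr (Or.inr ⟨2, le_rfl,
          (h.trans (hiso.sum (Isom.refl _))).trans ⟨Iso.sumComm⟩⟩)))))
    · by_cases h4 : 4 ≤ M₁.order + M₂.order
      · exact Or.inl (.c13 M₁ M₂ hK h4 h)
      · exact Or.inr (Or.inr (Or.inl (h.trans (Isom.sum (isom_path_three connected_join hK (by
          simp only [Fintype.card_sum, Fintype.card_fin]
          omega)) (Isom.refl _)))))
  | i h => exact Or.inl (.c5 h)
  | j M₁ M₂ h => exact Or.inl (.c8 M₁ M₂ h)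
  | k h => exact Or.inr (Or.inr (Or.inr (Or.inr (Or.inl h))))
  | l M h => exact Or.inl (.c7 M h)
  | m M₁ M₂ M₃ Γ hΓ h => exact Or.inl (.c10 M₁ M₂ M₃ Γ hΓ h)
  | n M₁ M₂ h =>
    by_cases hne : ¬(M₁.graph ≅g K 1) ∨ ¬(M₂.graph ≅g K 1)
    · exact Or.inl (.c14 M₁ M₂ hne h)
    · rw [not_or, not_not, not_not] at hne
      refine Or.inr (Or.inr (Or.inr (Or.inr (Or.inr (Or.inl (hP4 h fun i => ?_))))))
      fin_cases i
      exacts [horder hne.1, horder hne.2, rfl, rfl]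
  | o M₁ M₂ h =>
    by_cases hne : ¬(M₁.graph ≅g K 1) ∨ ¬(M₂.graph ≅g K 1)
    · exact Or.inl (.c15 M₁ M₂ hne h)
    · rw [not_or, not_not, not_not] at hne
      refine Or.inr (Or.inr (Or.inr (Or.inr (Or.inr (Or.inl (hP4 h fun i => ?_))))))
      fin_cases i
      exacts [rfl, horder hne.1, horder hne.2, rfl]
  | p M₁ M₂ M₃ h => exact Or.inl (.c11 M₁ M₂ M₃ h)
  | q M₁ M₂ M₃ M₄ h => exact Or.inl (.c9 M₁ M₂ M₃ M₄ h)

/-- The graphs for which a second copy needs exactly one further color. -/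
theorem chiD_sum_self_eq_add_one [Fintype V] (hn : 4 ≤ Fintype.card V)
    (hG : chiD G = Fintype.card V - 2)
    (h : (G ≅g K (Fintype.card V - 2) ⊕g K 2) ∨ (G ≅g pathGraph 3 ⊕g E 2) ∨
      (∃ m : ℕ, 3 ≤ m ∧ (G ≅g K m ⊕g E 2)) ∨ (G ≅g (K 2 ⊕g K 2) ⊕g K 1) ∨
      (G ≅g pathGraph 4)) : chiD (G ⊕g G) = chiD G + 1 := by
  rcases h with h | h | ⟨m, hm, h⟩ | h | h
  · have h3 : 3 ≤ Fintype.card V - 2 := by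
      by_contra! h3
      have h4 : Fintype.card V - 2 = 2 := by omega
      have h5 := lt_chiD_sum_complete 2 (by norm_num)
      rw [h4] at h hG
      rw [chiD_congr h] at hG
      omega
    rw [h.chiD_sum_self, chiD_complete_sum_two h3, hG]
  all_goals have hc := h.elim fun e => Fintype.card_congr e.toEquiv
  · rw [h.chiD_sum_self, chiD_path_sum_edgeless, hG, hc]
    simp
  · rw [h.chiD_sum_self, chiD_complete_sum_edgeless hm, hG, hc]
    simp
  · rw [h.chiD_sum_self, chiD_two_edges_sum_one, hG, hc]
    simp
  · rw [h.chiD_sum_self, chiD_path_sum, hG, hc]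
    · simp
    · rw [← chiD_congr h, hG, hc]
      simp

theorem chiD_sum_self_eq_two_mul [Fintype V] (hG : chiD G = Fintype.card V - 2) {r : ℕ}
    (hr : 2 ≤ r) (h : G ≅g E r ⊕g K 2) : chiD G = r ∧ chiD (G ⊕g G) = 2 * r := by
  have hc := h.elim fun e => Fintype.card_congr e.toEquiv
  rw [h.chiD_sum_self, chiD_edgeless_sum hr, hG, hc]
  simp

end Families
end DistChrom

open DistChrom
theorem mainTheorem8 {V : Type*} [Fintype V] (G : SimpleGraph V)
    (hn : 4 ≤ Fintype.card V) (hG : chiD G = Fintype.card V - 2) :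
    (chiD (G ⊕g G) = chiD G ↔
      (∃ (M : CMGraph) (k : ℕ) (F : SimpleGraph (Fin k)),
        BaseFamily F ∧ (G ≅g M.graph ∨g F)) ∨
      EqualFamily G) ∧
    (chiD (G ⊕g G) = chiD G + 1 ↔
      (G ≅g K (Fintype.card V - 2) ⊕g K 2) ∨
      (G ≅g SimpleGraph.pathGraph 3 ⊕g E 2) ∨
      (∃ m : ℕ, 3 ≤ m ∧ (G ≅g K m ⊕g E 2)) ∨
      (G ≅g (K 2 ⊕g K 2) ⊕g K 1) ∨
      (G ≅g SimpleGraph.pathGraph 4)) ∧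
    (chiD (G ⊕g G) = chiD G + 2 ↔ (G ≅g K 2 ⊕g E 2)) ∧
    (chiD (G ⊕g G) = 2 * chiD G ↔ ∃ r : ℕ, 2 ≤ r ∧ (G ≅g E r ⊕g K 2)) := by
  have hA : ((∃ (M : CMGraph) (k : ℕ) (F : SimpleGraph (Fin k)),
      BaseFamily F ∧ (G ≅g M.graph ∨g F)) ∨ EqualFamily G) → chiD (G ⊕g G) = chiD G := by
    rintro (⟨M, k, F, hF, h⟩ | h)
    · exact hF.chiD_sum_self_of_join h hG
    · exact h.chiD_sum_self hn hG
  have hB := chiD_sum_self_eq_add_one hn hG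
  have hC : (∃ r : ℕ, 2 ≤ r ∧ (G ≅g E r ⊕g K 2)) → chiD (G ⊕g G) = 2 * chiD G := by
    rintro ⟨r, hr, h⟩
    obtain ⟨h1, h2⟩ := chiD_sum_self_eq_two_mul hG hr h
    rw [h1, h2]
  have hcases : ((∃ (M : CMGraph) (k : ℕ) (F : SimpleGraph (Fin k)),
      BaseFamily F ∧ (G ≅g M.graph ∨g F)) ∨ EqualFamily G) ∨
      ((G ≅g K (Fintype.card V - 2) ⊕g K 2) ∨ (G ≅g SimpleGraph.pathGraph 3 ⊕g E 2) ∨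
        (∃ m : ℕ, 3 ≤ m ∧ (G ≅g K m ⊕g E 2)) ∨ (G ≅g (K 2 ⊕g K 2) ⊕g K 1) ∨
        (G ≅g SimpleGraph.pathGraph 4)) ∨ ∃ r : ℕ, 2 ≤ r ∧ (G ≅g E r ⊕g K 2) := by
    rcases exists_baseFamily hn hG with h | h
    · exact Or.inl (Or.inl h)
    · rcases h.cases with h | h | h | h | h | h | h
      · exact Or.inl (Or.inr h)
      · exact Or.inr (Or.inl (Or.inl h))
      · exact Or.inr (Or.inl (Or.inr (Or.inl h)))
      · exact Or.inr (Or.inl (Or.inr (Or.inr (Or.inl h))))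
      · exact Or.inr (Or.inl (Or.inr (Or.inr (Or.inr (Or.inl h)))))
      · exact Or.inr (Or.inl (Or.inr (Or.inr (Or.inr (Or.inr h)))))
      · exact Or.inr (Or.inr h)
  have hcomm : ∀ {r : ℕ}, r = 2 → ((G ≅g K 2 ⊕g E 2) ↔ (G ≅g E r ⊕g K 2)) := by
    rintro r rfl
    exact ⟨fun h => h.trans ⟨SimpleGraph.Iso.sumComm⟩, fun h => h.trans ⟨SimpleGraph.Iso.sumComm⟩⟩
  have hchi : 2 ≤ chiD G := by omega
  refine ⟨⟨fun h => ?_, hA⟩, ⟨fun h => ?_, hB⟩, ⟨fun h => ?_, fun h => ?_⟩, ⟨fun h => ?_, hC⟩⟩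
  · rcases hcases with h' | h' | h'
    · exact h'
    · have := hB h'
      omega
    · have := hC h'
      omega
  · rcases hcases with h' | h' | h'
    · have := hA h'
      omega
    · exact h'
    · have := hC h'
      obtain ⟨r, hr, h'⟩ := h'
      omega
  · rcases hcases with h' | h' | h'
    · have := hA h'
      omega
    · have := hB h'
      omega
    · obtain ⟨r, hr, h'⟩ := h'
      obtain ⟨h1, h2⟩ := chiD_sum_self_eq_two_mul hG hr h'
      exact (hcomm (by omega)).2 h'
  · obtain ⟨h1, h2⟩ := chiD_sum_self_eq_two_mul hG le_rfl ((hcomm rfl).1 h)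
    omega
  · rcases hcases with h' | h' | h'
    · have := hA h'
      omega
    · have := hB h'
      omega
    · exact h'
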